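/- **Setting.** Let $0<\mu<1$ and consider the planar Euler problem of two fixed centers, $H=\tfrac12|p|^2+V(q)$, $V(q)=-\frac{1-\mu}{|q-E|}-\frac{\mu}{|q-M|}$, with $E=(-\tfrac12,0)$, $M=(\tfrac12,0)$, at energies $c<c_1=-1-2\sqrt{\mu(1-\mu)}$. Use elliptic coordinates $q=(\tfrac12\cosh\lambda\cos\nu,\tfrac12\sinh\lambda\sin\nu)$ and regularize collisions by the Hamiltonian $K=(H-c)(\cosh^2\lambda-\cos^2\nu)=K_\lambda+K_\nu$ with $K_\lambda=2p_\lambda^2-2\cosh\lambda-c\cosh^2\lambda$, $K_\nu=2p_\nu^2+2(1-2\mu)\cos\nu+c\cos^2\nu$, on $K=0$; let $G=K_\lambda=-K_\nu$ be the second integral, with value $g$. The region $S$ is $-2<g+c<-2|1-2\mu|$ and the region $S'$ is $-2|1-2\mu|<g+c<2|1-2\mu|$ (both with $c<c_1$). Fix a primary $e\in\{E,M\}$ and coprime positive integers $k,l$. A *$T_{k,l}$-type orbit* around $e$ is a regularized orbit with $(g,c)\in S\cup S'$ in the component of the Hill's region $\{V\le c\}$ (with the primaries included) containing $e$, such that the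 minimal periods of $\lambda$ and $\nu$ satisfy $T_\nu/T_\lambda=k/l$; its closed curve is the curve of $q-e$ over one minimal period in phase space (that is, modulo $2\pi$ in $\nu$ and modulo $(\lambda,\nu,p_\lambda,p_\nu)\sim(-\lambda,-\nu,-p_\lambda,-p_\nu)$). The $T_{k,l}$-torus family around $e$ consists of all these orbits, for all such $(g,c)$. Advancing the $\lambda$-motion of an orbit by a time $\sigma$ relative to its $\nu$-motion gives the *circle family* of orbits on its Liouville torus. An orbit is *singular* if it collides with $e$ or touches the boundary of the Hill's region. A *generic immersion* is an immersed closed curve whose only multiple points are transverse double points. As there is no magnetic field, a *Stark–Zeeman homotopy* here means a Stark homotopy: a $C^1$-continuous one-parameter family $(K^s)_{s\in[0,1]}$ of smooth closed curves such that each $K^s$ is a generic immersion in $\mathbb C\setminus\{0\}$, except at finitely many $s\in(0,1)$, where $K^s$ either is one of the distinguished orbits with inverse self-tangencies (*brake–brake*: touches the boundary of the Hill's region at two distinct points; *collision–collision*: collides with $e$ twice with distinct momenta; *brake–collision*: touches the boundary and collides) or is an immersion in $\mathbb C\setminus\{0\}$ that is generic but for one triple point with pairwise transverse branches. $J^+$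 is Arnold's invariant of generic immersions (it changes by $\pm2$ at positive/negative crossings through a direct self-tangency, does not change at inverse self-tangencies and at triple points, and equals $0$ on the figure eight $K_0$ and $2-2j$ on the standard curve $K_j$, $j\ge1$, a circle with $j-1$ small interior loops). For a generic immersion $K$ in $\mathbb C\setminus\{0\}$ with winding number $w_0(K)$ about $0$, $\mathcal J_1(K)=J^+(K)+w_0(K)^2/2$, and $\mathcal J_2(K)$ is $J^+$ of the preimage of $K$ under $z\mapsto z^2$ if $w_0(K)$ is odd and of one of the two components of the preimage if $w_0(K)$ is even. **Proposition 4.2.** The $T_{k,l}$-torus family around $e$ in the regions $S$ and $S'$ is a Stark–Zeeman homotopy, in the following sense. 1. On each torus of the family, only finitely many parameters $\sigma$ in any bounded interval $[a,b]$ give a singular orbit, and the circle family over $[a,b]$ is a Stark–Zeeman homotopy whenever its two end orbits are not singular. 2. Every continuous one-parameter subfamily, indexed by $s\in[0,1]$ (with $(g,c)$ allowed to vary), of the torus family whose members are singular at only finitely many $s$, and not at $s=0,1$, is a Stark–Zeeman homotopy. Moreover $\mathcal J_1$ and $\mathcal J_2$ are constant on the torus family and can hence be computed from a single representative: there are $j_1\in\mathbb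 Q$, $j_2\in\mathbb Z$ (depending only on $\mu,e,k,l$) such that $\mathcal J_1=j_1$ and $\mathcal J_2=j_2$ for each non-singular orbit of the family, and for a singular orbit of the family all sufficiently small non-zero shifts $\sigma$ of it along its torus are generic immersions in $\mathbb C\setminus\{0\}$ with $\mathcal J_1=j_1$ and $\mathcal J_2=j_2$ (so that these are the invariants of the singular orbit, defined through its perturbations). -/

import Mathlib

open Set Filter Topology

namespace TwoCenter

noncomputable section

/-! ### Closed plane curves

A closed curve is a 1-periodic map `ℝ → ℂ`; its parameters are taken in `[0,1)`. -/

/-- The parameters in `[0,1)` at which `γ` passes through `p`. -/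
def fiber (γ : ℝ → ℂ) (p : ℂ) : Set ℝ := {t | t ∈ Ico (0 : ℝ) 1 ∧ γ t = p}

/-- Linear independence over `ℝ` of two plane vectors. -/
def Transverse (a b : ℂ) : Prop := a.re * b.im - a.im * b.re ≠ 0

/-- The two vectors are nonzero and have the same direction. -/
def SameDirection (a b : ℂ) : Prop := a ≠ 0 ∧ ∃ r : ℝ, 0 < r ∧ b = (r : ℂ) * a

/-- The two vectors are nonzero and have opposite directions. -/
def OppositeDirection (a b : ℂ) : Prop := a ≠ 0 ∧ ∃ r : ℝ, r < 0 ∧ b = (r : ℂ) * a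

/-- Immersions of the circle in the plane. -/
structure IsImmersedLoop (γ : ℝ → ℂ) : Prop where
  periodic : Function.Periodic γ 1
  contDiff : ContDiff ℝ 1 γ
  deriv_ne_zero : ∀ t, deriv γ t ≠ 0

/-- A generic immersion: the only multiple points are transverse double points. -/
structure IsGenericImmersion (γ : ℝ → ℂ) : Prop extends IsImmersedLoop γ where
  transverse : ∀ t ∈ Ico (0 : ℝ) 1, ∀ u ∈ Ico (0 : ℝ) 1, t ≠ u → γ t = γ u →
    Transverse (deriv γ t) (deriv γ u)
  fiber_le_two : ∀ p, (fiber γ p).encard ≤ 2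

/-- A generic immersion in `ℂ \ {0}`. -/
def IsGenericImmersionAvoidingZero (γ : ℝ → ℂ) : Prop :=
  IsGenericImmersion γ ∧ ∀ t, γ t ≠ 0

/-- The number of double points of a generic immersion. -/
def numDouble (γ : ℝ → ℂ) : ℕ := {p : ℂ | (fiber γ p).encard = 2}.ncard

/-- An immersion that is generic except for exactly one triple point, whose three branches are
pairwise transverse. -/
structure HasOneTriplePoint (γ : ℝ → ℂ) : Prop extends IsImmersedLoop γ where
  transverse : ∀ t ∈ Ico (0 : ℝ) 1, ∀ u ∈ Ico (0 : ℝ) 1, t ≠ u → γ t = γ u →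
    Transverse (deriv γ t) (deriv γ u)
  triple : ∃ p, (fiber γ p).encard = 3 ∧ ∀ p', p' ≠ p → (fiber γ p').encard ≤ 2

/-- An immersion that is generic except for exactly one self-tangency, the two tangent vectors at
which are related by `D` (same direction: direct; opposite directions: inverse). -/
structure HasOneTangency (D : ℂ → ℂ → Prop) (γ : ℝ → ℂ) : Prop extends IsImmersedLoop γ where
  fiber_le_two : ∀ p, (fiber γ p).encard ≤ 2
  tangency : ∃ t₀ ∈ Ico (0 : ℝ) 1, ∃ u₀ ∈ Ico (0 : ℝ) 1, t₀ < u₀ ∧ γ t₀ = γ u₀ ∧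
    D (deriv γ t₀) (deriv γ u₀) ∧
    ∀ t ∈ Ico (0 : ℝ) 1, ∀ u ∈ Ico (0 : ℝ) 1, t < u → γ t = γ u → (t, u) ≠ (t₀, u₀) →
      Transverse (deriv γ t) (deriv γ u)

/-! ### Generic homotopies and Arnold's `J⁺` -/

/-- A one-parameter family `(Γ s)`, `s ∈ [0,1]`, of closed `C¹` curves, continuous in the `C¹`
topology. -/
structure IsC1Family (Γ : ℝ → ℝ → ℂ) : Prop where
  periodic : ∀ s ∈ Icc (0 : ℝ) 1, Function.Periodic (Γ s) 1
  contDiff : ∀ s ∈ Icc (0 : ℝ) 1, ContDiff ℝ 1 (Γ s)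
  continuousOn : ContinuousOn (fun x : ℝ × ℝ => Γ x.1 x.2) (Icc (0 : ℝ) 1 ×ˢ univ)
  continuousOn_deriv :
    ContinuousOn (fun x : ℝ × ℝ => deriv (Γ x.1) x.2) (Icc (0 : ℝ) 1 ×ˢ univ)

/-- At the time `s` the family crosses a direct self-tangency in the positive direction: the number
of double points increases by two. -/
def PositiveDirectCrossing (Γ : ℝ → ℝ → ℂ) (s : ℝ) : Prop :=
  HasOneTangency SameDirection (Γ s) ∧
  ∃ ε > 0, ∀ s₁ ∈ Ioo (s - ε) s, ∀ s₂ ∈ Ioo s (s + ε),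
    numDouble (Γ s₂) = numDouble (Γ s₁) + 2

/-- At the time `s` the family crosses a direct self-tangency in the negative direction. -/
def NegativeDirectCrossing (Γ : ℝ → ℝ → ℂ) (s : ℝ) : Prop :=
  HasOneTangency SameDirection (Γ s) ∧
  ∃ ε > 0, ∀ s₁ ∈ Ioo (s - ε) s, ∀ s₂ ∈ Ioo s (s + ε),
    numDouble (Γ s₁) = numDouble (Γ s₂) + 2

/-- A generic (regular) homotopy: every member is a generic immersion, except at finitely many
`s ∈ (0,1)`, where there is one triple point, one inverse self-tangency or a crossing through one
direct self-tangency. -/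
structure IsGenericHomotopy (Γ : ℝ → ℝ → ℂ) : Prop extends IsC1Family Γ where
  exceptional : ∃ D : Set ℝ, D.Finite ∧ D ⊆ Ioo (0 : ℝ) 1 ∧
    (∀ s ∈ Icc (0 : ℝ) 1, s ∉ D → IsGenericImmersion (Γ s)) ∧
    ∀ s ∈ D, HasOneTriplePoint (Γ s) ∨ HasOneTangency OppositeDirection (Γ s) ∨
      PositiveDirectCrossing Γ s ∨ NegativeDirectCrossing Γ s

/-- The point `e^{2πit}`. -/
def circlePoint (t : ℝ) : ℂ := Complex.exp (2 * Real.pi * t * Complex.I)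

/-- The standard curves: `K₀` is a figure eight, `K₁` is a circle, and `K_j`, `j ≥ 2`, is a circle
with `j - 1` small interior loops (an epitrochoid), of rotation number `j`. -/
def standardCurve (j : ℕ) (t : ℝ) : ℂ :=
  if j = 0 then (Real.sin (2 * Real.pi * t) : ℂ) + (Real.sin (4 * Real.pi * t) : ℂ) * Complex.I
  else circlePoint t + (3 / (2 * j) : ℂ) * circlePoint (j * t)

/-- The normalization `J⁺(K₀) = 0`, `J⁺(K_j) = 2 - 2j` for `j ≥ 1`. -/
def standardJPlus (j : ℕ) : ℤ := if j = 0 then 0 else 2 - 2 * j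

/-- `m` is the value of Arnold's `J⁺` of `γ`, read off along a generic homotopy to a standard curve
from `γ`, or from `γ` with the reversed orientation: `J⁺` increases (decreases) by two at each
positive (negative) crossing through a direct self-tangency, and does not change at triple points
and at inverse self-tangencies. -/
def HasJPlus (γ : ℝ → ℂ) (m : ℤ) : Prop :=
  ∃ (j : ℕ) (Γ : ℝ → ℝ → ℂ), IsGenericHomotopy Γ ∧
    (Γ 0 = γ ∨ Γ 0 = fun t => γ (-t)) ∧ Γ 1 = standardCurve j ∧
    m = standardJPlus j - 2 * ({s ∈ Ioo (0 : ℝ) 1 | PositiveDirectCrossing Γ s}.ncard : ℤ)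
      + 2 * ({s ∈ Ioo (0 : ℝ) 1 | NegativeDirectCrossing Γ s}.ncard : ℤ)

/-- Arnold's `J⁺`-invariant of a generic immersion. -/
def JPlus (γ : ℝ → ℂ) : ℤ := Classical.epsilon (HasJPlus γ)

/-! ### The invariants `𝒥₁` and `𝒥₂` -/

/-- The winding number around the origin of a closed curve in `ℂ \ {0}`. -/
def windingNumber (γ : ℝ → ℂ) : ℤ :=
  Classical.epsilon fun n : ℤ => ∃ θ : ℝ → ℂ, Continuous θ ∧ (∀ t, γ t = Complex.exp (θ t)) ∧
    ∀ t, θ (t + 1) = θ t + n * (2 * Real.pi * Complex.I)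

/-- `𝒥₁ = J⁺ + w₀² / 2`. -/
def JOne (γ : ℝ → ℂ) : ℚ := JPlus γ + (windingNumber γ : ℚ) ^ 2 / 2

/-- A lift of `γ` under the complex squaring map. -/
def squareRootLift (γ : ℝ → ℂ) : ℝ → ℂ :=
  Classical.epsilon fun δ : ℝ → ℂ => Continuous δ ∧ ∀ t, δ t ^ 2 = γ t

open Classical in
/-- `𝒥₂` is `J⁺` of (a component of) the preimage under the squaring map. If the winding number is
even, a lift closes up after one period and is one of the two components; if it is odd, a lift
closes up after two periods and is the whole preimage. -/
def JTwo (γ : ℝ → ℂ) : ℤ :=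
  if Even (windingNumber γ) then JPlus (squareRootLift γ)
  else JPlus fun t => squareRootLift γ (2 * t)

/-! ### Stark homotopies: Stark–Zeeman homotopies in absence of a magnetic field

`V` is the potential (with its singularity at the origin) and `c` the energy. Curves are
parametrized by regularized time. -/

/-- `p` lies on the boundary of the Hill's region. -/
def OnHillBoundary (V : ℂ → ℝ) (c : ℝ) (p : ℂ) : Prop := p ≠ 0 ∧ V p = c

def HasInverseSelfTangency (γ : ℝ → ℂ) : Prop :=
  ∃ t ∈ Ico (0 : ℝ) 1, ∃ u ∈ Ico (0 : ℝ) 1, t ≠ u ∧ γ t = γ u ∧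
    OppositeDirection (deriv γ t) (deriv γ u)

/-- The boundary is touched at two distinct points. -/
def IsBrakeBrake (V : ℂ → ℝ) (c : ℝ) (γ : ℝ → ℂ) : Prop :=
  HasInverseSelfTangency γ ∧
    ∃ t u, OnHillBoundary V c (γ t) ∧ OnHillBoundary V c (γ u) ∧ γ t ≠ γ u

/-- There are two collisions with distinct momenta. In regularized time
`γ(t) ≈ γ''(t₀) (t - t₀)² / 2` near a collision, so the second derivative gives the direction of the
momentum. -/
def IsCollisionCollision (γ : ℝ → ℂ) : Prop :=
  HasInverseSelfTangency γ ∧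
    ∃ t u, γ t = 0 ∧ γ u = 0 ∧ deriv (deriv γ) t ≠ deriv (deriv γ) u

def IsBrakeCollision (V : ℂ → ℝ) (c : ℝ) (γ : ℝ → ℂ) : Prop :=
  HasInverseSelfTangency γ ∧ ∃ t u, OnHillBoundary V c (γ t) ∧ γ u = 0

/-- The disaster `(II⁺)` of a Stark homotopy. -/
def IsDistinguished (V : ℂ → ℝ) (c : ℝ) (γ : ℝ → ℂ) : Prop :=
  IsBrakeBrake V c γ ∨ IsCollisionCollision γ ∨ IsBrakeCollision V c γ

/-- A family `(K s)`, `s ∈ [0,1]`, of closed curves (of energy `c s`) is a Stark homotopy if its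
members are generic immersions in `ℂ \ {0}` except at finitely many `s ∈ (0,1)`, at which the
disaster `(II⁺)` (a distinguished orbit) or `(III)` (a triple point) happens. -/
structure IsStarkHomotopy (V : ℂ → ℝ) (c : ℝ → ℝ) (K : ℝ → ℝ → ℂ) : Prop
    extends IsC1Family K where
  smooth : ∀ s ∈ Icc (0 : ℝ) 1, ContDiff ℝ (⊤ : ℕ∞) (K s)
  exceptional : ∃ D : Set ℝ, D.Finite ∧ D ⊆ Ioo (0 : ℝ) 1 ∧
    (∀ s ∈ Icc (0 : ℝ) 1, s ∉ D → IsGenericImmersionAvoidingZero (K s)) ∧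
    ∀ s ∈ D, IsDistinguished V (c s) (K s) ∨ (HasOneTriplePoint (K s) ∧ ∀ t, K s t ≠ 0)

/-! ### The Euler problem of two fixed centers -/

inductive Primary
  | earth
  | moon

/-- The Earth is at `(-1/2, 0)` and the Moon is at `(1/2, 0)`. -/
def Primary.pos : Primary → ℂ
  | .earth => -1 / 2
  | .moon => 1 / 2

/-- The potential; the masses of the Earth and the Moon are `1 - μ` and `μ`. -/
def potential (μ : ℝ) (q : ℂ) : ℝ :=
  -(1 - μ) / ‖q - Primary.earth.pos‖ - μ / ‖q - Primary.moon.pos‖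

/-- The Hill's region at energy `c`; it contains the primaries, where the potential is `-∞`. -/
def hillRegion (μ c : ℝ) : Set ℂ :=
  {q | q = Primary.earth.pos ∨ q = Primary.moon.pos ∨ potential μ q ≤ c}

/-- The component of the Hill's region around a primary. -/
def hillComponent (μ c : ℝ) (e : Primary) : Set ℂ := connectedComponentIn (hillRegion μ c) e.pos

/-- The critical energy. -/
def criticalEnergy (μ : ℝ) : ℝ := -1 - 2 * Real.sqrt (μ * (1 - μ))

/-- The region `S` of the values `(g, c)` of the integral `G` and the energy, below the critical
energy: there is motion around both primaries. -/
def InRegionS (μ g c : ℝ) : Prop :=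
  c < criticalEnergy μ ∧ -2 < g + c ∧ g + c < -2 * |1 - 2 * μ|

/-- The region `S'`, below the critical energy: there is motion around the heavier primary only. -/
def InRegionS' (μ g c : ℝ) : Prop :=
  c < criticalEnergy μ ∧ -2 * |1 - 2 * μ| < g + c ∧ g + c < 2 * |1 - 2 * μ|

/-- A curve in the phase space in (double covered) elliptic coordinates `(λ, ν)` with conjugate
momenta; the angle `ν` is lifted to `ℝ`. -/
structure EllipticPath where
  lam : ℝ → ℝ
  nu : ℝ → ℝ
  plam : ℝ → ℝ
  pnu : ℝ → ℝ

namespace EllipticPath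

/-- The position `(½ cosh λ cos ν, ½ sinh λ sin ν)`. -/
def pos (z : EllipticPath) (t : ℝ) : ℂ :=
  ⟨Real.cosh (z.lam t) * Real.cos (z.nu t) / 2, Real.sinh (z.lam t) * Real.sin (z.nu t) / 2⟩

/-- Hamilton's equations of the regularized Hamiltonian `K = K_λ + K_ν`, where
`K_λ = 2 p_λ² - 2 cosh λ - c cosh² λ` and `K_ν = 2 p_ν² + 2 (1 - 2μ) cos ν + c cos² ν`, on the joint
level `K = 0`, `G = g`, that is, `K_λ = g` and `K_ν = -g`. -/
structure IsRegularizedOrbit (μ g c : ℝ) (z : EllipticPath) : Prop where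
  deriv_lam : ∀ t, HasDerivAt z.lam (4 * z.plam t) t
  deriv_nu : ∀ t, HasDerivAt z.nu (4 * z.pnu t) t
  deriv_plam : ∀ t, HasDerivAt z.plam
    (2 * Real.sinh (z.lam t) + 2 * c * Real.cosh (z.lam t) * Real.sinh (z.lam t)) t
  deriv_pnu : ∀ t, HasDerivAt z.pnu
    (2 * (1 - 2 * μ) * Real.sin (z.nu t) + 2 * c * Real.cos (z.nu t) * Real.sin (z.nu t)) t
  level_lam : ∀ t, 2 * z.plam t ^ 2 - 2 * Real.cosh (z.lam t) - c * Real.cosh (z.lam t) ^ 2 = g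
  level_nu : ∀ t, 2 * z.pnu t ^ 2 + 2 * (1 - 2 * μ) * Real.cos (z.nu t)
    + c * Real.cos (z.nu t) ^ 2 = -g

/-- The phase space points at the times `t` and `u` coincide: the coordinates agree modulo `2π` in
`ν`, possibly after exchanging the two sheets by `(λ, ν, p_λ, p_ν) ↦ (-λ, -ν, -p_λ, -p_ν)`. -/
def SamePhasePoint (z : EllipticPath) (t u : ℝ) : Prop :=
  (z.lam t = z.lam u ∧ (∃ n : ℤ, z.nu t = z.nu u + n * (2 * Real.pi)) ∧
    z.plam t = z.plam u ∧ z.pnu t = z.pnu u) ∨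
  (z.lam t = -z.lam u ∧ (∃ n : ℤ, z.nu t = -z.nu u + n * (2 * Real.pi)) ∧
    z.plam t = -z.plam u ∧ z.pnu t = -z.pnu u)

/-- The minimal period of a periodic orbit. -/
def minPeriod (z : EllipticPath) : ℝ := sInf {P | 0 < P ∧ ∀ t, z.SamePhasePoint (t + P) t}

/-- The closed curve traced, relative to the primary `e`, by the simply covered periodic orbit. -/
def loop (e : Primary) (z : EllipticPath) (t : ℝ) : ℂ := z.pos (z.minPeriod * t) - e.pos

/-- The orbits on the Liouville torus through `z`: the motion in `λ` is advanced by `σ` relative to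
the motion in `ν`. -/
def shift (σ : ℝ) (z : EllipticPath) : EllipticPath where
  lam t := z.lam (t + σ)
  nu := z.nu
  plam t := z.plam (t + σ)
  pnu := z.pnu

/-- `T` is the minimal period of `f`. -/
def IsMinPeriod (f : ℝ → ℝ) (T : ℝ) : Prop := IsLeast {T | 0 < T ∧ Function.Periodic f T} T

/-- A `T_{k,l}`-type orbit around the primary `e`, on the Liouville torus `(G, H) = (g, c)` in the
region `S` or `S'`: the rotation number `T_ν / T_λ` equals `k / l`. -/
structure IsTorusOrbit (μ : ℝ) (e : Primary) (k l : ℕ) (g c : ℝ) (z : EllipticPath) : Prop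
    extends IsRegularizedOrbit μ g c z where
  region : InRegionS μ g c ∨ InRegionS' μ g c
  near : ∀ t, z.pos t ∈ hillComponent μ c e
  rotation : ∃ Tlam Tnu : ℝ, IsMinPeriod z.lam Tlam ∧ IsMinPeriod z.nu Tnu ∧
    Tnu / Tlam = (k : ℝ) / l

/-- The orbit collides with the primary `e` or touches the boundary of the Hill's region. -/
def IsSingular (μ : ℝ) (e : Primary) (c : ℝ) (z : EllipticPath) : Prop :=
  ∃ t, z.pos t = e.pos ∨ potential μ (z.pos t) = c

/-- A continuous one-parameter subfamily of the (two-parameter) `T_{k,l}`-torus family. -/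
structure IsTorusSubfamily (μ : ℝ) (e : Primary) (k l : ℕ) (g c : ℝ → ℝ)
    (z : ℝ → EllipticPath) : Prop where
  orbit : ∀ s ∈ Icc (0 : ℝ) 1, IsTorusOrbit μ e k l (g s) (c s) (z s)
  continuousOn_g : ContinuousOn g (Icc 0 1)
  continuousOn_c : ContinuousOn c (Icc 0 1)
  continuousOn_lam : ContinuousOn (fun x : ℝ × ℝ => (z x.1).lam x.2) (Icc (0 : ℝ) 1 ×ˢ univ)
  continuousOn_nu : ContinuousOn (fun x : ℝ × ℝ => (z x.1).nu x.2) (Icc (0 : ℝ) 1 ×ˢ univ)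
  continuousOn_plam : ContinuousOn (fun x : ℝ × ℝ => (z x.1).plam x.2) (Icc (0 : ℝ) 1 ×ˢ univ)
  continuousOn_pnu : ContinuousOn (fun x : ℝ × ℝ => (z x.1).pnu x.2) (Icc (0 : ℝ) 1 ×ˢ univ)

end EllipticPath

/-- The potential in the coordinate centered at the primary `e`. -/
def centeredPotential (μ : ℝ) (e : Primary) (p : ℂ) : ℝ := potential μ (p + e.pos)

end

end TwoCenter

open TwoCenter TwoCenter.EllipticPath

/-! The problem separates. Put `w = λ + i(ν - ν_e)`, with `ν_e` the value of `ν` at the primary.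
Along a torus orbit each of `λ` and `ν - ν_e` is a one-degree-of-freedom oscillation with the
symmetries of a sine: odd, symmetric about its turning points, monotone between them
(`exists_profile`). So `w` runs through a Lissajous curve with frequency ratio `k : l`
(`exists_isTorusMotion`), and `q - e = (ε sinh (w/2))²` with `ε² = ±1`, a double cover branched at
the collision `w = 0` (`pos_sub`). Position and momentum then depend only on two phases `(x, y)`,
taken modulo `ℤ²` together with the half shift `(½, ½)` that exchanges the sheets.

Two times give the same point of the plane only if their phases agree up to reflecting neither, one
or both of them (`coincidence`). Reflecting both is time reversal, whose fixed points are the brakes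
and the collisions. A non-singular orbit meets none of them, so only single reflections occur at its
double points. These make the branches transverse, and combining two of them excludes triple points
(`IsRegular.isGenericImmersion`). A singular orbit is retraced by time reversal, which gives the
inverse tangencies; half a period later it meets a second fixed point, so it is brake-brake,
collision-collision or brake-collision (`isDistinguished`). Hence no disasters other than the
distinguished orbits occur. They are isolated along a torus because singularity means that a phase
difference, affine in `σ`, is a quarter-integer (`HasType.isRegular_iff`, `finite_singular`).

For the invariants, oscillation profiles form a convex set. Two Lissajous curves of the same type
whose phase differences lie in the same interval between singular values are therefore joined by
linear interpolation through generic immersions avoiding `0` (`invariants_eq_of_phase`). Lattice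
translations and time reversal carry every non-singular phase difference into `(0, 1/4)`
(`exists_normal_form`), so one pair of values serves all tori. For `𝒥₂` the same argument applies to
the lifted Lissajous curve `ε sinh (w/2)` (`jTwo_eq`). In a family of tori the remaining point is
the continuity of the period (`continuous_period`). -/

namespace TwoCenter

/-! ### Winding numbers and square roots -/

/-- `n` is the increment, in units of `2πi`, of a logarithm of `γ` over one period. -/
def IsWinding (γ : ℝ → ℂ) (n : ℤ) : Prop :=
  ∃ θ : ℝ → ℂ, Continuous θ ∧ (∀ t, γ t = Complex.exp (θ t)) ∧
    ∀ t, θ (t + 1) = θ t + n * (2 * Real.pi * Complex.I)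

/-- The values lie in the discrete set `2πiℤ`. Applied to the difference of two logarithms of a
curve, this makes the winding number independent of the logarithm. -/
theorem constant_of_exp_eq {f : ℝ → ℂ} (hf : Continuous f)
    (h : ∀ t, Complex.exp (f t) = 1) (t u : ℝ) : f t = f u := by
  have hz : ∀ t, ∃ n : ℤ, f t = n * (2 * Real.pi * Complex.I) := fun t =>
    Complex.exp_eq_one_iff.1 (h t)
  choose n hn using hz
  have hpi : (2 * Real.pi * Complex.I : ℂ) ≠ 0 := Complex.two_pi_I_ne_zero
  have hre : ∀ t, ((n t : ℤ) : ℝ) = (f t / (2 * Real.pi * Complex.I)).re := by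
    intro t
    rw [hn t, mul_div_cancel_right₀ _ hpi, Complex.intCast_re]
  have hc : Continuous n := by
    rw [Int.isClosedEmbedding_coe_real.isInducing.continuous_iff]
    have : (((↑) : ℤ → ℝ) ∘ n) = fun t => (f t / (2 * Real.pi * Complex.I)).re := funext hre
    rw [this]
    exact Complex.continuous_re.comp (hf.div_const _)
  rw [hn t, hn u, PreconnectedSpace.constant inferInstance hc]

theorem IsWinding.unique {γ : ℝ → ℂ} {n m : ℤ} (hn : IsWinding γ n) (hm : IsWinding γ m) :
    n = m := by
  obtain ⟨θ, hθ, he, hp⟩ := hn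
  obtain ⟨η, hη, he', hp'⟩ := hm
  have h := constant_of_exp_eq (hθ.sub hη) (fun t => by
    rw [Pi.sub_apply, Complex.exp_sub, ← he, ← he', div_self]
    rw [he]; exact Complex.exp_ne_zero _) 1 0
  have h1 := hp 0
  have h2 := hp' 0
  rw [zero_add] at h1 h2
  simp only [Pi.sub_apply] at h
  have : ((n : ℂ) - m) * (2 * Real.pi * Complex.I) = 0 := by
    linear_combination h - h1 + h2
  have := (mul_eq_zero.1 this).resolve_right Complex.two_pi_I_ne_zero
  exact_mod_cast sub_eq_zero.1 this

theorem IsWinding.windingNumber_eq {γ : ℝ → ℂ} {n : ℤ} (hn : IsWinding γ n) :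
    windingNumber γ = n :=
  IsWinding.unique (Classical.epsilon_spec (p := IsWinding γ) ⟨n, hn⟩) hn

/-- A primitive of `γ'/γ` is a logarithm of `γ` up to a constant. The integral formula is part of
the conclusion because it is the quantity that visibly varies continuously in families. -/
theorem exists_isWinding {γ : ℝ → ℂ} (hp : Function.Periodic γ 1) (hγ : ContDiff ℝ 1 γ)
    (h0 : ∀ t, γ t ≠ 0) : ∃ n : ℤ, IsWinding γ n ∧
      ∫ t in (0 : ℝ)..1, deriv γ t / γ t = n * (2 * Real.pi * Complex.I) := by
  set f : ℝ → ℂ := fun t => deriv γ t / γ t with hf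
  have hfc : Continuous f := (hγ.continuous_deriv le_rfl).div hγ.continuous h0
  have hfp : Function.Periodic f 1 := by
    intro t
    simp only [hf, hp t]
    congr 1
    have : γ = fun t => γ (t + 1) := funext fun t => (hp t).symm
    conv_rhs => rw [this, deriv_comp_add_const]
  set I : ℝ → ℂ := fun t => ∫ x in (0 : ℝ)..t, f x with hI
  have hId : ∀ t, HasDerivAt I (f t) t := fun t =>
    intervalIntegral.integral_hasDerivAt_right (hfc.intervalIntegrable _ _)
      (hfc.stronglyMeasurableAtFilter _ _) hfc.continuousAt
  have hexp : ∀ t, γ t * Complex.exp (-I t) = γ 0 := by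
    have hd : ∀ t, HasDerivAt (fun t => γ t * Complex.exp (-I t)) 0 t := by
      intro t
      have h1 := ((hγ.differentiable one_ne_zero) t).hasDerivAt.mul (hId t).neg.cexp
      refine HasDerivAt.congr_deriv h1 ?_
      have h2 : f t = deriv γ t / γ t := rfl
      have := h0 t
      rw [h2]
      field_simp
      ring
    intro t
    have := is_const_of_deriv_eq_zero (fun t => (hd t).differentiableAt) (fun t => (hd t).deriv) t 0
    simpa [hI] using this
  have hγI : ∀ t, γ t = Complex.exp (Complex.log (γ 0) + I t) := by
    intro t
    rw [Complex.exp_add, Complex.exp_log (h0 0), ← hexp t, mul_assoc, ← Complex.exp_add]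
    simp
  have hI1 : Complex.exp (I 1) = 1 := by
    have h1 := hexp 1
    have : γ 1 = γ 0 := by simpa using hp 0
    rw [this] at h1
    have : Complex.exp (-I 1) = 1 := by
      exact mul_left_cancel₀ (h0 0) (by rw [h1, mul_one])
    rw [Complex.exp_neg] at this
    exact inv_eq_one.1 this
  obtain ⟨n, hn⟩ := Complex.exp_eq_one_iff.1 hI1
  refine ⟨n, ⟨fun t => Complex.log (γ 0) + I t, ?_, hγI, fun t => ?_⟩, hn⟩
  · exact continuous_const.add (continuous_iff_continuousAt.2 fun t => (hId t).continuousAt)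
  · have : I (t + 1) = I t + I 1 := by
      have h1 := intervalIntegral.integral_add_adjacent_intervals
        (hfc.intervalIntegrable (μ := MeasureTheory.volume) 0 t)
        (hfc.intervalIntegrable (μ := MeasureTheory.volume) t (t + 1))
      have h2 := hfp.intervalIntegral_add_eq t 0
      simp only [hI]
      rw [← h1, h2, zero_add]
    simp only [this, hn, add_assoc]

theorem IsWinding.reverse {γ : ℝ → ℂ} {n : ℤ} (h : IsWinding γ n) :
    IsWinding (fun t => γ (-t)) (-n) := by
  obtain ⟨θ, hθ, he, hp⟩ := h
  refine ⟨fun t => θ (-t), by fun_prop, fun t => he _, fun t => ?_⟩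
  have := hp (-(t + 1))
  rw [show -(t + 1) + 1 = -t by ring] at this
  simp only [this]
  push_cast
  ring

/-- The winding number is constant along homotopies in `ℂ \ {0}`. -/
theorem IsC1Family.isWinding {Γ : ℝ → ℝ → ℂ} (h : IsC1Family Γ)
    (h0 : ∀ s ∈ Icc (0 : ℝ) 1, ∀ t, Γ s t ≠ 0) :
    ∃ n, IsWinding (Γ 0) n ∧ IsWinding (Γ 1) n := by
  have hn := fun s : Icc (0 : ℝ) 1 =>
    exists_isWinding (h.periodic s s.2) (h.contDiff s s.2) (h0 s s.2)
  choose n hn hint using hn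
  have hc : Continuous fun s : Icc (0 : ℝ) 1 =>
      ∫ t in (0 : ℝ)..1, deriv (Γ s) t / Γ s t := by
    apply intervalIntegral.continuous_parametric_intervalIntegral_of_continuous'
    have hm : ∀ x : Icc (0 : ℝ) 1 × ℝ, ((x.1 : ℝ), x.2) ∈ Icc (0 : ℝ) 1 ×ˢ univ :=
      fun x => ⟨x.1.2, trivial⟩
    have hg : Continuous fun x : Icc (0 : ℝ) 1 × ℝ => ((x.1 : ℝ), x.2) := by fun_prop
    exact (h.continuousOn_deriv.comp_continuous hg hm).div
      (h.continuousOn.comp_continuous hg hm) fun x => h0 _ x.1.2 _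
  have hnc : Continuous n := by
    rw [Int.isClosedEmbedding_coe_real.isInducing.continuous_iff]
    have : (((↑) : ℤ → ℝ) ∘ n) = fun s : Icc (0 : ℝ) 1 =>
        ((∫ t in (0 : ℝ)..1, deriv (Γ s) t / Γ s t) / (2 * Real.pi * Complex.I)).re := by
      funext s
      rw [hint, mul_div_cancel_right₀ _ Complex.two_pi_I_ne_zero]
      simp
    rw [this]
    exact Complex.continuous_re.comp (hc.div_const _)
  have h01 : n ⟨0, by simp⟩ = n ⟨1, by simp⟩ :=
    PreconnectedSpace.constant inferInstance hnc
  exact ⟨n ⟨0, by simp⟩, hn ⟨0, by simp⟩, h01 ▸ hn ⟨1, by simp⟩⟩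

/-- The quotient `δ / η` is continuous with values in `{1, -1}`. -/
theorem eq_or_eq_neg_of_sq_eq {δ η : ℝ → ℂ} (hδ : Continuous δ) (hη : Continuous η)
    (h : ∀ t, δ t ^ 2 = η t ^ 2) (h0 : ∀ t, η t ≠ 0) : δ = η ∨ δ = fun t => -η t := by
  have hc : Continuous fun t => δ t / η t := hδ.div hη h0
  have h1 : ∀ t, δ t / η t = 1 ∨ δ t / η t = -1 := fun t => by
    have : (δ t / η t) ^ 2 = 1 := by rw [div_pow, h t, div_self (pow_ne_zero _ (h0 t))]
    exact sq_eq_one_iff.1 this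
  have hre : ∀ t, δ t / η t = ((δ t / η t).re : ℂ) := fun t => by
    rcases h1 t with h | h <;> simp [h]
  have hconst : ∀ t, δ t / η t = δ 0 / η 0 := fun t => by
    refine IsPreconnected.constant_of_mapsTo (S := univ) isPreconnected_univ
      (T := {1, -1}) ?_ hc.continuousOn (fun t _ => h1 t) trivial trivial
    exact (Set.toFinite _).isDiscrete
  rcases h1 0 with h | h
  · left; funext t
    have := hconst t
    rw [h, div_eq_iff (h0 t)] at this
    rw [this, one_mul]
  · right; funext t
    have := hconst t
    rw [h, div_eq_iff (h0 t)] at this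
    rw [this, neg_one_mul]

theorem squareRootLift_eq {γ δ : ℝ → ℂ} (hδ : Continuous δ) (h : ∀ t, δ t ^ 2 = γ t)
    (h0 : ∀ t, γ t ≠ 0) :
    squareRootLift γ = δ ∨ squareRootLift γ = fun t => -δ t := by
  have hs : Continuous (squareRootLift γ) ∧ ∀ t, squareRootLift γ t ^ 2 = γ t :=
    Classical.epsilon_spec (p := fun δ : ℝ → ℂ => Continuous δ ∧ ∀ t, δ t ^ 2 = γ t) ⟨δ, hδ, h⟩
  refine eq_or_eq_neg_of_sq_eq hs.1 hδ (fun t => by rw [hs.2, h]) fun t ht => h0 t ?_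
  rw [← h, ht]; simp

/-- The winding number is even if and only if the lifts under the squaring map close up. -/
theorem IsWinding.even_iff {γ δ : ℝ → ℂ} {n : ℤ} (hn : IsWinding γ n) (hδ : Continuous δ)
    (h : ∀ t, δ t ^ 2 = γ t) : Even n ↔ δ 1 = δ 0 := by
  obtain ⟨θ, hθ, he, hp⟩ := hn
  have h1 := hp 0
  rw [zero_add] at h1
  -- Every lift is `± exp (θ/2)`, and over one period `exp (θ/2)` is multiplied by `exp (nπi) =
  -- (-1)ⁿ`.
  have key : ∀ n : ℤ, Complex.exp (n * (Real.pi * Complex.I)) = if Even n then 1 else -1 := by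
    intro n
    rw [Complex.exp_int_mul, Complex.exp_pi_mul_I]
    split_ifs with hn
    · exact hn.neg_one_zpow
    · exact (Int.not_even_iff_odd.1 hn).neg_one_zpow
  have hexp : Complex.exp (θ 1 / 2) = (if Even n then 1 else -1) * Complex.exp (θ 0 / 2) := by
    rw [← key, ← Complex.exp_add, h1]
    congr 1; ring
  have hcomp : δ 1 = (if Even n then 1 else -1) * δ 0 := by
    rcases eq_or_eq_neg_of_sq_eq hδ (η := fun t => Complex.exp (θ t / 2)) (by fun_prop)
      (fun t => by rw [h, he, ← Complex.exp_nat_mul]; congr 1; push_cast; ring)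
      (fun t => Complex.exp_ne_zero _) with h | h
    · rw [h]; exact hexp
    · rw [h]; simp only [hexp]; ring
  have hne : δ 0 ≠ 0 := fun h' => Complex.exp_ne_zero (θ 0) (by rw [← he, ← h, h']; simp)
  rw [hcomp]
  split_ifs with hn
  · simp [hn]
  · simp only [hn, false_iff, neg_one_mul]
    exact fun h => hne (self_eq_neg.1 h.symm)

/-! ### Concatenation of homotopies -/

/-- The concatenation of two homotopies. -/
noncomputable def concat (Γ Δ : ℝ → ℝ → ℂ) (s : ℝ) : ℝ → ℂ :=
  if s ≤ 1 / 2 then Γ (2 * s) else Δ (2 * s - 1)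

theorem concat_of_le {Γ Δ : ℝ → ℝ → ℂ} {s : ℝ} (hs : s ≤ 1 / 2) : concat Γ Δ s = Γ (2 * s) :=
  if_pos hs

theorem concat_of_lt {Γ Δ : ℝ → ℝ → ℂ} {s : ℝ} (hs : 1 / 2 < s) :
    concat Γ Δ s = Δ (2 * s - 1) :=
  if_neg (not_le.2 hs)

theorem concat_of_ge {Γ Δ : ℝ → ℝ → ℂ} (h : Γ 1 = Δ 0) {s : ℝ} (hs : 1 / 2 ≤ s) :
    concat Γ Δ s = Δ (2 * s - 1) := by
  rcases hs.eq_or_lt with rfl | hs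
  · rw [concat_of_le le_rfl]; norm_num [h]
  · exact concat_of_lt hs

theorem continuousOn_glue {f g h : ℝ → ℝ → ℂ}
    (hf : ContinuousOn (fun x : ℝ × ℝ => f x.1 x.2) (Icc (0 : ℝ) 1 ×ˢ univ))
    (hg : ContinuousOn (fun x : ℝ × ℝ => g x.1 x.2) (Icc (0 : ℝ) 1 ×ˢ univ))
    (h₁ : ∀ s ≤ 1 / 2, ∀ t, h s t = f (2 * s) t) (h₂ : ∀ s ≥ 1 / 2, ∀ t, h s t = g (2 * s - 1) t) :
    ContinuousOn (fun x : ℝ × ℝ => h x.1 x.2) (Icc (0 : ℝ) 1 ×ˢ univ) := by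
  have e : Icc (0 : ℝ) 1 ×ˢ (univ : Set ℝ) = Icc (0 : ℝ) (1 / 2) ×ˢ univ ∪ Icc (1 / 2 : ℝ) 1 ×ˢ univ := by
    rw [← Set.union_prod, Icc_union_Icc_eq_Icc] <;> norm_num
  rw [e]
  refine ContinuousOn.union_of_isClosed ?_ ?_ (isClosed_Icc.prod isClosed_univ)
    (isClosed_Icc.prod isClosed_univ)
  · have hm : ContinuousOn (fun x : ℝ × ℝ => f (2 * x.1) x.2) (Icc (0 : ℝ) (1 / 2) ×ˢ univ) := by
      refine hf.comp (f := fun x : ℝ × ℝ => (2 * x.1, x.2)) (by fun_prop) ?_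
      rintro ⟨s, t⟩ ⟨⟨h1, h2⟩, -⟩
      exact ⟨⟨by simp only at h1 ⊢; linarith, by simp only at h2 ⊢; linarith⟩, trivial⟩
    exact hm.congr fun x hx => h₁ _ hx.1.2 _
  · have hm : ContinuousOn (fun x : ℝ × ℝ => g (2 * x.1 - 1) x.2) (Icc (1 / 2 : ℝ) 1 ×ˢ univ) := by
      refine hg.comp (f := fun x : ℝ × ℝ => (2 * x.1 - 1, x.2)) (by fun_prop) ?_
      rintro ⟨s, t⟩ ⟨⟨h1, h2⟩, -⟩
      exact ⟨⟨by simp only at h1 ⊢; linarith, by simp only at h2 ⊢; linarith⟩, trivial⟩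
    exact hm.congr fun x hx => h₂ _ hx.1.1 _

theorem IsC1Family.concat {Γ Δ : ℝ → ℝ → ℂ} (hΓ : IsC1Family Γ) (hΔ : IsC1Family Δ)
    (h : Γ 1 = Δ 0) : IsC1Family (concat Γ Δ) := by
  have hcase : ∀ s ∈ Icc (0 : ℝ) 1, ∀ P : (ℝ → ℂ) → Prop, (∀ s ∈ Icc (0 : ℝ) 1, P (Γ s)) →
      (∀ s ∈ Icc (0 : ℝ) 1, P (Δ s)) → P (TwoCenter.concat Γ Δ s) := by
    rintro s ⟨h0, h1⟩ P hP hQ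
    rcases le_or_gt s (1 / 2) with hs | hs
    · rw [concat_of_le hs]; exact hP _ ⟨by linarith, by linarith⟩
    · rw [concat_of_lt hs]; exact hQ _ ⟨by linarith, by linarith⟩
  exact
    { periodic := fun s hs => hcase s hs (Function.Periodic · 1) hΓ.periodic hΔ.periodic
      contDiff := fun s hs => hcase s hs _ hΓ.contDiff hΔ.contDiff
      continuousOn := continuousOn_glue hΓ.continuousOn hΔ.continuousOn
        (fun s hs t => by rw [concat_of_le hs]) fun s hs t => by rw [concat_of_ge h hs]
      continuousOn_deriv := continuousOn_glue (f := fun s => deriv (Γ s)) (g := fun s => deriv (Δ s))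
        (h := fun s => deriv (TwoCenter.concat Γ Δ s))
        hΓ.continuousOn_deriv hΔ.continuousOn_deriv
        (fun s hs t => by rw [concat_of_le hs]) fun s hs t => by rw [concat_of_ge h hs] }

theorem IsGenericImmersion.not_hasOneTangency_sameDirection {γ : ℝ → ℂ}
    (h : IsGenericImmersion γ) : ¬ HasOneTangency SameDirection γ := by
  rintro ⟨-, -, t, ht, u, hu, htu, he, ⟨-, r, -, hr⟩, -⟩
  apply h.transverse t ht u hu htu.ne he
  rw [hr]
  simp
  ring

section Crossing

/-- Local change of the number of double points when crossing the time `s`, in either direction. -/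
def CrossingAt (R : ℕ → ℕ → Prop) (Γ : ℝ → ℝ → ℂ) (s : ℝ) : Prop :=
  HasOneTangency SameDirection (Γ s) ∧
  ∃ ε > 0, ∀ s₁ ∈ Ioo (s - ε) s, ∀ s₂ ∈ Ioo s (s + ε), R (numDouble (Γ s₁)) (numDouble (Γ s₂))

theorem crossingAt_concat {R : ℕ → ℕ → Prop} {Γ Δ : ℝ → ℝ → ℂ} {s : ℝ} (hs : 1 / 2 < s) :
    CrossingAt R (concat Γ Δ) s ↔ CrossingAt R Δ (2 * s - 1) := by
  unfold CrossingAt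
  rw [concat_of_lt hs]
  refine and_congr_right fun _ => ⟨?_, ?_⟩
  · rintro ⟨ε, hε, H⟩
    -- The second bound keeps `s₁` positive, so that `(s₁ + 1) / 2` stays in the half where the
    -- concatenation is `Δ`.
    refine ⟨min ε (2 * s - 1), lt_min hε (by linarith), fun s₁ h₁ s₂ h₂ => ?_⟩
    have e1 : min ε (2 * s - 1) ≤ ε := min_le_left _ _
    have e2 : min ε (2 * s - 1) ≤ 2 * s - 1 := min_le_right _ _
    have := H ((s₁ + 1) / 2) ⟨by linarith [h₁.1], by linarith [h₁.2]⟩ ((s₂ + 1) / 2)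
      ⟨by linarith [h₂.1], by linarith [h₂.2]⟩
    rw [concat_of_lt (by linarith [h₁.1]), concat_of_lt (by linarith [h₂.1])] at this
    convert this using 3 <;> ring
  · rintro ⟨ε, hε, H⟩
    refine ⟨min (ε / 2) (s - 1 / 2), lt_min (by linarith) (by linarith), fun s₁ h₁ s₂ h₂ => ?_⟩
    have e1 : min (ε / 2) (s - 1 / 2) ≤ ε / 2 := min_le_left _ _
    have e2 : min (ε / 2) (s - 1 / 2) ≤ s - 1 / 2 := min_le_right _ _
    rw [concat_of_lt (by linarith [h₁.1]), concat_of_lt (by linarith [h₂.1])]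
    exact H _ ⟨by linarith [h₁.1], by linarith [h₁.2]⟩ _ ⟨by linarith [h₂.1], by linarith [h₂.2]⟩

/-- The half through generic immersions contains no self-tangency, and the other half is an
injective rescaling of `Δ`. The relation `R` covers positive and negative crossings at once. -/
theorem ncard_crossingAt_concat {R : ℕ → ℕ → Prop} {Γ Δ : ℝ → ℝ → ℂ}
    (hΓ : ∀ s ∈ Icc (0 : ℝ) 1, IsGenericImmersion (Γ s)) :
    {s ∈ Ioo (0 : ℝ) 1 | CrossingAt R (concat Γ Δ) s}.ncard =
      {s ∈ Ioo (0 : ℝ) 1 | CrossingAt R Δ s}.ncard := by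
  have : {s ∈ Ioo (0 : ℝ) 1 | CrossingAt R (concat Γ Δ) s} =
      (fun s => (s + 1) / 2) '' {s ∈ Ioo (0 : ℝ) 1 | CrossingAt R Δ s} := by
    ext s
    constructor
    · rintro ⟨⟨h0, h1⟩, h⟩
      rcases le_or_gt s (1 / 2) with hs | hs
      · have := h.1
        rw [concat_of_le hs] at this
        exact absurd this (hΓ _ ⟨by linarith, by linarith⟩).not_hasOneTangency_sameDirection
      · exact ⟨2 * s - 1, ⟨⟨by linarith, by linarith⟩, (crossingAt_concat hs).1 h⟩,
          by simp⟩
    · rintro ⟨s, ⟨⟨h0, h1⟩, h⟩, rfl⟩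
      refine ⟨⟨by linarith, by linarith⟩, (crossingAt_concat (by linarith)).2 ?_⟩
      convert h using 1; ring
  rw [this]
  exact Set.ncard_image_of_injective _ fun x y h => by simpa using h

end Crossing

/-! ### Reversal of the orientation and of the homotopy parameter -/

theorem IsC1Family.reverse {Γ : ℝ → ℝ → ℂ} (h : IsC1Family Γ) :
    IsC1Family fun s t => Γ s (-t) where
  periodic s hs t := by
    have := h.periodic s hs (-(t + 1))
    refine Eq.trans this.symm ?_
    congr 1; ring
  contDiff s hs := (h.contDiff s hs).comp contDiff_neg
  continuousOn := h.continuousOn.comp (f := fun x : ℝ × ℝ => (x.1, -x.2)) (by fun_prop)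
    fun x hx => ⟨hx.1, trivial⟩
  continuousOn_deriv := by
    have : (fun x : ℝ × ℝ => deriv (fun t => Γ x.1 (-t)) x.2) =
        fun x : ℝ × ℝ => -deriv (Γ x.1) (-x.2) := by
      funext x; exact deriv_comp_neg (Γ x.1) x.2
    rw [this]
    exact (h.continuousOn_deriv.comp (f := fun x : ℝ × ℝ => (x.1, -x.2)) (by fun_prop)
      fun x hx => ⟨hx.1, trivial⟩).neg

theorem IsC1Family.symm {Γ : ℝ → ℝ → ℂ} (h : IsC1Family Γ) :
    IsC1Family fun s => Γ (1 - s) := by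
  have hm : ∀ s ∈ Icc (0 : ℝ) 1, 1 - s ∈ Icc (0 : ℝ) 1 := fun s hs =>
    ⟨by linarith [hs.2], by linarith [hs.1]⟩
  exact
    { periodic := fun s hs => h.periodic _ (hm s hs)
      contDiff := fun s hs => h.contDiff _ (hm s hs)
      continuousOn := h.continuousOn.comp (f := fun x : ℝ × ℝ => (1 - x.1, x.2)) (by fun_prop)
        fun x hx => ⟨hm _ hx.1, trivial⟩
      continuousOn_deriv := h.continuousOn_deriv.comp (f := fun x : ℝ × ℝ => (1 - x.1, x.2))
        (by fun_prop) fun x hx => ⟨hm _ hx.1, trivial⟩ }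

/-- Reversal of the orientation by `t ↦ -t`, with parameters kept in `[0,1)`. -/
theorem exists_reverse_param {γ : ℝ → ℂ} (hp : Function.Periodic γ 1) (t : ℝ)
    (ht : t ∈ Ico (0 : ℝ) 1) :
    ∃ t' ∈ Ico (0 : ℝ) 1, γ (-t) = γ t' ∧ deriv γ (-t) = deriv γ t' ∧
      (t = 0 ∧ t' = 0 ∨ t ≠ 0 ∧ t' = 1 - t) := by
  rcases eq_or_ne t 0 with rfl | h
  · exact ⟨0, ht, by simp, by simp, .inl ⟨rfl, rfl⟩⟩
  · have e : γ = fun t => γ (t + 1) := funext fun t => (hp t).symm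
    have hpos : 0 < t := lt_of_le_of_ne ht.1 (Ne.symm h)
    refine ⟨1 - t, ⟨by linarith [ht.2], by linarith⟩, ?_, ?_, .inr ⟨h, rfl⟩⟩
    · rw [← hp]; congr 1; ring
    · conv_lhs => rw [e, deriv_comp_add_const]
      congr 1; ring

theorem IsGenericImmersion.reverse {γ : ℝ → ℂ} (h : IsGenericImmersion γ) :
    IsGenericImmersion fun t => γ (-t) := by
  have hd : ∀ t, deriv (fun t => γ (-t)) t = -deriv γ (-t) := fun t => deriv_comp_neg γ t
  refine ⟨⟨fun t => ?_, h.contDiff.comp contDiff_neg, fun t => ?_⟩, ?_, fun p => ?_⟩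
  · have := h.periodic (-(t + 1))
    refine Eq.trans this.symm ?_
    congr 1; ring
  · rw [hd]; exact neg_ne_zero.2 (h.deriv_ne_zero _)
  · intro t ht u hu htu he
    obtain ⟨t', ht', e1, e2, h1⟩ := exists_reverse_param h.periodic t ht
    obtain ⟨u', hu', e3, e4, h2⟩ := exists_reverse_param h.periodic u hu
    have hne : t' ≠ u' := by
      intro h'
      apply htu
      rcases h1 with ⟨h1, h1'⟩ | ⟨h1, h1'⟩ <;> rcases h2 with ⟨h2, h2'⟩ | ⟨h2, h2'⟩
      · rw [h1, h2]
      · linarith [hu.2]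
      · linarith [ht.2]
      · linarith
    have := h.transverse t' ht' u' hu' hne (by rw [← e1, ← e3]; exact he)
    unfold Transverse at this ⊢
    rw [hd, hd, e2, e4]
    simpa using this
  · have hinj : Set.MapsTo (fun t : ℝ => if t = 0 then 0 else 1 - t)
        (fiber (fun t => γ (-t)) p) (fiber γ p) := by
      rintro t ⟨ht, he⟩
      obtain ⟨t', ht', e1, e2, h1⟩ := exists_reverse_param h.periodic t ht
      have : (if t = 0 then 0 else 1 - t) = t' := by
        rcases h1 with ⟨h1, h1'⟩ | ⟨h1, h1'⟩ <;> simp [h1, h1']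
      simp only [this]
      exact ⟨ht', by rw [← e1]; exact he⟩
    refine (Set.encard_le_encard_of_injOn hinj ?_).trans (h.fiber_le_two p)
    rintro t ⟨ht, -⟩ u ⟨hu, -⟩ he
    simp only at he
    split_ifs at he with h1 h2 h2
    · rw [h1, h2]
    · linarith [hu.2]
    · linarith [ht.2]
    · linarith

/-! ### Invariance of `J⁺` -/

/-- A `C¹` homotopy through generic immersions. -/
def IsIsotopy (Γ : ℝ → ℝ → ℂ) : Prop :=
  IsC1Family Γ ∧ ∀ s ∈ Icc (0 : ℝ) 1, IsGenericImmersion (Γ s)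

theorem IsIsotopy.reverse {Γ : ℝ → ℝ → ℂ} (h : IsIsotopy Γ) : IsIsotopy fun s t => Γ s (-t) :=
  ⟨h.1.reverse, fun s hs => (h.2 s hs).reverse⟩

theorem IsIsotopy.symm {Γ : ℝ → ℝ → ℂ} (h : IsIsotopy Γ) : IsIsotopy fun s => Γ (1 - s) :=
  ⟨h.1.symm, fun s hs => h.2 _ ⟨by linarith [hs.2], by linarith [hs.1]⟩⟩

theorem IsIsotopy.concat {Γ Δ : ℝ → ℝ → ℂ} (hΓ : IsIsotopy Γ) (hΔ : IsGenericHomotopy Δ)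
    (h : Γ 1 = Δ 0) : IsGenericHomotopy (concat Γ Δ) := by
  refine ⟨hΓ.1.concat hΔ.1 h, ?_⟩
  obtain ⟨D, hfin, hsub, hgen, hex⟩ := hΔ.exceptional
  refine ⟨(fun s => (s + 1) / 2) '' D, hfin.image _, ?_, ?_, ?_⟩
  · rintro _ ⟨s, hs, rfl⟩
    have := hsub hs
    exact ⟨by linarith [this.1], by linarith [this.2]⟩
  · rintro s ⟨h0, h1⟩ hs
    rcases le_or_gt s (1 / 2) with h2 | h2
    · rw [concat_of_le h2]; exact hΓ.2 _ ⟨by linarith, by linarith⟩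
    · rw [concat_of_lt h2]
      exact hgen _ ⟨by linarith, by linarith⟩ fun h' => hs ⟨_, h', by simp⟩
  · rintro _ ⟨s, hs, rfl⟩
    have h1 : 1 / 2 < (s + 1) / 2 := by linarith [(hsub hs).1]
    have e : 2 * ((s + 1) / 2) - 1 = s := by ring
    have hc := concat_of_lt (Γ := Γ) (Δ := Δ) h1
    rw [e] at hc
    have hx := fun R => crossingAt_concat (R := R) (Γ := Γ) (Δ := Δ) h1
    rw [e] at hx
    rw [hc]
    rcases hex s hs with h | h | h | h
    · exact .inl h
    · exact .inr (.inl h)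
    · exact .inr (.inr (.inl ((hx fun a b => b = a + 2).2 h)))
    · exact .inr (.inr (.inr ((hx fun a b => a = b + 2).2 h)))

/-- The isotopy is put in front of the homotopy to the standard curve. If that homotopy starts at
the reversed curve, the reversed isotopy is used instead. -/
theorem HasJPlus.of_isIsotopy {Γ : ℝ → ℝ → ℂ} (h : IsIsotopy Γ) {m : ℤ}
    (hm : HasJPlus (Γ 1) m) : HasJPlus (Γ 0) m := by
  have key : ∀ Θ Δ : ℝ → ℝ → ℂ, IsIsotopy Θ → IsGenericHomotopy Δ → Θ 1 = Δ 0 → ∀ j : ℕ,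
      Δ 1 = standardCurve j →
      m = standardJPlus j - 2 * ({s ∈ Ioo (0 : ℝ) 1 | PositiveDirectCrossing Δ s}.ncard : ℤ)
      + 2 * ({s ∈ Ioo (0 : ℝ) 1 | NegativeDirectCrossing Δ s}.ncard : ℤ) →
      (Θ 0 = Γ 0 ∨ Θ 0 = fun t => Γ 0 (-t)) → HasJPlus (Γ 0) m := by
    intro Θ Δ hΘ hΔ h1 j hj hm h0
    refine ⟨j, concat Θ Δ, hΘ.concat hΔ h1, ?_, ?_, ?_⟩
    · rw [concat_of_le (by norm_num)]; simpa using h0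
    · rw [concat_of_lt (by norm_num)]; norm_num [hj]
    · rw [hm]
      have e1 := ncard_crossingAt_concat (R := fun a b => b = a + 2) (Δ := Δ) hΘ.2
      have e2 := ncard_crossingAt_concat (R := fun a b => a = b + 2) (Δ := Δ) hΘ.2
      unfold CrossingAt at e1 e2
      unfold PositiveDirectCrossing NegativeDirectCrossing
      rw [e1, e2]
  obtain ⟨j, Δ, hΔ, h0 | h0, h1, hm⟩ := hm
  · exact key Γ Δ h hΔ h0.symm j h1 hm (.inl rfl)
  · exact key _ Δ h.reverse hΔ h0.symm j h1 hm (.inr rfl)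

/-- `JPlus` is a choice made from the predicate `HasJPlus`. Running the isotopy in both directions
shows that the predicates at its two ends are equal, hence so are the chosen values; neither
existence nor uniqueness of the value of `J⁺` is needed. -/
theorem jPlus_eq_of_isIsotopy {Γ : ℝ → ℝ → ℂ} (h : IsIsotopy Γ) : JPlus (Γ 0) = JPlus (Γ 1) := by
  have : HasJPlus (Γ 0) = HasJPlus (Γ 1) := by
    funext m
    refine propext ⟨fun hm => ?_, fun hm => .of_isIsotopy h hm⟩
    have := HasJPlus.of_isIsotopy h.symm (m := m)
    simp only [sub_self, sub_zero] at this
    exact this hm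
  rw [JPlus, JPlus, this]

theorem jPlus_reverse (γ : ℝ → ℂ) : JPlus (fun t => γ (-t)) = JPlus γ := by
  have : HasJPlus (fun t => γ (-t)) = HasJPlus γ := by
    funext m
    simp only [HasJPlus, neg_neg]
    refine propext ⟨?_, ?_⟩ <;>
    · rintro ⟨j, Γ, h, h0, h1⟩
      exact ⟨j, Γ, h, h0.symm, h1⟩
  rw [JPlus, JPlus, this]

/-! ### Multiplication of curves by non-zero constants -/

theorem transverse_mul {c z w : ℂ} (hc : c ≠ 0) (h : Transverse z w) :
    Transverse (c * z) (c * w) := by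
  unfold Transverse at *
  have hn : c.re ^ 2 + c.im ^ 2 ≠ 0 := by
    have := (Complex.normSq_pos.2 hc).ne'
    rwa [Complex.normSq_apply, ← sq, ← sq] at this
  convert mul_ne_zero hn h using 1
  simp only [Complex.mul_re, Complex.mul_im]
  ring

theorem IsGenericImmersion.const_mul {γ : ℝ → ℂ} (h : IsGenericImmersion γ) {c : ℂ} (hc : c ≠ 0) :
    IsGenericImmersion fun t => c * γ t := by
  have hd : ∀ t, deriv (fun t => c * γ t) t = c * deriv γ t := fun t =>
    deriv_const_mul c (h.contDiff.differentiable one_ne_zero t)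
  refine ⟨⟨fun t => ?_, contDiff_const.mul h.contDiff, fun t => ?_⟩, ?_, fun p => ?_⟩
  · simp only [h.periodic t]
  · rw [hd]; exact mul_ne_zero hc (h.deriv_ne_zero t)
  · intro t ht u hu htu he
    rw [hd, hd]
    exact transverse_mul hc (h.transverse t ht u hu htu (mul_left_cancel₀ hc he))
  · have : fiber (fun t => c * γ t) p = fiber γ (p / c) := by
      ext t
      simp only [fiber, mem_ofPred_eq, eq_div_iff hc, mul_comm c]
    rw [this]; exact h.fiber_le_two _

/-- Rotating the plane through the angle `π` is an isotopy from `γ` to `-γ`. This removes the sign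
ambiguity of square root lifts. -/
theorem jPlus_neg {γ : ℝ → ℂ} (h : IsGenericImmersion γ) : JPlus (fun t => -γ t) = JPlus γ := by
  set c : ℝ → ℂ := fun s => Complex.exp (s * (Real.pi * Complex.I)) with hcdef
  have hcc : Continuous c := by fun_prop
  have hI : IsIsotopy fun s t => c s * γ t := by
    have hg := fun s : ℝ => h.const_mul (c := c s) (Complex.exp_ne_zero _)
    refine ⟨⟨fun s _ => (hg s).periodic, fun s _ => (hg s).contDiff, ?_, ?_⟩, fun s _ => hg s⟩
    · have := h.contDiff.continuous
      exact Continuous.continuousOn (by fun_prop)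
    · have : (fun x : ℝ × ℝ => deriv (fun t => c x.1 * γ t) x.2) =
          fun x : ℝ × ℝ => c x.1 * deriv γ x.2 := funext fun x =>
        deriv_const_mul (c x.1) (h.contDiff.differentiable one_ne_zero x.2)
      rw [this]
      have := h.contDiff.continuous_deriv le_rfl
      exact Continuous.continuousOn (by fun_prop)
  have := jPlus_eq_of_isIsotopy hI
  simpa [hcdef] using this.symm

theorem jPlus_eq_of_eq_or_neg {γ δ : ℝ → ℂ} (hδ : IsGenericImmersion δ)
    (h : γ = δ ∨ γ = fun t => -δ t) : JPlus γ = JPlus δ := by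
  rcases h with rfl | rfl
  · rfl
  · exact jPlus_neg hδ

end TwoCenter

namespace TwoCenter

/-! ### Profiles of symmetric oscillations -/

/-- A smooth 1-periodic function with the symmetries and the monotonicity of `sin (2πx)`. -/
structure IsProfile (L : ℝ → ℝ) : Prop where
  smooth : ContDiff ℝ (⊤ : ℕ∞) L
  half : ∀ x, L (x + 1 / 2) = -L x
  refl : ∀ x, L (1 / 2 - x) = L x
  deriv_pos : ∀ x ∈ Ioo (-1 / 4 : ℝ) (1 / 4), 0 < deriv L x

namespace IsProfile

/-- The interval is a fundamental domain for the group generated by `x ↦ x + 1` and `x ↦ 1/2 - x`,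
and a profile is strictly monotone on it. Hence level sets of a profile are exactly orbits of this
group. -/
theorem exists_fold (x : ℝ) : ∃ x' ∈ Icc (-1 / 4 : ℝ) (1 / 4),
    (∃ m : ℤ, x' - x = m) ∨ ∃ m : ℤ, x' + x - 1 / 2 = m := by
  have h1 := Int.floor_le (x + 1 / 4)
  have h2 := Int.lt_floor_add_one (x + 1 / 4)
  set m := ⌊x + 1 / 4⌋
  rcases le_or_gt (x - m) (1 / 4) with h3 | h3
  · exact ⟨x - m, ⟨by linarith, h3⟩, .inl ⟨-m, by push_cast; ring⟩⟩
  · exact ⟨1 / 2 - (x - m), ⟨by linarith, by linarith⟩, .inr ⟨m, by ring⟩⟩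

variable {L : ℝ → ℝ} (h : IsProfile L)
include h

theorem hasDerivAt (x : ℝ) : HasDerivAt L (deriv L x) x :=
  (h.smooth.differentiable (by simp) x).hasDerivAt

theorem periodic : Function.Periodic L 1 := fun x => by
  rw [show x + 1 = x + 1 / 2 + 1 / 2 by ring, h.half, h.half, neg_neg]

theorem add_int (x : ℝ) (m : ℤ) : L (x + m) = L x := by
  simpa using h.periodic.int_mul m x

theorem deriv_half (x : ℝ) : deriv L (x + 1 / 2) = -deriv L x := by
  rw [← deriv_comp_add_const, show (fun x => L (x + 1 / 2)) = fun x => -L x from funext h.half,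
    deriv.fun_neg]

theorem deriv_refl (x : ℝ) : deriv L (1 / 2 - x) = -deriv L x := by
  have := deriv_comp_const_sub L (1 / 2) x
  rw [show (fun x => L (1 / 2 - x)) = L from funext h.refl] at this
  rw [this, neg_neg]

theorem deriv_periodic : Function.Periodic (deriv L) 1 := fun x => by
  rw [show x + 1 = x + 1 / 2 + 1 / 2 by ring, h.deriv_half, h.deriv_half, neg_neg]

theorem deriv_add_int (x : ℝ) (m : ℤ) : deriv L (x + m) = deriv L x := by
  simpa using h.deriv_periodic.int_mul m x

theorem eq_of_sub {x x' : ℝ} {m : ℤ} (e : x' - x = m) : L x' = L x ∧ deriv L x' = deriv L x := by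
  obtain rfl : x' = x + m := by linarith
  exact ⟨h.add_int x m, h.deriv_add_int x m⟩

theorem eq_of_sub_half {x x' : ℝ} {m : ℤ} (e : x' - x = m + 1 / 2) :
    L x' = -L x ∧ deriv L x' = -deriv L x := by
  obtain rfl : x' = x + 1 / 2 + m := by linarith
  rw [h.add_int, h.deriv_add_int, h.half, h.deriv_half]
  exact ⟨rfl, rfl⟩

theorem eq_of_add {x x' : ℝ} {m : ℤ} (e : x' + x - 1 / 2 = m) :
    L x' = L x ∧ deriv L x' = -deriv L x := by
  obtain rfl : x' = 1 / 2 - x + m := by linarith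
  rw [h.add_int, h.deriv_add_int, h.refl, h.deriv_refl]
  exact ⟨rfl, rfl⟩

theorem eq_of_add_half {x x' : ℝ} {m : ℤ} (e : x' + x - 1 / 2 = m + 1 / 2) :
    L x' = -L x ∧ deriv L x' = deriv L x := by
  obtain rfl : x' = 1 / 2 - x + 1 / 2 + m := by linarith
  rw [h.add_int, h.deriv_add_int, h.half, h.deriv_half, h.refl, h.deriv_refl, neg_neg]
  exact ⟨rfl, rfl⟩

theorem strictMonoOn : StrictMonoOn L (Icc (-1 / 4) (1 / 4)) := by
  apply strictMonoOn_of_deriv_pos (convex_Icc _ _) h.smooth.continuous.continuousOn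
  rw [interior_Icc]
  exact h.deriv_pos

theorem eq_cases {x y : ℝ} (e : L y = L x) :
    (∃ m : ℤ, y - x = m) ∨ ∃ m : ℤ, y + x - 1 / 2 = m := by
  obtain ⟨x', hx', cx⟩ := exists_fold x
  obtain ⟨y', hy', cy⟩ := exists_fold y
  have ex : L x' = L x := by
    rcases cx with ⟨m, hm⟩ | ⟨m, hm⟩
    exacts [(h.eq_of_sub hm).1, (h.eq_of_add hm).1]
  have ey : L y' = L y := by
    rcases cy with ⟨m, hm⟩ | ⟨m, hm⟩
    exacts [(h.eq_of_sub hm).1, (h.eq_of_add hm).1]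
  have hxy : x' = y' := h.strictMonoOn.injOn hx' hy' (by rw [ex, ey, e])
  subst hxy
  rcases cx with ⟨m, hm⟩ | ⟨m, hm⟩ <;> rcases cy with ⟨n, hn⟩ | ⟨n, hn⟩
  · exact .inl ⟨m - n, by push_cast; linarith⟩
  · exact .inr ⟨n - m, by push_cast; linarith⟩
  · exact .inr ⟨m - n, by push_cast; linarith⟩
  · exact .inl ⟨n - m, by push_cast; linarith⟩

theorem eq_neg_cases {x y : ℝ} (e : L y = -L x) :
    (∃ m : ℤ, y - x = m + 1 / 2) ∨ ∃ m : ℤ, y + x - 1 / 2 = m + 1 / 2 := by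
  rw [← h.half] at e
  rcases h.eq_cases e with ⟨m, hm⟩ | ⟨m, hm⟩
  · exact .inl ⟨m, by linarith⟩
  · exact .inr ⟨m - 1, by push_cast; linarith⟩

/-- At a zero `L x = -L x`, so the classification of opposite values applies to `x` and itself; its
translation case would require an integer equal to `-1/2`. -/
theorem eq_zero {x : ℝ} (e : L x = 0) : ∃ m : ℤ, 2 * x = m := by
  rcases h.eq_neg_cases (x := x) (y := x) (by rw [e, neg_zero]) with ⟨m, hm⟩ | ⟨m, hm⟩
  · exfalso
    have h2 : ((2 * m + 1 : ℤ) : ℝ) = (0 : ℤ) := by push_cast; linarith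
    have := Int.cast_injective h2
    omega
  · exact ⟨m + 1, by push_cast; linarith⟩

theorem zero_of_int {x : ℝ} {m : ℤ} (e : 2 * x = m) : L x = 0 := by
  have := (h.eq_of_add_half (x := x) (x' := x) (m := m - 1) (by push_cast; linarith)).1
  linarith

theorem deriv_eq_zero {x : ℝ} (e : deriv L x = 0) : ∃ m : ℤ, 2 * x - 1 / 2 = m := by
  obtain ⟨x', hx', cx⟩ := exists_fold x
  have e' : deriv L x' = 0 := by
    rcases cx with ⟨m, hm⟩ | ⟨m, hm⟩
    · rw [(h.eq_of_sub hm).2, e]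
    · rw [(h.eq_of_add hm).2, e, neg_zero]
  have hb : x' = -1 / 4 ∨ x' = 1 / 4 := by
    by_contra! hne
    exact (h.deriv_pos x' ⟨lt_of_le_of_ne hx'.1 (Ne.symm hne.1),
      lt_of_le_of_ne hx'.2 hne.2⟩).ne' e'
  rcases cx with ⟨m, hm⟩ | ⟨m, hm⟩ <;> rcases hb with hb | hb
  · exact ⟨-2 * m - 1, by push_cast; linarith⟩
  · exact ⟨-2 * m, by push_cast; linarith⟩
  · exact ⟨2 * m + 1, by push_cast; linarith⟩
  · exact ⟨2 * m, by push_cast; linarith⟩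

theorem deriv_zero_of_int {x : ℝ} {m : ℤ} (e : 2 * x - 1 / 2 = m) : deriv L x = 0 := by
  have := (h.eq_of_add (x := x) (x' := x) (m := m) (by linarith)).2
  linarith

/-- A point of the phase curve determines the phase. -/
theorem sub_int_of_eq {x y : ℝ} (e : L y = L x) (e' : deriv L y = deriv L x) :
    ∃ m : ℤ, y - x = m := by
  rcases h.eq_cases e with hm | ⟨m, hm⟩
  · exact hm
  · have := (h.eq_of_add hm).2
    obtain ⟨n, hn⟩ := h.deriv_eq_zero (x := x) (by linarith)
    exact ⟨m - n, by push_cast; linarith⟩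

theorem sub_half_of_eq_neg {x y : ℝ} (e : L y = -L x) (e' : deriv L y = -deriv L x) :
    ∃ m : ℤ, y - x = m + 1 / 2 := by
  rw [← h.half] at e
  rw [← h.deriv_half] at e'
  obtain ⟨m, hm⟩ := h.sub_int_of_eq e e'
  exact ⟨m, by linarith⟩

theorem pos {x : ℝ} (hx : x ∈ Ioo (0 : ℝ) (1 / 2)) : 0 < L x := by
  have h0 : L 0 = 0 := h.zero_of_int (m := 0) (by simp)
  rcases le_or_gt x (1 / 4) with hx' | hx'
  · rw [← h0]
    exact h.strictMonoOn ⟨by norm_num, by norm_num⟩ ⟨by linarith [hx.1], hx'⟩ hx.1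
  · rw [← h0, ← h.refl x]
    exact h.strictMonoOn ⟨by norm_num, by norm_num⟩ ⟨by linarith [hx.2], by linarith⟩
      (by linarith [hx.2])

end IsProfile

/-- Linear interpolation. -/
def lerp (s : ℝ) (f g : ℝ → ℝ) (x : ℝ) : ℝ := (1 - s) * f x + s * g x

theorem IsProfile.deriv_lerp {f g : ℝ → ℝ} (hf : IsProfile f) (hg : IsProfile g) (s x : ℝ) :
    deriv (lerp s f g) x = lerp s (deriv f) (deriv g) x :=
  (((hf.hasDerivAt x).const_mul (1 - s)).add ((hg.hasDerivAt x).const_mul s)).deriv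

theorem lerp_pos {s x : ℝ} (hs : s ∈ Icc (0 : ℝ) 1) {f g : ℝ → ℝ} (hf : 0 < f x) (hg : 0 < g x) :
    0 < lerp s f g x := by
  unfold lerp
  rcases hs.1.eq_or_lt with rfl | h
  · simpa using hf
  · have := mul_nonneg (sub_nonneg.2 hs.2) hf.le
    have := mul_pos h hg
    linarith

/-- The conditions are linear equations and the positivity of a derivative, hence convex. This is
what makes straight-line homotopies of orbits available. -/
theorem IsProfile.lerp {f g : ℝ → ℝ} (hf : IsProfile f) (hg : IsProfile g) {s : ℝ}
    (hs : s ∈ Icc (0 : ℝ) 1) : IsProfile (lerp s f g) where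
  smooth := (contDiff_const.mul hf.smooth).add (contDiff_const.mul hg.smooth)
  half x := by simp only [TwoCenter.lerp, hf.half, hg.half]; ring
  refl x := by simp only [TwoCenter.lerp, hf.refl, hg.refl]
  deriv_pos x hx := by
    rw [hf.deriv_lerp hg]
    exact lerp_pos hs (hf.deriv_pos x hx) (hg.deriv_pos x hx)

/-! ### Lissajous curves -/

/-- The lattice `ℤ²` or, if `E` holds, `ℤ² ∪ (½ + ℤ)²`. -/
def lattice (E : Prop) : AddSubgroup (ℝ × ℝ) where
  carrier := {v | ∃ m n : ℤ, (v.1 = m ∧ v.2 = n) ∨ (E ∧ v.1 = m + 1 / 2 ∧ v.2 = n + 1 / 2)}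
  zero_mem' := ⟨0, 0, by simp⟩
  add_mem' := by
    rintro ⟨x, y⟩ ⟨x', y'⟩ ⟨m, n, h⟩ ⟨m', n', h'⟩
    simp only [Prod.mk_add_mk, mem_ofPred_eq] at *
    rcases h with ⟨h1, h2⟩ | ⟨e, h1, h2⟩ <;> rcases h' with ⟨h3, h4⟩ | ⟨e', h3, h4⟩
    · exact ⟨m + m', n + n', .inl ⟨by push_cast; linarith, by push_cast; linarith⟩⟩
    · exact ⟨m + m', n + n', .inr ⟨e', by push_cast; linarith, by push_cast; linarith⟩⟩
    · exact ⟨m + m', n + n', .inr ⟨e, by push_cast; linarith, by push_cast; linarith⟩⟩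
    · exact ⟨m + m' + 1, n + n' + 1, .inl ⟨by push_cast; linarith, by push_cast; linarith⟩⟩
  neg_mem' := by
    rintro ⟨x, y⟩ ⟨m, n, h⟩
    simp only [Prod.neg_mk, mem_ofPred_eq] at *
    rcases h with ⟨h1, h2⟩ | ⟨e, h1, h2⟩
    · exact ⟨-m, -n, .inl ⟨by push_cast; linarith, by push_cast; linarith⟩⟩
    · exact ⟨-m - 1, -n - 1, .inr ⟨e, by push_cast; linarith, by push_cast; linarith⟩⟩

theorem mem_lattice {E : Prop} {x y : ℝ} : (x, y) ∈ lattice E ↔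
    ∃ m n : ℤ, (x = m ∧ y = n) ∨ (E ∧ x = m + 1 / 2 ∧ y = n + 1 / 2) := Iff.rfl

theorem int_mem_lattice {E : Prop} (m n : ℤ) : ((m : ℝ), (n : ℝ)) ∈ lattice E :=
  ⟨m, n, .inl ⟨rfl, rfl⟩⟩

theorem half_mem_lattice {E : Prop} (hE : E) (m n : ℤ) :
    ((m : ℝ) + 1 / 2, (n : ℝ) + 1 / 2) ∈ lattice E :=
  ⟨m, n, .inr ⟨hE, rfl, rfl⟩⟩

/-- A chart, defined near the strip `|Im w| < π`, of the plane or (if `E` holds) of its double cover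
branched at the origin. -/
structure IsChart (E : Prop) (F F' : ℂ → ℂ) : Prop where
  hasDerivAt : ∀ w, HasDerivAt F (F' w) w
  smooth : ContDiff ℝ (⊤ : ℕ∞) F
  continuous_deriv : Continuous F'
  eq : ∀ w z : ℂ, |w.im| < Real.pi → |z.im| < Real.pi → F w = F z → z = w ∨ (E ∧ z = -w)
  even : E → ∀ w, F (-w) = F w
  deriv_odd : E → ∀ w, F' (-w) = -F' w
  deriv_ne_zero : ∀ w : ℂ, |w.im| < Real.pi → (E → w ≠ 0) → F' w ≠ 0

/-- The data of a Lissajous curve. -/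
structure Lissajous where
  L : ℝ → ℝ
  N : ℝ → ℝ
  κ : ℝ
  κ' : ℝ
  a : ℝ
  b : ℝ

namespace Lissajous

variable (d : Lissajous)

def x (t : ℝ) : ℝ := d.κ * t + d.a
def y (t : ℝ) : ℝ := d.κ' * t + d.b

/-- The curve in the covering plane. -/
def path (t : ℝ) : ℂ := ⟨d.L (d.x t), d.N (d.y t)⟩

noncomputable def velocity (t : ℝ) : ℂ := ⟨d.κ * deriv d.L (d.x t), d.κ' * deriv d.N (d.y t)⟩

/-- The conditions on the profiles. -/
structure IsAdmissible : Prop where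
  profile_L : IsProfile d.L
  profile_N : IsProfile d.N
  abs_lt : ∀ x, |d.N x| < Real.pi
  κ_pos : 0 < d.κ
  κ'_pos : 0 < d.κ'

/-- The curve closes up after the minimal time 1. -/
structure IsClosing (E : Prop) : Prop where
  mem : (d.κ, d.κ') ∈ lattice E
  minimal : ∀ r, (d.κ * r, d.κ' * r) ∈ lattice E → ∃ n : ℤ, r = n

/-- The curve does not meet a fixed point of the time reversal. -/
def IsRegular (E : Prop) : Prop := ∀ t, (2 * d.x t - 1 / 2, 2 * d.y t - 1 / 2) ∉ lattice E

variable {d} {E : Prop} {F F' : ℂ → ℂ}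

theorem path_eq (t : ℝ) : d.path t = d.L (d.x t) + d.N (d.y t) * Complex.I :=
  Complex.mk_eq_add_mul_I _ _

theorem velocity_eq (t : ℝ) :
    d.velocity t = ((d.κ * deriv d.L (d.x t) : ℝ) : ℂ) + (d.κ' * deriv d.N (d.y t) : ℝ) * Complex.I :=
  Complex.mk_eq_add_mul_I _ _

theorem IsAdmissible.contDiff (h : d.IsAdmissible) : ContDiff ℝ (⊤ : ℕ∞) d.path := by
  have h1 : ContDiff ℝ (⊤ : ℕ∞) fun t => d.L (d.x t) :=
    h.profile_L.smooth.comp (by unfold x; fun_prop)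
  have h2 : ContDiff ℝ (⊤ : ℕ∞) fun t => d.N (d.y t) :=
    h.profile_N.smooth.comp (by unfold y; fun_prop)
  rw [show d.path = fun t => (d.L (d.x t) : ℂ) + d.N (d.y t) * Complex.I from funext path_eq]
  exact (Complex.ofRealCLM.contDiff.comp h1).add
    ((Complex.ofRealCLM.contDiff.comp h2).mul contDiff_const)

theorem IsAdmissible.hasDerivAt (h : d.IsAdmissible) (t : ℝ) :
    HasDerivAt d.path (d.velocity t) t := by
  have hx : HasDerivAt d.x d.κ t :=
    (((hasDerivAt_id t).const_mul d.κ).add_const d.a).congr_deriv (mul_one _)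
  have hy : HasDerivAt d.y d.κ' t :=
    (((hasDerivAt_id t).const_mul d.κ').add_const d.b).congr_deriv (mul_one _)
  have h1 := ((h.profile_L.hasDerivAt (d.x t)).comp t hx).ofReal_comp
  have h2 := (((h.profile_N.hasDerivAt (d.y t)).comp t hy).ofReal_comp).mul_const Complex.I
  rw [show d.path = fun t => (d.L (d.x t) : ℂ) + d.N (d.y t) * Complex.I from funext path_eq]
  refine (h1.add h2).congr_deriv ?_
  rw [velocity_eq, mul_comm d.κ, mul_comm d.κ']

theorem IsAdmissible.hasDerivAt_comp (h : d.IsAdmissible) (hF : IsChart E F F') (t : ℝ) :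
    HasDerivAt (fun t => F (d.path t)) (F' (d.path t) * d.velocity t) t :=
  (hF.hasDerivAt _).comp_of_eq t (h.hasDerivAt t) rfl

theorem IsAdmissible.contDiff_comp (h : d.IsAdmissible) (hF : IsChart E F F') :
    ContDiff ℝ (⊤ : ℕ∞) fun t => F (d.path t) := hF.smooth.comp h.contDiff

/-- Reflecting both phases is time reversal: the point is kept and the velocity reversed. On the
same sheet `w` is kept and its velocity changes sign; on the other sheet `w` changes sign, its
velocity is kept, and the oddness of `F'` supplies the sign. -/
theorem eq_of_add (h : d.IsAdmissible) (hF : IsChart E F F') {t u : ℝ}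
    (hm : (d.x u + d.x t - 1 / 2, d.y u + d.y t - 1 / 2) ∈ lattice E) :
    F (d.path u) = F (d.path t) ∧
      F' (d.path u) * d.velocity u = -(F' (d.path t) * d.velocity t) := by
  obtain ⟨m, n, ⟨h1, h2⟩ | ⟨hE, h1, h2⟩⟩ := mem_lattice.1 hm
  · obtain ⟨e1, e2⟩ := h.profile_L.eq_of_add h1
    obtain ⟨e3, e4⟩ := h.profile_N.eq_of_add h2
    have hp : d.path u = d.path t := by simp [path, e1, e3]
    have hv : d.velocity u = -d.velocity t := by
      apply Complex.ext <;> simp [velocity, e2, e4]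
    rw [hp, hv]; simp
  · obtain ⟨e1, e2⟩ := h.profile_L.eq_of_add_half h1
    obtain ⟨e3, e4⟩ := h.profile_N.eq_of_add_half h2
    have hp : d.path u = -d.path t := by apply Complex.ext <;> simp [path, e1, e3]
    have hv : d.velocity u = d.velocity t := by
      apply Complex.ext <;> simp [velocity, e2, e4]
    rw [hp, hv, hF.even hE, hF.deriv_odd hE]; simp

theorem eq_of_sub (h : d.IsAdmissible) (hF : IsChart E F F') {t u : ℝ}
    (hm : (d.x u - d.x t, d.y u - d.y t) ∈ lattice E) :
    F (d.path u) = F (d.path t) := by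
  obtain ⟨m, n, ⟨h1, h2⟩ | ⟨hE, h1, h2⟩⟩ := mem_lattice.1 hm
  · have hp : d.path u = d.path t := by
      simp [path, (h.profile_L.eq_of_sub h1).1, (h.profile_N.eq_of_sub h2).1]
    rw [hp]
  · have hp : d.path u = -d.path t := by
      apply Complex.ext <;>
        simp [path, (h.profile_L.eq_of_sub_half h1).1, (h.profile_N.eq_of_sub_half h2).1]
    rw [hp, hF.even hE]

theorem periodic (h : d.IsAdmissible) (hF : IsChart E F F') (hc : d.IsClosing E) :
    Function.Periodic (fun t => F (d.path t)) 1 := fun t => by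
  refine eq_of_sub h hF ?_
  have := hc.mem
  unfold x y
  convert this using 2 <;> ring

/-- The four ways in which two points of the curve can coincide. -/
theorem coincidence (h : d.IsAdmissible) (hF : IsChart E F F') {t u : ℝ}
    (he : F (d.path t) = F (d.path u)) :
    (d.x u - d.x t, d.y u - d.y t) ∈ lattice E ∨
    (d.x u + d.x t - 1 / 2, d.y u - d.y t) ∈ lattice E ∨
    (d.x u - d.x t, d.y u + d.y t - 1 / 2) ∈ lattice E ∨
    (d.x u + d.x t - 1 / 2, d.y u + d.y t - 1 / 2) ∈ lattice E := by
  simp only [mem_lattice]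
  rcases hF.eq _ _ (h.abs_lt _) (h.abs_lt _) he with hw | ⟨hE, hw⟩
  · have e1 : d.L (d.x u) = d.L (d.x t) := congrArg Complex.re hw
    have e2 : d.N (d.y u) = d.N (d.y t) := congrArg Complex.im hw
    rcases h.profile_L.eq_cases e1 with ⟨m, hm⟩ | ⟨m, hm⟩ <;>
      rcases h.profile_N.eq_cases e2 with ⟨n, hn⟩ | ⟨n, hn⟩
    · exact .inl ⟨m, n, .inl ⟨hm, hn⟩⟩
    · exact .inr (.inr (.inl ⟨m, n, .inl ⟨hm, hn⟩⟩))
    · exact .inr (.inl ⟨m, n, .inl ⟨hm, hn⟩⟩)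
    · exact .inr (.inr (.inr ⟨m, n, .inl ⟨hm, hn⟩⟩))
  · have e1 : d.L (d.x u) = -d.L (d.x t) := congrArg Complex.re hw
    have e2 : d.N (d.y u) = -d.N (d.y t) := congrArg Complex.im hw
    rcases h.profile_L.eq_neg_cases e1 with ⟨m, hm⟩ | ⟨m, hm⟩ <;>
      rcases h.profile_N.eq_neg_cases e2 with ⟨n, hn⟩ | ⟨n, hn⟩
    · exact .inl ⟨m, n, .inr ⟨hE, hm, hn⟩⟩
    · exact .inr (.inr (.inl ⟨m, n, .inr ⟨hE, hm, hn⟩⟩))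
    · exact .inr (.inl ⟨m, n, .inr ⟨hE, hm, hn⟩⟩)
    · exact .inr (.inr (.inr ⟨m, n, .inr ⟨hE, hm, hn⟩⟩))

/-- The phases are affine in time, so if time reversal matches `t` with `u`, it fixes the phase at
their midpoint. -/
theorem IsRegular.add_notMem (hr : d.IsRegular E) (t u : ℝ) :
    (d.x u + d.x t - 1 / 2, d.y u + d.y t - 1 / 2) ∉ lattice E := by
  have := hr ((t + u) / 2)
  convert this using 3 <;> simp only [x, y] <;> ring

theorem IsClosing.sub_notMem (hc : d.IsClosing E) {t u : ℝ} (ht : t ∈ Ico (0 : ℝ) 1)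
    (hu : u ∈ Ico (0 : ℝ) 1) (htu : t ≠ u) : (d.x u - d.x t, d.y u - d.y t) ∉ lattice E := by
  intro hm
  obtain ⟨n, hn⟩ := hc.minimal (u - t) (by
    convert hm using 2 <;> simp only [x, y] <;> ring)
  have h1 : (n : ℝ) < 1 := by linarith [ht.1, hu.2]
  have h2 : (-1 : ℝ) < n := by linarith [ht.2, hu.1]
  have h3 : n < 1 := by exact_mod_cast h1
  have h4 : -1 < n := by exact_mod_cast h2
  obtain rfl : n = 0 := by omega
  apply htu
  simp only [Int.cast_zero] at hn
  linarith

/-- The chart degenerates only at `w = 0`, where both profiles vanish, and the velocity vanishes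
only where both profiles turn. In both cases the phase is a fixed point of time reversal. -/
theorem IsRegular.deriv_ne_zero (h : d.IsAdmissible) (hF : IsChart E F F') (hr : d.IsRegular E)
    (t : ℝ) : F' (d.path t) ≠ 0 ∧ d.velocity t ≠ 0 := by
  refine ⟨hF.deriv_ne_zero _ (h.abs_lt _) fun hE h0 => ?_, fun h0 => ?_⟩
  · obtain ⟨m, hm⟩ := h.profile_L.eq_zero (congrArg Complex.re h0)
    obtain ⟨n, hn⟩ := h.profile_N.eq_zero (congrArg Complex.im h0)
    exact hr t ⟨m - 1, n - 1, .inr ⟨hE, by push_cast; linarith, by push_cast; linarith⟩⟩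
  · have e1 : d.κ * deriv d.L (d.x t) = 0 := congrArg Complex.re h0
    have e2 : d.κ' * deriv d.N (d.y t) = 0 := congrArg Complex.im h0
    obtain ⟨m, hm⟩ := h.profile_L.deriv_eq_zero ((mul_eq_zero.1 e1).resolve_left h.κ_pos.ne')
    obtain ⟨n, hn⟩ := h.profile_N.deriv_eq_zero ((mul_eq_zero.1 e2).resolve_left h.κ'_pos.ne')
    exact hr t ⟨m, n, .inl ⟨hm, hn⟩⟩

/-- Only coincidences reflecting exactly one phase remain. There the velocity `(A, B)` in the
covering plane becomes `(-A, B)` or `(A, -B)`, up to the sign of the sheet, which the odd `F'`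
compensates. These are independent as soon as `A` and `B` are non-zero. -/
theorem transverse_of_coincidence (h : d.IsAdmissible) (hF : IsChart E F F') (hr : d.IsRegular E)
    {t u : ℝ} (hs : (d.x u - d.x t, d.y u - d.y t) ∉ lattice E)
    (he : F (d.path t) = F (d.path u)) :
    Transverse (F' (d.path t) * d.velocity t) (F' (d.path u) * d.velocity u) := by
  have hc := (hr.deriv_ne_zero h hF t).1
  -- If one component of the velocity vanishes, reflecting the corresponding phase changes it by an
  -- integer only. The single reflection would then be a reflection of none or of both phases.
  have hL : (d.x u + d.x t - 1 / 2, d.y u - d.y t) ∈ lattice E ∨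
      (d.x u - d.x t, d.y u + d.y t - 1 / 2) ∈ lattice E →
      d.κ * deriv d.L (d.x t) ≠ 0 ∧ d.κ' * deriv d.N (d.y t) ≠ 0 := by
    intro hm
    constructor <;> intro h0
    · obtain ⟨m, hm'⟩ := h.profile_L.deriv_eq_zero ((mul_eq_zero.1 h0).resolve_left h.κ_pos.ne')
      have hi := int_mem_lattice (E := E) m 0
      rcases hm with hm | hm
      · apply hs
        convert sub_mem hm hi using 1
        simp only [Prod.mk_sub_mk]; congr 1
        · linarith
        · simp
      · apply hr.add_notMem t u
        convert add_mem hm hi using 1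
        simp only [Prod.mk_add_mk]; congr 1
        · linarith
        · simp
    · obtain ⟨m, hm'⟩ := h.profile_N.deriv_eq_zero ((mul_eq_zero.1 h0).resolve_left h.κ'_pos.ne')
      have hi := int_mem_lattice (E := E) 0 m
      rcases hm with hm | hm
      · apply hr.add_notMem t u
        convert add_mem hm hi using 1
        simp only [Prod.mk_add_mk]; congr 1
        · simp
        · linarith
      · apply hs
        convert sub_mem hm hi using 1
        simp only [Prod.mk_sub_mk]; congr 1
        · simp
        · linarith
  have key : ∀ A B : ℝ, A ≠ 0 → B ≠ 0 →
      Transverse ⟨A, B⟩ ⟨-A, B⟩ ∧ Transverse ⟨A, B⟩ ⟨A, -B⟩ := by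
    intro A B hA hB
    have := mul_ne_zero hA hB
    simp only [Transverse]
    exact ⟨fun h => this (by linarith), fun h => this (by linarith)⟩
  rcases coincidence h hF he with hm | hm | hm | hm
  · exact absurd hm hs
  · obtain ⟨hA, hB⟩ := hL (.inl hm)
    obtain ⟨m, n, ⟨h1, h2⟩ | ⟨hE, h1, h2⟩⟩ := mem_lattice.1 hm
    · obtain ⟨e1, e2⟩ := h.profile_L.eq_of_add h1
      obtain ⟨e3, e4⟩ := h.profile_N.eq_of_sub h2
      have hp : d.path u = d.path t := by simp [path, e1, e3]
      have hv : d.velocity u = ⟨-(d.κ * deriv d.L (d.x t)), d.κ' * deriv d.N (d.y t)⟩ := by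
        simp [velocity, e2, e4]
      rw [hp, hv]
      exact transverse_mul hc (key _ _ hA hB).1
    · obtain ⟨e1, e2⟩ := h.profile_L.eq_of_add_half h1
      obtain ⟨e3, e4⟩ := h.profile_N.eq_of_sub_half h2
      have hp : d.path u = -d.path t := by apply Complex.ext <;> simp [path, e1, e3]
      have hv : d.velocity u = -⟨-(d.κ * deriv d.L (d.x t)), d.κ' * deriv d.N (d.y t)⟩ := by
        apply Complex.ext <;> simp [velocity, e2, e4]
      rw [hp, hv, hF.deriv_odd hE, neg_mul_neg]
      exact transverse_mul hc (key _ _ hA hB).1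
  · obtain ⟨hA, hB⟩ := hL (.inr hm)
    obtain ⟨m, n, ⟨h1, h2⟩ | ⟨hE, h1, h2⟩⟩ := mem_lattice.1 hm
    · obtain ⟨e1, e2⟩ := h.profile_L.eq_of_sub h1
      obtain ⟨e3, e4⟩ := h.profile_N.eq_of_add h2
      have hp : d.path u = d.path t := by simp [path, e1, e3]
      have hv : d.velocity u = ⟨d.κ * deriv d.L (d.x t), -(d.κ' * deriv d.N (d.y t))⟩ := by
        simp [velocity, e2, e4]
      rw [hp, hv]
      exact transverse_mul hc (key _ _ hA hB).2
    · obtain ⟨e1, e2⟩ := h.profile_L.eq_of_sub_half h1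
      obtain ⟨e3, e4⟩ := h.profile_N.eq_of_add_half h2
      have hp : d.path u = -d.path t := by apply Complex.ext <;> simp [path, e1, e3]
      have hv : d.velocity u = -⟨d.κ * deriv d.L (d.x t), -(d.κ' * deriv d.N (d.y t))⟩ := by
        apply Complex.ext <;> simp [velocity, e2, e4]
      rw [hp, hv, hF.deriv_odd hE, neg_mul_neg]
      exact transverse_mul hc (key _ _ hA hB).2
  · exact absurd hm (hr.add_notMem t u)

/-- A Lissajous curve that avoids the fixed points of the time reversal is generic. -/
theorem IsRegular.isGenericImmersion (h : d.IsAdmissible) (hF : IsChart E F F')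
    (hc : d.IsClosing E) (hr : d.IsRegular E) : IsGenericImmersion fun t => F (d.path t) := by
  have hd := fun t => (h.hasDerivAt_comp hF t).deriv
  refine ⟨⟨periodic h hF hc, (h.contDiff_comp hF).of_le (by exact_mod_cast le_top), fun t => ?_⟩,
    ?_, fun p => ?_⟩
  · rw [hd]
    exact mul_ne_zero (hr.deriv_ne_zero h hF t).1 (hr.deriv_ne_zero h hF t).2
  · intro t ht u hu htu he
    rw [hd, hd]
    exact transverse_of_coincidence h hF hr (hc.sub_notMem ht hu htu) he
  · by_contra hcon
    obtain ⟨S, hS, hS3⟩ := Set.exists_subset_encard_eq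
      (show (3 : ℕ∞) ≤ _ from Order.add_one_le_of_lt (not_le.1 hcon))
    obtain ⟨t, u, v, htu, htv, huv, rfl⟩ := Set.encard_eq_three.1 hS3
    obtain ⟨ht, et⟩ := hS (show t ∈ _ by simp)
    obtain ⟨hu, eu⟩ := hS (show u ∈ _ by simp)
    obtain ⟨hv, ev⟩ := hS (show v ∈ _ by simp)
    -- If `u` and `v` are related to `t` by the same single reflection, the difference identifies
    -- their phases; if by different ones, the sum makes them related by time reversal. Both are
    -- excluded.
    have c1 := (coincidence h hF (et.trans eu.symm)).resolve_left (hc.sub_notMem ht hu htu)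
    have c2 := (coincidence h hF (et.trans ev.symm)).resolve_left (hc.sub_notMem ht hv htv)
    have n1 := hc.sub_notMem hu hv huv
    have n2 := hr.add_notMem u v
    rcases c1 with c1 | c1 | c1
    · rcases c2 with c2 | c2 | c2
      · apply n1
        convert sub_mem c2 c1 using 1
        simp
      · apply n2
        convert add_mem c2 c1 using 1
        simp only [Prod.mk_add_mk]; congr 1 <;> ring
      · exact hr.add_notMem t v c2
    · rcases c2 with c2 | c2 | c2
      · apply n2
        convert add_mem c2 c1 using 1
        simp only [Prod.mk_add_mk]; congr 1 <;> ring
      · apply n1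
        convert sub_mem c2 c1 using 1
        simp
      · exact hr.add_notMem t v c2
    · exact hr.add_notMem t u c1

/-! ### Interpolation -/

/-- Linear interpolation of the profiles and the phases. -/
def interp (d d' : Lissajous) (s : ℝ) : Lissajous where
  L := lerp s d.L d'.L
  N := lerp s d.N d'.N
  κ := d.κ
  κ' := d.κ'
  a := (1 - s) * d.a + s * d'.a
  b := (1 - s) * d.b + s * d'.b

theorem IsAdmissible.interp {d d' : Lissajous} (h : d.IsAdmissible) (h' : d'.IsAdmissible)
    {s : ℝ} (hs : s ∈ Icc (0 : ℝ) 1) : (d.interp d' s).IsAdmissible where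
  profile_L := h.profile_L.lerp h'.profile_L hs
  profile_N := h.profile_N.lerp h'.profile_N hs
  abs_lt x := by
    have h1 := _root_.abs_lt.1 (h.abs_lt x)
    have h2 := _root_.abs_lt.1 (h'.abs_lt x)
    have e1 := lerp_pos hs (x := x) (f := fun x => Real.pi - d.N x) (g := fun x => Real.pi - d'.N x)
      (by linarith) (by linarith)
    have e2 := lerp_pos hs (x := x) (f := fun x => Real.pi + d.N x) (g := fun x => Real.pi + d'.N x)
      (by linarith) (by linarith)
    simp only [lerp, Lissajous.interp] at *
    exact _root_.abs_lt.2 ⟨by linarith, by linarith⟩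
  κ_pos := h.κ_pos
  κ'_pos := h.κ'_pos

theorem isC1Family_interp {d d' : Lissajous} (h : d.IsAdmissible) (h' : d'.IsAdmissible)
    (hF : IsChart E F F') (hc : d.IsClosing E) :
    IsC1Family fun s t => F ((d.interp d' s).path t) := by
  have hadm := fun s hs => h.interp h' (s := s) hs
  have hL := h.profile_L.smooth
  have hN := h.profile_N.smooth
  have hL' := h'.profile_L.smooth
  have hN' := h'.profile_N.smooth
  have := hL.continuous
  have := hN.continuous
  have := hL'.continuous
  have := hN'.continuous
  have := hL.continuous_deriv (by simp)
  have := hN.continuous_deriv (by simp)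
  have := hL'.continuous_deriv (by simp)
  have := hN'.continuous_deriv (by simp)
  have hp : Continuous fun x : ℝ × ℝ => (d.interp d' x.1).path x.2 := by
    simp only [path_eq, interp, lerp, x, y]
    fun_prop
  have hv : Continuous fun x : ℝ × ℝ => (d.interp d' x.1).velocity x.2 := by
    simp only [velocity_eq, interp, h.profile_L.deriv_lerp h'.profile_L,
      h.profile_N.deriv_lerp h'.profile_N, lerp, x, y]
    fun_prop
  refine ⟨fun s hs => periodic (hadm s hs) hF ⟨hc.mem, hc.minimal⟩,
    fun s hs => ((hadm s hs).contDiff_comp hF).of_le (by exact_mod_cast le_top), ?_, ?_⟩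
  · exact (hF.smooth.continuous.comp hp).continuousOn
  · refine ContinuousOn.congr (f := fun x : ℝ × ℝ => F' ((d.interp d' x.1).path x.2) *
      (d.interp d' x.1).velocity x.2) ?_ fun x hx => ((hadm x.1 hx.1).hasDerivAt_comp hF x.2).deriv
    exact ((hF.continuous_deriv.comp hp).mul hv).continuousOn

theorem interp_zero (d d' : Lissajous) : d.interp d' 0 = d := by
  cases d; simp [interp, lerp, funext_iff]

theorem interp_one {d d' : Lissajous} (h1 : d.κ = d'.κ) (h2 : d.κ' = d'.κ') :
    d.interp d' 1 = d' := by
  cases d; cases d'; simp_all [interp, lerp, funext_iff]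

theorem jPlus_eq {d d' : Lissajous} (h : d.IsAdmissible) (h' : d'.IsAdmissible)
    (hF : IsChart E F F') (hc : d.IsClosing E) (h1 : d.κ = d'.κ) (h2 : d.κ' = d'.κ')
    (hr : ∀ s ∈ Icc (0 : ℝ) 1, (d.interp d' s).IsRegular E) :
    JPlus (fun t => F (d.path t)) = JPlus fun t => F (d'.path t) := by
  have := jPlus_eq_of_isIsotopy (Γ := fun s t => F ((d.interp d' s).path t))
    ⟨isC1Family_interp h h' hF hc, fun s hs =>
      (hr s hs).isGenericImmersion (h.interp h' hs) hF ⟨hc.mem, hc.minimal⟩⟩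
  simpa only [interp_zero, interp_one h1 h2] using this

end Lissajous

end TwoCenter

namespace TwoCenter

/-! ### The charts -/

theorem cosh_eq_mk (u : ℂ) :
    Complex.cosh u = ⟨Real.cosh u.re * Real.cos u.im, Real.sinh u.re * Real.sin u.im⟩ := by
  rw [Complex.mk_eq_add_mul_I]
  conv_lhs => rw [← Complex.re_add_im u]
  rw [Complex.cosh_add, Complex.cosh_mul_I, Complex.sinh_mul_I]
  push_cast
  ring

theorem sinh_eq_mk (u : ℂ) :
    Complex.sinh u = ⟨Real.sinh u.re * Real.cos u.im, Real.cosh u.re * Real.sin u.im⟩ := by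
  rw [Complex.mk_eq_add_mul_I]
  conv_lhs => rw [← Complex.re_add_im u]
  rw [Complex.sinh_add, Complex.cosh_mul_I, Complex.sinh_mul_I]
  push_cast
  ring

theorem cosh_ne_zero_of_abs_im_lt {u : ℂ} (h : |u.im| < Real.pi / 2) : Complex.cosh u ≠ 0 := by
  intro h0
  have h1 : Real.cosh u.re * Real.cos u.im = 0 := congrArg Complex.re ((cosh_eq_mk u).symm.trans h0)
  have := mul_pos (Real.cosh_pos u.re) (Real.cos_pos_of_mem_Ioo (abs_lt.1 h))
  linarith

theorem eq_zero_of_sinh_eq_zero {u : ℂ} (h : |u.im| < Real.pi / 2) (h0 : Complex.sinh u = 0) :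
    u = 0 := by
  have e := (sinh_eq_mk u).symm.trans h0
  have h1 : Real.sinh u.re * Real.cos u.im = 0 := congrArg Complex.re e
  have h2 : Real.cosh u.re * Real.sin u.im = 0 := congrArg Complex.im e
  have hc := Real.cos_pos_of_mem_Ioo (abs_lt.1 h)
  have hre := Real.sinh_eq_zero.1 ((mul_eq_zero.1 h1).resolve_right hc.ne')
  have hs := (mul_eq_zero.1 h2).resolve_left (Real.cosh_pos u.re).ne'
  have hp := Real.pi_pos
  have him := (Real.sin_eq_zero_iff_of_lt_of_lt (by linarith [(abs_lt.1 h).1])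
    (by linarith [(abs_lt.1 h).2])).1 hs
  exact Complex.ext hre him

theorem abs_im_half_lt {w : ℂ} (h : |w.im| < Real.pi) : |(w / 2).im| < Real.pi / 2 := by
  have : (w / 2).im = w.im / 2 := by simp
  rw [this, abs_div, abs_two]
  linarith

/-- The difference is `2 cosh ((w+z)/4) sinh ((w-z)/4)`. In the strip the first factor has no zeros
and the second vanishes only for `w = z`. -/
theorem eq_of_sinh_half_eq {w z : ℂ} (hw : |w.im| < Real.pi) (hz : |z.im| < Real.pi)
    (h : Complex.sinh (w / 2) = Complex.sinh (z / 2)) : z = w := by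
  have e : Complex.sinh (w / 2) - Complex.sinh (z / 2) =
      2 * Complex.cosh ((w + z) / 2 / 2) * Complex.sinh ((w - z) / 2 / 2) := by
    have e1 : w / 2 = (w + z) / 2 / 2 + (w - z) / 2 / 2 := by ring
    have e2 : z / 2 = (w + z) / 2 / 2 - (w - z) / 2 / 2 := by ring
    rw [e1, Complex.sinh_add, e2, Complex.sinh_sub]
    ring_nf
  rw [h, sub_self] at e
  have hw' := abs_lt.1 hw
  have hz' := abs_lt.1 hz
  have i1 : |((w + z) / 2).im| < Real.pi := by
    have : ((w + z) / 2).im = (w.im + z.im) / 2 := by simp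
    rw [this]; exact abs_lt.2 ⟨by linarith, by linarith⟩
  have i2 : |((w - z) / 2).im| < Real.pi := by
    have : ((w - z) / 2).im = (w.im - z.im) / 2 := by simp
    rw [this]; exact abs_lt.2 ⟨by linarith, by linarith⟩
  have h1 := cosh_ne_zero_of_abs_im_lt (abs_im_half_lt i1)
  have h2 := eq_zero_of_sinh_eq_zero (abs_im_half_lt i2)
    ((mul_eq_zero.1 e.symm).resolve_left (mul_ne_zero two_ne_zero h1))
  have : w - z = 0 := by simpa using h2
  exact (sub_eq_zero.1 this).symm

/-- The position relative to a primary, as a function of the elliptic coordinate. -/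
noncomputable def loopMap (c w : ℂ) : ℂ := (c * Complex.sinh (w / 2)) ^ 2

noncomputable def loopMapDeriv (c w : ℂ) : ℂ := c ^ 2 * Complex.sinh (w / 2) * Complex.cosh (w / 2)

/-- A square root of `loopMap`, injective on the strip: the coordinate on the preimage under `z ↦
z²`. -/
noncomputable def liftMap (c w : ℂ) : ℂ := c * Complex.sinh (w / 2)

theorem contDiff_liftMap (c : ℂ) : ContDiff ℝ (⊤ : ℕ∞) (liftMap c) := by
  have : ContDiff ℂ (⊤ : ℕ∞) (liftMap c) := by
    unfold liftMap
    have h : ContDiff ℂ (⊤ : ℕ∞) Complex.sinh := Complex.contDiff_sinh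
    exact contDiff_const.mul (h.comp (contDiff_id.div_const 2))
  exact this.restrict_scalars ℝ

theorem isChart_liftMap {c : ℂ} (hc : c ≠ 0) :
    IsChart False (liftMap c) fun w => c * (Complex.cosh (w / 2) * (1 / 2)) where
  hasDerivAt w := (((hasDerivAt_id w).div_const 2).csinh).const_mul c
  smooth := contDiff_liftMap c
  continuous_deriv := by fun_prop
  eq w z hw hz h := .inl (eq_of_sinh_half_eq hw hz (mul_left_cancel₀ hc h))
  even := False.elim
  deriv_odd := False.elim
  deriv_ne_zero w hw _ :=
    mul_ne_zero hc (mul_ne_zero (cosh_ne_zero_of_abs_im_lt (abs_im_half_lt hw)) (by norm_num))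

theorem isChart_loopMap {c : ℂ} (hc : c ≠ 0) : IsChart True (loopMap c) (loopMapDeriv c) where
  hasDerivAt w := by
    refine (((((hasDerivAt_id w).div_const 2).csinh).const_mul c).pow 2).congr_deriv ?_
    simp [loopMapDeriv]
    ring
  smooth := (contDiff_liftMap c).pow 2
  continuous_deriv := by unfold loopMapDeriv; fun_prop
  eq w z hw hz h := by
    unfold loopMap at h
    rw [mul_pow, mul_pow] at h
    rcases sq_eq_sq_iff_eq_or_eq_neg.1 (mul_left_cancel₀ (pow_ne_zero 2 hc) h) with h | h
    · exact .inl (eq_of_sinh_half_eq hw hz h)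
    · refine .inr ⟨trivial, ?_⟩
      rw [← Complex.sinh_neg, ← neg_div] at h
      have := eq_of_sinh_half_eq hw (z := -z) (by simpa using hz) h
      rw [← this, neg_neg]
  even _ w := by simp [loopMap, neg_div]
  deriv_odd _ w := by simp [loopMapDeriv, neg_div]
  deriv_ne_zero w hw h0 := by
    refine mul_ne_zero (mul_ne_zero (pow_ne_zero 2 hc) fun h => h0 trivial ?_)
      (cosh_ne_zero_of_abs_im_lt (abs_im_half_lt hw))
    simpa using eq_zero_of_sinh_eq_zero (abs_im_half_lt hw) h

theorem loopMap_eq_zero {c w : ℂ} (hc : c ≠ 0) (hw : |w.im| < Real.pi) (h : loopMap c w = 0) :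
    w = 0 := by
  have := (mul_eq_zero.1 (eq_zero_of_pow_eq_zero h)).resolve_left hc
  simpa using eq_zero_of_sinh_eq_zero (abs_im_half_lt hw) this

/-! ### Arithmetic of the rotation number -/

/-- The fraction of the period of the torus after which an orbit with rotation number `k / l`
closes up modulo the exchange of the sheets. -/
noncomputable def closingFraction (k l : ℕ) : ℝ :=
  open Classical in if Odd k ∧ Odd l then 1 / 2 else 1

theorem closingFraction_cases {k l : ℕ} (hkl : Nat.Coprime k l) :
    (closingFraction k l = 1 ∧ Odd ((l : ℤ) - k)) ∨
      (closingFraction k l = 1 / 2 ∧ Odd k ∧ Odd l) := by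
  unfold closingFraction
  split_ifs with h
  · exact .inr ⟨rfl, h⟩
  · refine .inl ⟨rfl, ?_⟩
    rcases Nat.even_or_odd k with hk | hk <;> rcases Nat.even_or_odd l with hl | hl
    · have := Nat.dvd_gcd hk.two_dvd hl.two_dvd
      rw [hkl] at this
      omega
    · exact ((Int.odd_coe_nat l).2 hl).sub_even ((Int.even_coe_nat k).2 hk)
    · exact ((Int.even_coe_nat l).2 hl).sub_odd ((Int.odd_coe_nat k).2 hk)
    · exact absurd ⟨hk, hl⟩ h

theorem closingFraction_pos (k l : ℕ) : 0 < closingFraction k l := by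
  unfold closingFraction
  split_ifs <;> norm_num

theorem half_le_closingFraction (k l : ℕ) : 1 / 2 ≤ closingFraction k l := by
  unfold closingFraction
  split_ifs <;> norm_num

theorem exists_bezout {k l : ℕ} (hkl : Nat.Coprime k l) (r : ℤ) :
    ∃ m n : ℤ, (l : ℤ) * m - k * n = r := by
  have h := (Nat.isCoprime_iff_coprime.2 hkl)
  obtain ⟨a, b, hab⟩ := h
  exact ⟨b * r, -a * r, by linear_combination r * hab⟩

theorem int_of_mul_int {k l : ℕ} (hkl : Nat.Coprime k l) {r : ℝ} {m n : ℤ} (h1 : k * r = m)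
    (h2 : l * r = n) : ∃ p : ℤ, r = p := by
  obtain ⟨a, b, hab⟩ := Nat.isCoprime_iff_coprime.2 hkl
  have : (a : ℝ) * k + b * l = 1 := by exact_mod_cast hab
  exact ⟨a * m + b * n, by push_cast; linear_combination a * h1 + b * h2 - r * this⟩

/-! ### Closing, phase difference and regularity for the frequencies of type `T_{k,l}` -/

namespace Lissajous

/-- The frequencies of the curve are those of a `T_{k,l}`-type orbit. -/
def HasType (k l : ℕ) (d : Lissajous) : Prop :=
  d.κ = closingFraction k l * k ∧ d.κ' = closingFraction k l * l

variable {k l : ℕ} {d : Lissajous}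

theorem HasType.isClosing (hkl : Nat.Coprime k l) (ht : d.HasType k l) : d.IsClosing True := by
  rcases closingFraction_cases hkl with ⟨hq, ho⟩ | ⟨hq, ⟨p, hp⟩, ⟨r, hr⟩⟩
  · refine ⟨⟨k, l, .inl ?_⟩, fun r hr => ?_⟩
    · rw [ht.1, ht.2, hq]; simp
    · rw [ht.1, ht.2, hq, one_mul, one_mul] at hr
      obtain ⟨m, n, ⟨h1, h2⟩ | ⟨-, h1, h2⟩⟩ := mem_lattice.1 hr
      · exact int_of_mul_int hkl h1 h2
      -- If `kr` and `lr` were both half-integers, `2r` would be an integer with `k·2r` and `l·2r`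
      -- odd. Then `k` and `l` would both be odd, which is the other case.
      · exfalso
        obtain ⟨p, hp⟩ := int_of_mul_int hkl (r := 2 * r) (m := 2 * m + 1) (n := 2 * n + 1)
          (by push_cast; linarith) (by push_cast; linarith)
        have e1 : ((k * p : ℤ) : ℝ) = (2 * m + 1 : ℤ) := by push_cast; rw [← hp]; linarith
        have e2 : ((l * p : ℤ) : ℝ) = (2 * n + 1 : ℤ) := by push_cast; rw [← hp]; linarith
        have e1' := Int.cast_injective e1
        have e2' := Int.cast_injective e2
        have o1 : Odd ((k : ℤ) * p) := ⟨m, e1'⟩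
        have o2 : Odd ((l : ℤ) * p) := ⟨n, e2'⟩
        have := (Int.odd_mul.1 o2).1.sub_odd (Int.odd_mul.1 o1).1
        exact Int.not_odd_iff_even.2 this ho
  · refine ⟨⟨p, r, .inr ⟨trivial, ?_⟩⟩, fun s hs => ?_⟩
    · rw [ht.1, ht.2, hq]
      constructor
      · rw [hp]; push_cast; ring
      · rw [hr]; push_cast; ring
    · rw [ht.1, ht.2, hq] at hs
      obtain ⟨m, n, ⟨h1, h2⟩ | ⟨-, h1, h2⟩⟩ := mem_lattice.1 hs
      · exact int_of_mul_int hkl (m := 2 * m) (n := 2 * n) (by push_cast; linarith)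
          (by push_cast; linarith)
      · exact int_of_mul_int hkl (m := 2 * m + 1) (n := 2 * n + 1) (by push_cast; linarith)
          (by push_cast; linarith)

/-- The phase difference, which distinguishes the curves on a torus. -/
def phase (d : Lissajous) : ℝ := d.κ' * d.a - d.κ * d.b

theorem four_mul_phase (t : ℝ) : 4 * d.phase =
    2 * (d.κ' * (2 * d.x t - 1 / 2) - d.κ * (2 * d.y t - 1 / 2)) + (d.κ' - d.κ) := by
  simp only [phase, x, y]; ring

/-- The right side of `four_mul_phase` does not depend on time. As a function of `(2x - 1/2, 2y -
1/2)` it takes exactly the integer values on the lattice: all of them by Bézout, using integer or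
half-integer lattice points according to parity when the closing fraction is `1`. -/
theorem HasType.isRegular_iff (hk : 0 < k) (hkl : Nat.Coprime k l) (ht : d.HasType k l) :
    d.IsRegular True ↔ ∀ n : ℤ, 4 * d.phase ≠ n := by
  have hκ : d.κ ≠ 0 := by
    rw [ht.1]
    exact mul_ne_zero (closingFraction_pos k l).ne' (by exact_mod_cast hk.ne')
  constructor
  · intro hr j hj
    have key : ∃ X Y : ℝ, (X, Y) ∈ lattice True ∧
        2 * (d.κ' * X - d.κ * Y) + (d.κ' - d.κ) = j := by
      rcases closingFraction_cases hkl with ⟨hq, r, ho⟩ | ⟨hq, -, -⟩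
      · rw [ht.1, ht.2, hq]
        have ho' : (l : ℝ) - k = 2 * r + 1 := by exact_mod_cast ho
        rcases Int.even_or_odd j with ⟨i, hi⟩ | ⟨i, hi⟩
        · obtain ⟨m, n, hmn⟩ := exists_bezout hkl (i - (2 * r + 1))
          have hmn' : (l : ℝ) * m - k * n = i - (2 * r + 1) := by exact_mod_cast hmn
          exact ⟨_, _, half_mem_lattice trivial m n, by rw [hi]; push_cast; linarith⟩
        · obtain ⟨m, n, hmn⟩ := exists_bezout hkl (i - r)
          have hmn' : (l : ℝ) * m - k * n = i - r := by exact_mod_cast hmn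
          exact ⟨_, _, int_mem_lattice m n, by rw [hi]; push_cast; linarith⟩
      · rw [ht.1, ht.2, hq]
        obtain ⟨m, n, hmn⟩ := exists_bezout hkl (j - (l - k))
        have hmn' : (l : ℝ) * m - k * n = j - (l - k) := by exact_mod_cast hmn
        exact ⟨_, _, half_mem_lattice trivial m n, by linarith⟩
    obtain ⟨X, Y, hm, e⟩ := key
    -- The time at which the first coordinate hits the lattice point; equality of the phase
    -- differences then forces the second coordinate, because `κ ≠ 0`.
    set t := ((X + 1 / 2) / 2 - d.a) / d.κ with htdef
    have hx : 2 * d.x t - 1 / 2 = X := by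
      simp only [x, htdef]; field_simp; ring
    apply hr t
    have h4 := four_mul_phase (d := d) t
    rw [hx] at h4 ⊢
    have : d.κ * (2 * d.y t - 1 / 2) = d.κ * Y := by linarith
    rwa [mul_left_cancel₀ hκ this]
  · intro h t hm
    have h4 := four_mul_phase (d := d) t
    obtain ⟨m, n, ⟨h1, h2⟩ | ⟨-, h1, h2⟩⟩ := mem_lattice.1 hm <;> rw [h1, h2, ht.1, ht.2] at h4 <;>
      rcases closingFraction_cases hkl with ⟨hq, -⟩ | ⟨hq, ⟨p, hp⟩, ⟨r, hr⟩⟩ <;> rw [hq] at h4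
    · exact h (2 * (l * m - k * n) + (l - k)) (by push_cast; linarith)
    · rw [hp, hr] at h4
      exact h ((2 * r + 1) * m - (2 * p + 1) * n + (r - p)) (by push_cast at h4 ⊢; linarith)
    · exact h (2 * (l * m - k * n) + 2 * (l - k)) (by push_cast; linarith)
    · exact h ((l * m - k * n) + (l - k)) (by push_cast; linarith)

/-- Translating the phases by a lattice vector leaves the curve unchanged; this realizes every
multiple of `1/2` as the resulting change of the phase difference. -/
theorem exists_lattice_shift (hkl : Nat.Coprime k l) (ht : d.HasType k l) (r : ℤ) :
    ∃ X Y : ℝ, (X, Y) ∈ lattice True ∧ d.κ' * X - d.κ * Y = r / 2 := by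
  rcases closingFraction_cases hkl with ⟨hq, p, ho⟩ | ⟨hq, -, -⟩ <;> rw [ht.1, ht.2, hq]
  · have ho' : (l : ℝ) - k = 2 * p + 1 := by exact_mod_cast ho
    rcases Int.even_or_odd r with ⟨i, hi⟩ | ⟨i, hi⟩
    · obtain ⟨m, n, hmn⟩ := exists_bezout hkl i
      have hmn' : (l : ℝ) * m - k * n = i := by exact_mod_cast hmn
      exact ⟨_, _, int_mem_lattice m n, by rw [hi]; push_cast; linarith⟩
    · obtain ⟨m, n, hmn⟩ := exists_bezout hkl (i - p)
      have hmn' : (l : ℝ) * m - k * n = i - p := by exact_mod_cast hmn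
      exact ⟨_, _, half_mem_lattice trivial m n, by rw [hi]; push_cast; linarith⟩
  · obtain ⟨m, n, hmn⟩ := exists_bezout hkl r
    have hmn' : (l : ℝ) * m - k * n = r := by exact_mod_cast hmn
    exact ⟨_, _, int_mem_lattice m n, by linarith⟩

/-! ### The lift under the squaring map -/

/-- The curve, followed over the whole period of the torus. -/
def cover (k l : ℕ) (d : Lissajous) : Lissajous := { d with κ := k, κ' := l }

theorem isClosing_cover (hkl : Nat.Coprime k l) : (d.cover k l).IsClosing False := by
  refine ⟨by exact_mod_cast int_mem_lattice (E := False) k l, fun r hr => ?_⟩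
  obtain ⟨m, n, ⟨h1, h2⟩ | ⟨hF, -⟩⟩ := mem_lattice.1 hr
  · exact int_of_mul_int hkl h1 h2
  · exact hF.elim

theorem isAdmissible_cover (hk : 0 < k) (hl : 0 < l) (h : d.IsAdmissible) :
    (d.cover k l).IsAdmissible :=
  ⟨h.profile_L, h.profile_N, h.abs_lt, Nat.cast_pos.2 hk, Nat.cast_pos.2 hl⟩

theorem cover_x (ht : d.HasType k l) (t : ℝ) :
    (d.cover k l).x t = d.x (t / closingFraction k l) := by
  have := (closingFraction_pos k l).ne'
  simp only [cover, x, ht.1]; field_simp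

theorem cover_y (ht : d.HasType k l) (t : ℝ) :
    (d.cover k l).y t = d.y (t / closingFraction k l) := by
  have := (closingFraction_pos k l).ne'
  simp only [cover, y, ht.2]; field_simp

theorem cover_path (ht : d.HasType k l) (t : ℝ) :
    (d.cover k l).path t = d.path (t / closingFraction k l) := by
  unfold path
  rw [cover_x ht, cover_y ht]; rfl

theorem IsRegular.cover (ht : d.HasType k l) (hr : d.IsRegular True) :
    (d.cover k l).IsRegular False := by
  intro t hm
  rw [cover_x ht, cover_y ht] at hm
  obtain ⟨m, n, h | ⟨hF, -⟩⟩ := mem_lattice.1 hm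
  · exact hr _ ⟨m, n, .inl h⟩
  · exact hF.elim

variable {c : ℂ}

theorem loopMap_ne_zero (h : d.IsAdmissible) (hr : d.IsRegular True) (hc : c ≠ 0) (t : ℝ) :
    loopMap c (d.path t) ≠ 0 := by
  intro h0
  have := (hr.deriv_ne_zero h (isChart_loopMap hc) t).1
  apply this
  rw [loopMap_eq_zero hc (h.abs_lt _) h0]
  simp [loopMapDeriv]

theorem isGenericImmersion_lift (hk : 0 < k) (hl : 0 < l) (hkl : Nat.Coprime k l) (hc : c ≠ 0)
    (h : d.IsAdmissible) (ht : d.HasType k l) (hr : d.IsRegular True) :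
    IsGenericImmersion fun t => liftMap c ((d.cover k l).path t) :=
  (hr.cover ht).isGenericImmersion (isAdmissible_cover hk hl h) (isChart_liftMap hc)
    (isClosing_cover hkl)

/-- `𝒥₂` of a Lissajous curve is `J⁺` of the curve on the double cover. -/
theorem jTwo_eq (hk : 0 < k) (hl : 0 < l) (hkl : Nat.Coprime k l) (hc : c ≠ 0)
    (h : d.IsAdmissible) (ht : d.HasType k l) (hr : d.IsRegular True) :
    JTwo (fun t => loopMap c (d.path t)) =
      JPlus fun t => liftMap c ((d.cover k l).path t) := by
  have hF := isChart_loopMap hc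
  have hg := hr.isGenericImmersion h hF (ht.isClosing hkl)
  have hgl := isGenericImmersion_lift hk hl hkl hc h ht hr
  have h0 := loopMap_ne_zero h hr hc
  obtain ⟨n, hn, -⟩ := exists_isWinding hg.periodic hg.contDiff h0
  set δ : ℝ → ℂ := fun t => liftMap c (d.path t) with hδ
  have hδc : Continuous δ := ((isChart_liftMap hc).smooth.comp h.contDiff).continuous
  have hδ2 : ∀ t, δ t ^ 2 = loopMap c (d.path t) := fun t => rfl
  have hs := squareRootLift_eq hδc hδ2 h0
  have hev := hn.even_iff hδc hδ2
  unfold JTwo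
  rw [hn.windingNumber_eq]
  -- With closing fraction `1` the lift closes up after one period, so the winding number is even.
  -- With `1/2` one period exchanges the sheets, the lift changes sign, the winding number is odd,
  -- and the lift over two periods is the curve over the whole torus period.
  rcases closingFraction_cases hkl with ⟨hq, -⟩ | ⟨hq, ⟨p, hp⟩, ⟨r, hr'⟩⟩
  · have e : δ = fun t => liftMap c ((d.cover k l).path t) := by
      funext t; rw [cover_path ht, hq, div_one]
    have h1 : δ 1 = δ 0 := by
      rw [e]; simpa using hgl.periodic 0
    rw [if_pos (hev.2 h1)]
    rw [← e] at hgl ⊢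
    exact jPlus_eq_of_eq_or_neg hgl hs
  · have e : (fun t => liftMap c ((d.cover k l).path t)) = fun t => δ (2 * t) := by
      funext t; rw [cover_path ht, hq]; simp only [hδ]; congr 2; ring
    have h1 : δ 1 = -δ 0 := by
      have hp1 : d.path 1 = -d.path 0 := by
        have e1 : d.x 1 - d.x 0 = p + 1 / 2 := by
          simp only [x, ht.1, hq]; rw [hp]; push_cast; ring
        have e2 : d.y 1 - d.y 0 = r + 1 / 2 := by
          simp only [y, ht.2, hq]; rw [hr']; push_cast; ring
        apply Complex.ext
        · exact (h.profile_L.eq_of_sub_half (m := p) (by exact_mod_cast e1)).1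
        · exact (h.profile_N.eq_of_sub_half (m := r) (by exact_mod_cast e2)).1
      simp only [hδ, hp1, liftMap, neg_div, Complex.sinh_neg, mul_neg]
    have hne : δ 1 ≠ δ 0 := by
      rw [h1]
      intro h2
      apply h0 0
      rw [← hδ2, self_eq_neg.1 h2.symm]
      simp
    rw [if_neg (fun h => hne (hev.1 h)), e]
    rw [e] at hgl
    refine jPlus_eq_of_eq_or_neg hgl ?_
    rcases hs with hs | hs
    · left; rw [hs]
    · right; rw [hs]

/-! ### Normal forms and constancy of the invariants -/

theorem IsGenericImmersion.jOne_reverse {γ : ℝ → ℂ} (h : IsGenericImmersion γ)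
    (h0 : ∀ t, γ t ≠ 0) : JOne (fun t => γ (-t)) = JOne γ := by
  obtain ⟨n, hn, -⟩ := exists_isWinding h.periodic h.contDiff h0
  unfold JOne
  rw [jPlus_reverse, hn.windingNumber_eq, hn.reverse.windingNumber_eq]
  push_cast
  rw [neg_sq]

/-- The invariants agree for phases in the same interval. -/
theorem invariants_eq_of_phase (hk : 0 < k) (hl : 0 < l) (hkl : Nat.Coprime k l) (hc : c ≠ 0)
    {d d' : Lissajous} (h : d.IsAdmissible) (ht : d.HasType k l) (h' : d'.IsAdmissible)
    (ht' : d'.HasType k l) (hp : d.phase ∈ Ioo (0 : ℝ) (1 / 4))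
    (hp' : d'.phase ∈ Ioo (0 : ℝ) (1 / 4)) :
    JOne (fun t => loopMap c (d.path t)) = JOne (fun t => loopMap c (d'.path t)) ∧
      JTwo (fun t => loopMap c (d.path t)) = JTwo fun t => loopMap c (d'.path t) := by
  have hreg : ∀ d : Lissajous, d.HasType k l → d.phase ∈ Ioo (0 : ℝ) (1 / 4) →
      d.IsRegular True := by
    intro d ht hp
    rw [ht.isRegular_iff hk hkl]
    intro n hn
    have h1 : (0 : ℝ) < n := by rw [← hn]; linarith [hp.1]
    have h2 : (n : ℝ) < 1 := by rw [← hn]; linarith [hp.2]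
    have h3 : 0 < n := by exact_mod_cast h1
    have h4 : n < 1 := by exact_mod_cast h2
    omega
  have e1 : d.κ = d'.κ := ht.1.trans ht'.1.symm
  have e2 : d.κ' = d'.κ' := ht.2.trans ht'.2.symm
  have hti : ∀ s, (d.interp d' s).HasType k l := fun s => ht
  -- The frequencies agree, so the phase difference is affine in `s` and stays between the
  -- consecutive singular values `0` and `1/4`.
  have hri : ∀ s ∈ Icc (0 : ℝ) 1, (d.interp d' s).IsRegular True := by
    intro s hs
    refine hreg _ (hti s) ?_
    have : (d.interp d' s).phase = d.phase + s • (d'.phase - d.phase) := by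
      simp only [interp, phase, e1, e2, smul_eq_mul]; ring
    rw [this]
    exact (convex_Ioo (0 : ℝ) (1 / 4)).add_smul_sub_mem hp hp' hs
  have hF := isChart_loopMap hc
  have hcl := ht.isClosing hkl
  constructor
  · have hJ := jPlus_eq h h' hF hcl e1 e2 hri
    obtain ⟨n, h0, h1⟩ := (isC1Family_interp h h' hF hcl).isWinding fun s hs =>
      loopMap_ne_zero (h.interp h' hs) (hri s hs) hc
    simp only [interp_zero, interp_one e1 e2] at h0 h1
    unfold JOne
    rw [hJ, h0.windingNumber_eq, h1.windingNumber_eq]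
  · rw [jTwo_eq hk hl hkl hc h ht (hreg d ht hp), jTwo_eq hk hl hkl hc h' ht' (hreg d' ht' hp')]
    refine jPlus_eq (isAdmissible_cover hk hl h) (isAdmissible_cover hk hl h') (isChart_liftMap hc)
      (isClosing_cover hkl) rfl rfl fun s hs => ?_
    exact (hri s hs).cover (hti s)

/-- Shift of the phases. -/
def translate (X Y : ℝ) (d : Lissajous) : Lissajous := { d with a := d.a + X, b := d.b + Y }

/-- Inversion of the phases. -/
def invert (d : Lissajous) : Lissajous := { d with a := -d.a, b := -d.b }

theorem loopMap_translate (h : d.IsAdmissible) {X Y : ℝ} (hm : (X, Y) ∈ lattice True) (t : ℝ) :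
    loopMap c ((d.translate X Y).path t) = loopMap c (d.path t) := by
  have ex : (d.translate X Y).x t - d.x t = X := by simp only [translate, x]; ring
  have ey : (d.translate X Y).y t - d.y t = Y := by simp only [translate, y]; ring
  obtain ⟨m, n, ⟨h1, h2⟩ | ⟨-, h1, h2⟩⟩ := mem_lattice.1 hm
  · have : (d.translate X Y).path t = d.path t := by
      apply Complex.ext
      · exact (h.profile_L.eq_of_sub (ex.trans h1)).1
      · exact (h.profile_N.eq_of_sub (ey.trans h2)).1
    rw [this]
  · have : (d.translate X Y).path t = -d.path t := by
      apply Complex.ext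
      · exact (h.profile_L.eq_of_sub_half (ex.trans h1)).1
      · exact (h.profile_N.eq_of_sub_half (ey.trans h2)).1
    rw [this]; simp [loopMap, neg_div]

theorem _root_.TwoCenter.IsProfile.odd {L : ℝ → ℝ} (h : IsProfile L) (x : ℝ) : L (-x) = -L x :=
  (h.eq_of_add_half (x := x) (x' := -x) (m := -1) (by push_cast; ring)).1

theorem invert_path (h : d.IsAdmissible) (t : ℝ) : d.invert.path t = -d.path (-t) := by
  have ex : d.invert.x t = -d.x (-t) := by simp only [invert, x]; ring
  have ey : d.invert.y t = -d.y (-t) := by simp only [invert, y]; ring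
  apply Complex.ext
  · exact (congrArg d.L ex).trans (h.profile_L.odd _)
  · exact (congrArg d.N ey).trans (h.profile_N.odd _)

/-- A lattice translation brings the phase difference into `[-1/4, 1/4)` without changing the curve.
If it is then negative, inverting both phases changes its sign and reverses the curve in time, to
which the invariants are insensitive. -/
theorem exists_normal_form (hk : 0 < k) (hl : 0 < l) (hkl : Nat.Coprime k l) (hc : c ≠ 0)
    {d : Lissajous} (h : d.IsAdmissible) (ht : d.HasType k l) (hr : d.IsRegular True) :
    ∃ d' : Lissajous, d'.IsAdmissible ∧ d'.HasType k l ∧ d'.phase ∈ Ioo (0 : ℝ) (1 / 4) ∧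
      JOne (fun t => loopMap c (d'.path t)) = JOne (fun t => loopMap c (d.path t)) ∧
      JTwo (fun t => loopMap c (d'.path t)) = JTwo fun t => loopMap c (d.path t) := by
  set r : ℤ := -⌊2 * d.phase + 1 / 2⌋ with hrdef
  obtain ⟨X, Y, hm, hXY⟩ := exists_lattice_shift hkl ht r
  have h1 := Int.floor_le (2 * d.phase + 1 / 2)
  have h2 := Int.lt_floor_add_one (2 * d.phase + 1 / 2)
  have hrr : (r : ℝ) = -⌊2 * d.phase + 1 / 2⌋ := by rw [hrdef]; push_cast; rfl
  set e := d.translate X Y with he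
  have hea : e.IsAdmissible := ⟨h.1, h.2, h.3, h.4, h.5⟩
  have het : e.HasType k l := ht
  have hep : e.phase = d.phase + r / 2 := by
    rw [← hXY]; simp only [he, translate, phase]; ring
  have hγ : (fun t => loopMap c (e.path t)) = fun t => loopMap c (d.path t) :=
    funext fun t => loopMap_translate h hm t
  have her : ∀ n : ℤ, 4 * e.phase ≠ n := by
    intro n hn
    refine (ht.isRegular_iff hk hkl).1 hr (n - 2 * r) ?_
    push_cast; rw [← hn, hep]; ring
  have hb1 : -1 / 4 ≤ e.phase := by rw [hep, hrr]; linarith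
  have hb2 : e.phase < 1 / 4 := by rw [hep, hrr]; linarith
  have hreg : e.IsRegular True := (het.isRegular_iff hk hkl).2 her
  rcases lt_trichotomy e.phase 0 with hneg | hz | hpos
  · have hb3 : -1 / 4 < e.phase := lt_of_le_of_ne hb1 fun h' => her (-1) (by rw [← h']; norm_num)
    have hia : e.invert.IsAdmissible := ⟨h.1, h.2, h.3, h.4, h.5⟩
    have hip : e.invert.phase = -e.phase := by simp only [invert, phase]; ring
    have hit : e.invert.HasType k l := ht
    have hir : e.invert.IsRegular True := by
      rw [hit.isRegular_iff hk hkl]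
      intro n hn
      exact her (-n) (by push_cast; rw [← hn, hip]; ring)
    refine ⟨e.invert, hia, hit, ⟨by linarith, by linarith⟩, ?_, ?_⟩
    · have : (fun t => loopMap c (e.invert.path t)) =
          fun t => (fun t => loopMap c (e.path t)) (-t) := by
        funext t; rw [invert_path hea]; simp [loopMap, neg_div]
      rw [← hγ, this]
      exact IsGenericImmersion.jOne_reverse
        (hreg.isGenericImmersion hea (isChart_loopMap hc) (het.isClosing hkl))
        (loopMap_ne_zero hea hreg hc)
    · rw [← hγ, jTwo_eq hk hl hkl hc hea het hreg, jTwo_eq hk hl hkl hc hia hit hir]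
      have hg := isGenericImmersion_lift hk hl hkl hc hea het hreg
      have : (fun t => liftMap c ((e.invert.cover k l).path t)) =
          fun t => -(fun t => liftMap c ((e.cover k l).path t)) (-t) := by
        funext t
        have : (e.invert.cover k l).path t = -(e.cover k l).path (-t) :=
          invert_path (isAdmissible_cover hk hl hea) t
        rw [this]; simp [liftMap, neg_div]
      rw [this, jPlus_neg hg.reverse,
        jPlus_reverse fun t => liftMap c ((e.cover k l).path t)]
  · exact absurd (by rw [hz]; simp) (her 0)
  · exact ⟨e, hea, het, ⟨hpos, hb2⟩, by rw [hγ], by rw [hγ]⟩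

/-- The invariants of regular Lissajous curves depend only on the type. -/
theorem exists_invariants (hk : 0 < k) (hl : 0 < l) (hkl : Nat.Coprime k l) (hc : c ≠ 0) :
    ∃ (j₁ : ℚ) (j₂ : ℤ), ∀ d : Lissajous, d.IsAdmissible → d.HasType k l → d.IsRegular True →
      JOne (fun t => loopMap c (d.path t)) = j₁ ∧ JTwo (fun t => loopMap c (d.path t)) = j₂ := by
  by_cases hex : ∃ d : Lissajous, d.IsAdmissible ∧ d.HasType k l ∧ d.phase ∈ Ioo (0 : ℝ) (1 / 4)
  · obtain ⟨d₀, h₀, ht₀, hp₀⟩ := hex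
    refine ⟨JOne fun t => loopMap c (d₀.path t), JTwo fun t => loopMap c (d₀.path t),
      fun d h ht hr => ?_⟩
    obtain ⟨d', h', ht', hp', e1, e2⟩ := exists_normal_form hk hl hkl hc h ht hr
    rw [← e1, ← e2]
    exact invariants_eq_of_phase hk hl hkl hc h' ht' h₀ ht₀ hp' hp₀
  -- Without any data in normal form there is no regular curve of this type, so the values are
  -- arbitrary.
  · refine ⟨0, 0, fun d h ht hr => ?_⟩
    obtain ⟨d', h', ht', hp', -⟩ := exists_normal_form hk hl hkl hc h ht hr
    exact absurd ⟨d', h', ht', hp'⟩ hex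

end Lissajous

end TwoCenter

namespace TwoCenter

/-! ### Symmetric oscillations -/

/-- `(y, p)` is a solution of `y' = 4p`, `p' = f(y)`. -/
structure IsSolution (f y p : ℝ → ℝ) : Prop where
  deriv_y : ∀ t, HasDerivAt y (4 * p t) t
  deriv_p : ∀ t, HasDerivAt p (f (y t)) t

namespace IsSolution

variable {f y p : ℝ → ℝ}

theorem contDiff (h : IsSolution f y p) (hf : ContDiff ℝ (⊤ : ℕ∞) f) :
    ContDiff ℝ (⊤ : ℕ∞) y := by
  have key : ∀ n : ℕ, ContDiff ℝ n y ∧ ContDiff ℝ n p := by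
    intro n
    induction n with
    | zero =>
      exact ⟨contDiff_zero.2 (continuous_iff_continuousAt.2 fun t => (h.deriv_y t).continuousAt),
        contDiff_zero.2 (continuous_iff_continuousAt.2 fun t => (h.deriv_p t).continuousAt)⟩
    | succ n ih =>
      constructor
      · push_cast
        refine contDiff_succ_iff_deriv.2 ⟨fun t => (h.deriv_y t).differentiableAt, by simp, ?_⟩
        rw [show deriv y = fun t => 4 * p t from funext fun t => (h.deriv_y t).deriv]
        exact contDiff_const.mul ih.2
      · push_cast
        refine contDiff_succ_iff_deriv.2 ⟨fun t => (h.deriv_p t).differentiableAt, by simp, ?_⟩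
        rw [show deriv p = fun t => f (y t) from funext fun t => (h.deriv_p t).deriv]
        exact (hf.of_le (by exact_mod_cast le_top)).comp ih.1
  exact contDiff_infty.2 fun n => (key n).1

theorem comp_add (h : IsSolution f y p) (a : ℝ) :
    IsSolution f (fun t => y (a + t)) fun t => p (a + t) :=
  ⟨fun t => (h.deriv_y (a + t)).comp_const_add a t, fun t => (h.deriv_p (a + t)).comp_const_add a t⟩

theorem comp_sub (h : IsSolution f y p) (a : ℝ) :
    IsSolution f (fun t => y (a - t)) fun t => -p (a - t) :=
  ⟨fun t => ((h.deriv_y (a - t)).comp_const_sub a t).congr_deriv (by ring),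
    fun t => ((h.deriv_p (a - t)).comp_const_sub a t).neg.congr_deriv (by ring)⟩

theorem neg (h : IsSolution f y p) (hf : ∀ x, f (-x) = -f x) :
    IsSolution f (fun t => -y t) fun t => -p t :=
  ⟨fun t => (h.deriv_y t).neg.congr_deriv (by ring),
    fun t => (h.deriv_p t).neg.congr_deriv (by rw [hf])⟩

/-- The vector field is only locally Lipschitz; the bounds confine both solutions to a compact ball
on which it is Lipschitz. -/
theorem unique (hf : ContDiff ℝ (⊤ : ℕ∞) f) {y₁ p₁ y₂ p₂ : ℝ → ℝ} (h₁ : IsSolution f y₁ p₁)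
    (h₂ : IsSolution f y₂ p₂) {R : ℝ} (hy₁ : ∀ t, |y₁ t| ≤ R) (hp₁ : ∀ t, |p₁ t| ≤ R)
    (hy₂ : ∀ t, |y₂ t| ≤ R) (hp₂ : ∀ t, |p₂ t| ≤ R) {t₀ : ℝ} (hy : y₁ t₀ = y₂ t₀)
    (hp : p₁ t₀ = p₂ t₀) (t : ℝ) : y₁ t = y₂ t := by
  set v : ℝ × ℝ → ℝ × ℝ := fun z => (4 * z.2, f z.1) with hv
  have hvc : ContDiff ℝ 1 v :=
    (contDiff_const.mul contDiff_snd).prodMk ((hf.of_le (by exact_mod_cast le_top)).comp contDiff_fst)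
  obtain ⟨K, hK⟩ := (hvc.locallyLipschitz.locallyLipschitzOn
    (s := Metric.closedBall 0 R)).exists_lipschitzOnWith_of_compact (isCompact_closedBall 0 R)
  have hm : ∀ a b : ℝ, |a| ≤ R → |b| ≤ R → (a, b) ∈ Metric.closedBall (0 : ℝ × ℝ) R := by
    intro a b ha hb
    rw [mem_closedBall_zero_iff, Prod.norm_def]
    exact max_le ha hb
  have := ODE_solution_unique_univ (v := fun _ => v) (s := fun _ => Metric.closedBall 0 R)
    (f := fun t => (y₁ t, p₁ t)) (g := fun t => (y₂ t, p₂ t)) (t₀ := t₀) (fun _ => hK)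
    (fun t => ⟨(h₁.deriv_y t).prodMk (h₁.deriv_p t), hm _ _ (hy₁ t) (hp₁ t)⟩)
    (fun t => ⟨(h₂.deriv_y t).prodMk (h₂.deriv_p t), hm _ _ (hy₂ t) (hp₂ t)⟩)
    (by simp only [hy, hp])
  exact congrArg Prod.fst (congrFun this t)

end IsSolution

theorem bounded_of_periodic {y : ℝ → ℝ} {T : ℝ} (hT : 0 < T) (hp : Function.Periodic y T)
    (hy : Continuous y) : ∃ a b, ∀ t, y a ≤ y t ∧ y t ≤ y b := by
  have hne : (Icc (0 : ℝ) T).Nonempty := ⟨0, by simp [hT.le]⟩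
  obtain ⟨a, -, ha⟩ := isCompact_Icc.exists_isMinOn hne hy.continuousOn
  obtain ⟨b, -, hb⟩ := isCompact_Icc.exists_isMaxOn hne hy.continuousOn
  refine ⟨a, b, fun t => ?_⟩
  obtain ⟨t', ht', e⟩ := hp.exists_mem_Ico₀ hT t
  rw [e]
  exact ⟨ha (Ico_subset_Icc_self ht'), hb (Ico_subset_Icc_self ht')⟩

theorem _root_.TwoCenter.EllipticPath.IsMinPeriod.eq_int_mul {y : ℝ → ℝ} {T P : ℝ}
    (hT : IsMinPeriod y T) (hP : Function.Periodic y P) : ∃ n : ℤ, P = n * T := by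
  have hpos := hT.1.1
  refine ⟨⌊P / T⌋, ?_⟩
  have h1 := Int.floor_le (P / T)
  have h2 := Int.lt_floor_add_one (P / T)
  set n := ⌊P / T⌋
  rw [le_div_iff₀ hpos] at h1
  rw [div_lt_iff₀ hpos] at h2
  by_contra hne
  have hlt : 0 < P - n * T := lt_of_le_of_ne (by linarith) fun h => hne (by linarith)
  have hper : Function.Periodic y (P - n * T) := by
    intro t
    have := hP.sub_period (hT.1.2.int_mul n) t
    exact this
  have := hT.2 ⟨hlt, hper⟩
  linarith

/-- A periodic solution of an odd equation whose turning points are symmetric to the origin runs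
through a profile. -/
theorem exists_profile {f y p : ℝ → ℝ} {T : ℝ} (h : IsSolution f y p)
    (hf : ContDiff ℝ (⊤ : ℕ∞) f) (hodd : ∀ x, f (-x) = -f x) (hT : IsMinPeriod y T)
    (hturn : ∀ t u, p t = 0 → p u = 0 → |y t| = |y u|) :
    ∃ (L : ℝ → ℝ) (a : ℝ), IsProfile L ∧ ∀ t, y t = L (t / T + a) := by
  obtain ⟨⟨hpos, hper⟩, hmin⟩ := id hT
  have hsm := h.contDiff hf
  have hyc : Continuous y := hsm.continuous
  have hpc : Continuous p := continuous_iff_continuousAt.2 fun t => (h.deriv_p t).continuousAt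
  have hpper : Function.Periodic p T := by
    intro t
    have h1 := (h.deriv_y (t + T)).comp_add_const t T
    rw [show (fun t => y (t + T)) = y from funext hper] at h1
    linarith [h1.unique (h.deriv_y t)]
  obtain ⟨tm, tM, hy⟩ := bounded_of_periodic hpos hper hyc
  obtain ⟨pm, pM, hp⟩ := bounded_of_periodic hpos hpper hpc
  obtain ⟨R, hRy, hRp⟩ : ∃ R, (∀ t, |y t| ≤ R) ∧ ∀ t, |p t| ≤ R := by
    refine ⟨|y tm| + |y tM| + |p pm| + |p pM|, fun t => ?_, fun t => ?_⟩ <;>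
    · have := hy t
      have := hp t
      have := neg_abs_le (y tm)
      have := le_abs_self (y tM)
      have := neg_abs_le (p pm)
      have := le_abs_self (p pM)
      have := abs_nonneg (y tm)
      have := abs_nonneg (y tM)
      have := abs_nonneg (p pm)
      have := abs_nonneg (p pM)
      exact abs_le.2 ⟨by linarith, by linarith⟩
  -- Uniqueness turns relations between two states into symmetries of the whole motion: equal states
  -- give a period, opposite states an antisymmetry under translation, and a turning point a
  -- reflection.
  have hsame : ∀ t u, y t = y u → p t = p u → ∃ n : ℤ, t - u = n * T := by
    intro t u e1 e2
    have := IsSolution.unique hf (h.comp_add t) (h.comp_add u) (R := R) (fun _ => hRy _)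
      (fun _ => hRp _) (fun _ => hRy _) (fun _ => hRp _) (t₀ := 0) (by simpa using e1)
      (by simpa using e2)
    refine hT.eq_int_mul fun s => ?_
    have := this (s - u)
    rw [show s + (t - u) = t + (s - u) by ring, this]
    congr 1; ring
  have hanti : ∀ t u, y t = -y u → p t = -p u → ∀ s, y (s + (t - u)) = -y s := by
    intro t u e1 e2 s
    have := IsSolution.unique hf (h.comp_add t) ((h.comp_add u).neg hodd) (R := R) (fun _ => hRy _)
      (fun _ => hRp _) (fun _ => by rw [abs_neg]; exact hRy _)
      (fun _ => by rw [abs_neg]; exact hRp _) (t₀ := 0) (by simpa using e1)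
      (by simpa using e2) (s - u)
    rw [show s + (t - u) = t + (s - u) by ring, this]
    congr 2; ring
  have hrefl : ∀ t, p t = 0 → ∀ s, y (t + s) = y (t - s) := by
    intro t e
    exact IsSolution.unique hf (h.comp_add t) (h.comp_sub t) (R := R) (fun _ => hRy _)
      (fun _ => hRp _) (fun _ => hRy _) (fun _ => by rw [abs_neg]; exact hRp _)
      (t₀ := 0) (by simp) (by simp [e])
  have hpM : p tM = 0 := by
    have : IsLocalMax y tM := Filter.Eventually.of_forall fun t => (hy t).2
    linarith [this.hasDerivAt_eq_zero (h.deriv_y tM)]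
  have hpm : p tm = 0 := by
    have : IsLocalMin y tm := Filter.Eventually.of_forall fun t => (hy t).1
    linarith [this.hasDerivAt_eq_zero (h.deriv_y tm)]
  have hlt : y tm < y tM := by
    by_contra hcon
    have hconst : Function.Periodic y (T / 2) := fun t => by
      linarith [hy t, hy (t + T / 2)]
    have := hmin ⟨by linarith, hconst⟩
    linarith
  have hneg : y tM = -y tm := (abs_eq_abs.1 (hturn tM tm hpM hpm)).resolve_left hlt.ne'
  have hMpos : 0 < y tM := by linarith
  -- `2D` is a period, hence a multiple `nT`; an even `n` would make `D` itself a period and the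
  -- positive maximum its own negative.
  have hhalf_of : ∀ D : ℝ, (∀ s, y (s + D) = -y s) → ∃ m : ℤ, D = (m + 1 / 2) * T := by
    intro D hD
    obtain ⟨n, hn⟩ := hT.eq_int_mul (P := 2 * D) fun s => by
      rw [two_mul, ← add_assoc, hD, hD, neg_neg]
    rcases Int.even_or_odd n with ⟨m, hm⟩ | ⟨m, hm⟩
    · exfalso
      have hDm : D = m * T := by
        rw [hm] at hn; push_cast at hn; linarith
      have h1 := hD tM
      rw [hDm, hper.int_mul m tM] at h1
      linarith
    · exact ⟨m, by rw [hm] at hn; push_cast at hn; linarith⟩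
  have hD := hanti tM tm hneg (by rw [hpM, hpm, neg_zero])
  obtain ⟨m₀, hm₀⟩ := hhalf_of _ hD
  have hhalf : ∀ s, y (s + T / 2) = -y s := by
    intro s
    rw [← hD s, hm₀, ← hper.int_mul m₀ (s + T / 2)]
    congr 1; ring
  -- Time is rescaled by the period and shifted so that a maximum falls at `1/4`, the centre of
  -- reflection of a profile.
  refine ⟨fun x => y (T * (x - 1 / 4) + tM), 1 / 4 - tM / T, ?_, fun t => ?_⟩
  swap
  · simp only
    congr 1
    field_simp
    ring
  have hLd : ∀ x, HasDerivAt (fun x => y (T * (x - 1 / 4) + tM))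
      (4 * p (T * (x - 1 / 4) + tM) * T) x := fun x => by
    have : HasDerivAt (fun x => T * (x - 1 / 4) + tM) T x :=
      ((((hasDerivAt_id x).sub_const (1 / 4)).const_mul T).add_const tM).congr_deriv (mul_one T)
    exact (h.deriv_y _).comp x this
  -- All turning points have the same absolute value, so every one of them differs from `1/4` by a
  -- multiple of `1/2`, and none lies in the open interval.
  have hpne : ∀ x ∈ Ioo (-1 / 4 : ℝ) (1 / 4), p (T * (x - 1 / 4) + tM) ≠ 0 := by
    intro x hx h0
    rcases abs_eq_abs.1 (hturn _ tM h0 hpM) with e | e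
    · obtain ⟨n, hn⟩ := hsame _ _ e (h0.trans hpM.symm)
      have hn' : x - 1 / 4 = n := by
        have : T * (x - 1 / 4) = T * n := by linarith
        exact mul_left_cancel₀ hpos.ne' this
      have h1 : (n : ℝ) < 0 := by linarith [hx.2]
      have h2 : (-1 : ℝ) < n := by linarith [hx.1]
      have h3 : n < 0 := by exact_mod_cast h1
      have h4 : -1 < n := by exact_mod_cast h2
      omega
    · obtain ⟨n, hn⟩ := hhalf_of _ (hanti _ _ e (by rw [h0, hpM, neg_zero]))
      have hn' : x - 1 / 4 = n + 1 / 2 := by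
        have : T * (x - 1 / 4) = T * (n + 1 / 2) := by linarith
        exact mul_left_cancel₀ hpos.ne' this
      have h1 : (n : ℝ) < 0 := by linarith [hx.2]
      have h2 : (-1 : ℝ) < n := by linarith [hx.1]
      have h3 : n < 0 := by exact_mod_cast h1
      have h4 : -1 < n := by exact_mod_cast h2
      omega
  refine ⟨hsm.comp (by fun_prop), fun x => ?_, fun x => ?_, fun x hx => ?_⟩
  · rw [← hhalf]
    congr 1; ring
  · have := hrefl tM hpM (T * (1 / 4 - x))
    rw [show T * (1 / 2 - x - 1 / 4) + tM = tM + T * (1 / 4 - x) by ring, this]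
    congr 1; ring
  · rw [(hLd x).deriv]
    -- The motion rises from the minimum to the maximum, so the slope is positive somewhere; having
    -- no zero, it is positive throughout.
    obtain ⟨ξ, hξ, hs⟩ := exists_hasDerivAt_eq_slope (fun x => y (T * (x - 1 / 4) + tM))
      (fun x => 4 * p (T * (x - 1 / 4) + tM) * T) (a := -1 / 4) (b := 1 / 4) (by norm_num)
      (hyc.comp (by fun_prop)).continuousOn fun x _ => hLd x
    have hξpos : 0 < p (T * (ξ - 1 / 4) + tM) := by
      have e1 : y (T * (-1 / 4 - 1 / 4) + tM) = -y tM := by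
        have := hhalf (T * (-1 / 4 - 1 / 4) + tM)
        rw [show T * (-1 / 4 - 1 / 4) + tM + T / 2 = tM by ring] at this
        linarith
      have e2 : y (T * (1 / 4 - 1 / 4) + tM) = y tM := by congr 1; ring
      rw [e1, e2] at hs
      by_contra hcon
      have h1 : 4 * p (T * (ξ - 1 / 4) + tM) * T ≤ 0 :=
        mul_nonpos_of_nonpos_of_nonneg (by linarith) hpos.le
      rw [hs] at h1
      norm_num at h1
      linarith
    have hxpos : 0 < p (T * (x - 1 / 4) + tM) := by
      by_contra hcon
      have hc : ContinuousOn (fun x => p (T * (x - 1 / 4) + tM)) (Ioo (-1 / 4) (1 / 4)) :=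
        (hpc.comp (by fun_prop)).continuousOn
      obtain ⟨ζ, hζ, h0⟩ := isPreconnected_Ioo.intermediate_value hx hξ hc
        ⟨not_lt.1 hcon, hξpos.le⟩
      exact hpne ζ hζ h0
    positivity

/-! ### The Hill's region -/

theorem norm_add_half (a b : ℝ) :
    ‖(⟨Real.cosh a * Real.cos b / 2, Real.sinh a * Real.sin b / 2⟩ : ℂ) - Primary.earth.pos‖ =
      (Real.cosh a + Real.cos b) / 2 := by
  have h1 := Real.one_le_cosh a
  have h2 := Real.neg_one_le_cos b
  rw [← sq_eq_sq₀ (norm_nonneg _) (by linarith), ← Complex.normSq_eq_norm_sq,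
    Complex.normSq_apply]
  simp only [Primary.pos, Complex.sub_re, Complex.sub_im]
  norm_num
  have h3 := Real.cosh_sq a
  have h4 := Real.sin_sq_add_cos_sq b
  have h5 : Real.sinh a ^ 2 * Real.sin b ^ 2 = (Real.cosh a ^ 2 - 1) * (1 - Real.cos b ^ 2) := by
    rw [h3, ← h4]; ring
  linear_combination h5 / 4

theorem norm_sub_half (a b : ℝ) :
    ‖(⟨Real.cosh a * Real.cos b / 2, Real.sinh a * Real.sin b / 2⟩ : ℂ) - Primary.moon.pos‖ =
      (Real.cosh a - Real.cos b) / 2 := by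
  have h1 := Real.one_le_cosh a
  have h2 := Real.cos_le_one b
  rw [← sq_eq_sq₀ (norm_nonneg _) (by linarith), ← Complex.normSq_eq_norm_sq,
    Complex.normSq_apply]
  simp only [Primary.pos, Complex.sub_re, Complex.sub_im]
  norm_num
  have h3 := Real.cosh_sq a
  have h4 := Real.sin_sq_add_cos_sq b
  have h5 : Real.sinh a ^ 2 * Real.sin b ^ 2 = (Real.cosh a ^ 2 - 1) * (1 - Real.cos b ^ 2) := by
    rw [h3, ← h4]; ring
  linear_combination h5 / 4

/-- The difference of the distances to the primaries. -/
noncomputable def distDiff (q : ℂ) : ℝ := ‖q - Primary.earth.pos‖ - ‖q - Primary.moon.pos‖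

theorem continuous_distDiff : Continuous distDiff := by unfold distDiff; fun_prop

theorem distDiff_pos (z : EllipticPath) (t : ℝ) : distDiff (z.pos t) = Real.cos (z.nu t) := by
  unfold distDiff EllipticPath.pos
  rw [norm_add_half, norm_sub_half]; ring

variable {μ c : ℝ}

/-- Below the critical energy `(c + 1)² > 4μ(1 - μ) = 1 - (1 - 2μ)²`. -/
theorem quadratic_of_lt_criticalEnergy (h₀ : 0 < μ) (h₁ : μ < 1) (hc : c < criticalEnergy μ) :
    c < -1 ∧ 0 < c ^ 2 + 2 * c + (1 - 2 * μ) ^ 2 := by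
  unfold criticalEnergy at hc
  have h2 : 0 ≤ μ * (1 - μ) := mul_nonneg h₀.le (by linarith)
  have h3 := Real.sq_sqrt h2
  have h4 := Real.sqrt_nonneg (μ * (1 - μ))
  set r := Real.sqrt (μ * (1 - μ))
  refine ⟨by linarith, ?_⟩
  nlinarith

/-- The excluded value is the critical point of `2(1 - 2μ)X + cX²`, the potential in `X = cos ν`. On
this hyperbola between the primaries, with `Y` the sum of the distances, `V ≤ c` would give `-2Y -
cY² - cX² ≤ 0`. But the left side is positive at `Y = 1` by the bound on `c`, and it increases for
`Y ≥ 1`. -/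
theorem distDiff_ne (h₀ : 0 < μ) (h₁ : μ < 1) (hc : c < criticalEnergy μ) {q : ℂ}
    (hq : q ∈ hillRegion μ c) : distDiff q ≠ (1 - 2 * μ) / (-c) := by
  obtain ⟨hc1, hc2⟩ := quadratic_of_lt_criticalEnergy h₀ h₁ hc
  have hcpos : 0 < -c := by linarith
  have hme : ‖Primary.moon.pos - Primary.earth.pos‖ = 1 := by
    simp only [Primary.pos]; norm_num
  intro he
  rw [eq_div_iff hcpos.ne'] at he
  rcases hq with rfl | rfl | hq
  · have : distDiff Primary.earth.pos = -1 := by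
      rw [distDiff, sub_self, norm_zero, norm_sub_rev, hme]; norm_num
    rw [this] at he
    nlinarith
  · have : distDiff Primary.moon.pos = 1 := by
      rw [distDiff, sub_self, norm_zero, hme]; norm_num
    rw [this] at he
    nlinarith
  · have htri : 1 ≤ ‖q - Primary.earth.pos‖ + ‖q - Primary.moon.pos‖ := by
      rw [← hme, norm_sub_rev q Primary.moon.pos, add_comm]
      have := norm_add_le (Primary.moon.pos - q) (q - Primary.earth.pos)
      rwa [sub_add_sub_cancel] at this
    unfold distDiff at he
    unfold potential at hq
    have ha := norm_nonneg (q - Primary.earth.pos)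
    have hb := norm_nonneg (q - Primary.moon.pos)
    set A := ‖q - Primary.earth.pos‖
    set B := ‖q - Primary.moon.pos‖
    have hAne : A ≠ 0 := by
      intro h0
      rw [h0] at he htri
      nlinarith
    have hBne : B ≠ 0 := by
      intro h0
      rw [h0] at he htri
      nlinarith
    have hA : 0 < A := lt_of_le_of_ne ha hAne.symm
    have hB : 0 < B := lt_of_le_of_ne hb hBne.symm
    have e : -(1 - μ) / A - μ / B = (-(1 - μ) * B - μ * A) / (A * B) := by
      field_simp
    rw [e, div_le_iff₀ (mul_pos hA hB)] at hq
    set Y := A + B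
    set X := A - B
    have hAB : A * B = (Y ^ 2 - X ^ 2) / 4 := by ring
    have hlin : -(1 - μ) * B - μ * A = (-Y + (1 - 2 * μ) * X) / 2 := by ring
    rw [hAB, hlin] at hq
    have hX : X * -c = 1 - 2 * μ := he
    have h5 : -2 * Y - c * Y ^ 2 - c * X ^ 2 ≤ 0 := by
      rw [← hX] at hq
      nlinarith
    have h6 : 0 < -2 - c - c * X ^ 2 := by
      have : 0 < (-2 - c - c * X ^ 2) * (-c) := by
        have : (X * c) ^ 2 = (1 - 2 * μ) ^ 2 := by rw [← hX]; ring
        nlinarith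
      exact _root_.pos_of_mul_pos_left this hcpos.le
    have h7 : 0 ≤ (Y - 1) * (-2 - c * (Y + 1)) :=
      mul_nonneg (by linarith) (by nlinarith)
    nlinarith

/-- The sign of `cos ν` near a primary. -/
def Primary.sign : Primary → ℝ
  | .earth => -1
  | .moon => 1

/-- The component is connected and `distDiff`, which is `cos ν` along the orbit, omits the
separating value on it; so the orbit stays on the side of `e`. -/
theorem cos_gt_of_near (h₀ : 0 < μ) (h₁ : μ < 1) (hc : c < criticalEnergy μ) {e : Primary}
    {z : EllipticPath} (hz : ∀ t, z.pos t ∈ hillComponent μ c e) (t : ℝ) :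
    e.sign * ((1 - 2 * μ) / (-c)) < e.sign * Real.cos (z.nu t) := by
  obtain ⟨hc1, hc2⟩ := quadratic_of_lt_criticalEnergy h₀ h₁ hc
  have hcpos : 0 < -c := by linarith
  have hme : ‖Primary.moon.pos - Primary.earth.pos‖ = 1 := by
    simp only [Primary.pos]; norm_num
  have hsub := connectedComponentIn_subset (hillRegion μ c) e.pos
  have heR : e.pos ∈ hillRegion μ c := by
    cases e
    exacts [.inl rfl, .inr (.inl rfl)]
  have hpre : IsPreconnected (hillComponent μ c e) := isPreconnected_connectedComponentIn
  have hx1 : (1 - 2 * μ) / (-c) < 1 := by rw [div_lt_one hcpos]; linarith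
  have hx2 : -1 < (1 - 2 * μ) / (-c) := by rw [lt_div_iff₀ hcpos]; linarith
  have hdd : distDiff e.pos = e.sign := by
    cases e
    · rw [distDiff, sub_self, norm_zero, norm_sub_rev, hme]; norm_num [Primary.sign]
    · rw [distDiff, sub_self, norm_zero, hme]; norm_num [Primary.sign]
  rw [← distDiff_pos]
  by_contra hcon
  have hmem : e.sign * ((1 - 2 * μ) / (-c)) ∈
      Icc (e.sign * distDiff (z.pos t)) (e.sign * distDiff e.pos) := by
    refine ⟨not_lt.1 hcon, ?_⟩
    rw [hdd]
    cases e <;> simp only [Primary.sign] <;> linarith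
  obtain ⟨q, hq, he⟩ := hpre.intermediate_value (hz t) (mem_connectedComponentIn heR)
    (continuous_const.mul continuous_distDiff).continuousOn hmem
  have hne : e.sign ≠ 0 := by cases e <;> norm_num [Primary.sign]
  exact distDiff_ne h₀ h₁ hc (hsub hq) (mul_left_cancel₀ hne he)

end TwoCenter

namespace TwoCenter

/-! ### Torus orbits as Lissajous curves -/

theorem exists_int_abs_sub_lt {h : ℝ → ℝ} (hc : Continuous h) (hcos : ∀ t, Real.cos (h t) ≠ -1) :
    ∃ m : ℤ, ∀ t, |h t - m * (2 * Real.pi)| < Real.pi := by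
  have hp := Real.pi_pos
  have hne : ∀ (t : ℝ) (m : ℤ), h t ≠ Real.pi + m * (2 * Real.pi) := by
    intro t m he
    apply hcos t
    rw [he, Real.cos_add_int_mul_two_pi, Real.cos_pi]
  refine ⟨⌊(h 0 + Real.pi) / (2 * Real.pi)⌋, fun t => ?_⟩
  have h1 := Int.floor_le ((h 0 + Real.pi) / (2 * Real.pi))
  have h2 := Int.lt_floor_add_one ((h 0 + Real.pi) / (2 * Real.pi))
  set m := ⌊(h 0 + Real.pi) / (2 * Real.pi)⌋
  rw [le_div_iff₀ (by positivity)] at h1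
  rw [div_lt_iff₀ (by positivity)] at h2
  have hpre := isPreconnected_univ (α := ℝ)
  rw [abs_lt]
  constructor
  · by_contra hcon
    obtain ⟨s, -, hs⟩ := hpre.intermediate_value (mem_univ t) (mem_univ 0) hc.continuousOn
      (show Real.pi + ((m - 1 : ℤ) : ℝ) * (2 * Real.pi) ∈ _ from
        ⟨by push_cast; linarith, by push_cast; linarith⟩)
    exact hne s _ hs
  · by_contra hcon
    obtain ⟨s, -, hs⟩ := hpre.intermediate_value (mem_univ 0) (mem_univ t) hc.continuousOn
      (show Real.pi + (m : ℝ) * (2 * Real.pi) ∈ _ from ⟨by linarith, by linarith⟩)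
    exact hne s _ hs

/-- The value of `ν` at a primary. -/
noncomputable def Primary.angle : Primary → ℝ
  | .earth => Real.pi
  | .moon => 0

/-- A square root of the sign of a primary. -/
def Primary.unit : Primary → ℂ
  | .earth => Complex.I
  | .moon => 1

theorem Primary.unit_ne_zero (e : Primary) : e.unit ≠ 0 := by
  cases e
  exacts [Complex.I_ne_zero, one_ne_zero]

theorem cos_angle_add (e : Primary) (m : ℤ) (x : ℝ) :
    Real.cos (e.angle + m * (2 * Real.pi) + x) = e.sign * Real.cos x := by
  rw [show e.angle + m * (2 * Real.pi) + x = x + e.angle + m * (2 * Real.pi) by ring,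
    Real.cos_add_int_mul_two_pi]
  cases e <;> simp [Primary.angle, Primary.sign]

theorem sin_angle_add (e : Primary) (m : ℤ) (x : ℝ) :
    Real.sin (e.angle + m * (2 * Real.pi) + x) = e.sign * Real.sin x := by
  rw [show e.angle + m * (2 * Real.pi) + x = x + e.angle + m * (2 * Real.pi) by ring,
    Real.sin_add_int_mul_two_pi]
  cases e <;> simp [Primary.angle, Primary.sign]

/-- The motion `z` of type `T_{k,l}` near `e`, on the level `(g, c)`, is given by the Lissajous
curve `d`; the periods of `λ` and `ν` are `l u` and `k u`. -/
structure IsTorusMotion (μ : ℝ) (e : Primary) (k l : ℕ) (g c : ℝ) (z : EllipticPath)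
    (d : Lissajous) (u : ℝ) (m : ℤ) : Prop where
  admissible : d.IsAdmissible
  type : d.HasType k l
  pos : 0 < u
  lam : ∀ t, z.lam t = d.L (t / (l * u) + d.a)
  nu : ∀ t, z.nu t = e.angle + m * (2 * Real.pi) + d.N (t / (k * u) + d.b)
  deriv_lam : ∀ t, HasDerivAt z.lam (4 * z.plam t) t
  deriv_nu : ∀ t, HasDerivAt z.nu (4 * z.pnu t) t
  level_lam : ∀ t, 2 * z.plam t ^ 2 - 2 * Real.cosh (z.lam t) - c * Real.cosh (z.lam t) ^ 2 = g
  level_nu : ∀ t, 2 * z.pnu t ^ 2 + 2 * (1 - 2 * μ) * Real.cos (z.nu t)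
    + c * Real.cos (z.nu t) ^ 2 = -g

/-- Two different roots satisfy `g + c + 2 = c (Y₁ - 1) (Y₂ - 1)`, which is not positive if both are
at least `1`. This is where the lower bound `-2 < g + c`, valid in both regions, enters. -/
theorem cosh_eq_of_level {g c Y₁ Y₂ : ℝ} (hc : c < 0) (hg : -2 < g + c) (h1 : 1 ≤ Y₁)
    (h2 : 1 ≤ Y₂) (e1 : -2 * Y₁ - c * Y₁ ^ 2 = g) (e2 : -2 * Y₂ - c * Y₂ ^ 2 = g) : Y₁ = Y₂ := by
  by_contra hne
  have h3 : (Y₁ - Y₂) * (2 + c * (Y₁ + Y₂)) = 0 := by linear_combination e2 - e1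
  have h4 := (mul_eq_zero.1 h3).resolve_left (sub_ne_zero.2 hne)
  have h5 : g + 2 + c = c * ((Y₁ - 1) * (Y₂ - 1)) := by
    linear_combination -e1 + (1 - Y₁) * h4
  have h6 := mul_nonneg (sub_nonneg.2 h1) (sub_nonneg.2 h2)
  nlinarith

theorem _root_.TwoCenter.EllipticPath.IsMinPeriod.sub_const {y : ℝ → ℝ} {T : ℝ}
    (h : IsMinPeriod y T) (C : ℝ) : IsMinPeriod (fun t => y t - C) T := by
  unfold IsMinPeriod at *
  have : {T | 0 < T ∧ Function.Periodic (fun t => y t - C) T} =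
      {T | 0 < T ∧ Function.Periodic y T} := by
    ext T
    simp [Function.Periodic]
  rwa [this]

/-- The equations for `λ` and for `ν - ν_e` are odd, so `exists_profile` applies once all turning
points of each coordinate have the same absolute value. The level equations are quadratic in `cosh
λ` and `cos ν`, and in each case only one root is admissible. -/
theorem exists_isTorusMotion {μ : ℝ} (h₀ : 0 < μ) (h₁ : μ < 1) {e : Primary} {k l : ℕ}
    (hk : 0 < k) (hl : 0 < l) {g c : ℝ} {z : EllipticPath} (h : IsTorusOrbit μ e k l g c z) :
    ∃ d u m, IsTorusMotion μ e k l g c z d u m := by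
  have hk' : (0 : ℝ) < k := by exact_mod_cast hk
  have hl' : (0 : ℝ) < l := by exact_mod_cast hl
  have hcg : c < criticalEnergy μ ∧ -2 < g + c := by
    rcases h.region with ⟨hc, hg, -⟩ | ⟨hc, hg, -⟩
    · exact ⟨hc, hg⟩
    · have : |1 - 2 * μ| < 1 := abs_lt.2 ⟨by linarith, by linarith⟩
      exact ⟨hc, by linarith⟩
  obtain ⟨hcc, hg⟩ := hcg
  obtain ⟨hc1, -⟩ := quadratic_of_lt_criticalEnergy h₀ h₁ hcc
  have hcpos : 0 < -c := by linarith
  obtain ⟨Tl, Tn, hTl, hTn, hrot⟩ := h.rotation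
  have hTlpos := hTl.1.1
  have hTnpos := hTn.1.1
  obtain ⟨L, a, hL, hLe⟩ := exists_profile (f := fun y => 2 * Real.sinh y + 2 * c * Real.cosh y * Real.sinh y)
    ⟨h.deriv_lam, h.deriv_plam⟩ (by fun_prop)
    (fun x => by simp only [Real.sinh_neg, Real.cosh_neg]; ring) hTl
    (fun t u ht hu => by
      have e1 := h.level_lam t
      have e2 := h.level_lam u
      rw [ht] at e1
      rw [hu] at e2
      have hY := cosh_eq_of_level (by linarith) hg (Real.one_le_cosh (z.lam t))
        (Real.one_le_cosh (z.lam u)) (by linarith) (by linarith)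
      exact le_antisymm (Real.cosh_le_cosh.1 hY.le) (Real.cosh_le_cosh.1 hY.ge))
  have hside := cos_gt_of_near h₀ h₁ hcc h.near
  have hss : e.sign * e.sign = 1 := by cases e <;> norm_num [Primary.sign]
  have hx1 : (1 - 2 * μ) / (-c) < 1 := by rw [div_lt_one hcpos]; linarith
  have hx2 : -1 < (1 - 2 * μ) / (-c) := by rw [lt_div_iff₀ hcpos]; linarith
  have hsub : ∀ x, Real.cos x = e.sign * Real.cos (x - e.angle) := by
    intro x
    have := cos_angle_add e 0 (x - e.angle)
    rw [← this]; congr 1; simp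
  have hnuc : Continuous z.nu := continuous_iff_continuousAt.2 fun t => (h.deriv_nu t).continuousAt
  -- On the side of `e` the angle never reaches the value opposite to that of `e`, so one lift by
  -- `2πm` puts it within `π` of the primary for all times.
  obtain ⟨m, hm⟩ := exists_int_abs_sub_lt (h := fun t => z.nu t - e.angle) (by fun_prop) (by
    intro t ht
    have h1 := hside t
    rw [hsub (z.nu t), ht, ← mul_assoc, hss] at h1
    cases e <;> simp only [Primary.sign] at h1 <;> linarith)
  set y : ℝ → ℝ := fun t => z.nu t - (e.angle + m * (2 * Real.pi)) with hy
  have hye : ∀ t, z.nu t = e.angle + m * (2 * Real.pi) + y t := fun t => by simp only [hy]; ring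
  have hcos : ∀ t, Real.cos (z.nu t) = e.sign * Real.cos (y t) := fun t => by
    rw [hye, cos_angle_add]
  have hsin : ∀ t, Real.sin (z.nu t) = e.sign * Real.sin (y t) := fun t => by
    rw [hye, sin_angle_add]
  have hyb : ∀ t, |y t| < Real.pi := fun t => by
    have := hm t
    rwa [sub_sub] at this
  obtain ⟨N, b, hN, hNe⟩ := exists_profile
    (f := fun y => 2 * (1 - 2 * μ) * e.sign * Real.sin y + 2 * c * Real.cos y * Real.sin y)
    (y := y) (p := z.pnu)
    ⟨fun t => (h.deriv_nu t).sub_const _, fun t => (h.deriv_pnu t).congr_deriv (by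
      rw [hcos, hsin]; linear_combination (2 * c * Real.cos (y t) * Real.sin (y t)) * hss)⟩
    (by fun_prop) (fun x => by simp only [Real.sin_neg, Real.cos_neg]; ring) (hTn.sub_const _)
    (fun t u ht hu => by
      have e1 := h.level_nu t
      have e2 := h.level_nu u
      rw [ht] at e1
      rw [hu] at e2
      have s1 := hside t
      have s2 := hside u
      have hX : Real.cos (z.nu t) = Real.cos (z.nu u) := by
        by_contra hne
        have h3 : (Real.cos (z.nu t) - Real.cos (z.nu u)) *
            (2 * (1 - 2 * μ) + c * (Real.cos (z.nu t) + Real.cos (z.nu u))) = 0 := by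
          linear_combination e1 - e2
        have h4 := (mul_eq_zero.1 h3).resolve_left (sub_ne_zero.2 hne)
        -- Different roots are symmetric about the separating value, whereas both cosines lie
        -- strictly on the side of `e`.
        have h5 : Real.cos (z.nu t) + Real.cos (z.nu u) = 2 * ((1 - 2 * μ) / (-c)) := by
          rw [← mul_div_assoc, eq_div_iff hcpos.ne']
          linarith
        have h6 : e.sign * Real.cos (z.nu t) + e.sign * Real.cos (z.nu u) =
            2 * (e.sign * ((1 - 2 * μ) / (-c))) := by rw [← mul_add, h5]; ring
        linarith
      rw [hcos, hcos] at hX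
      have hne : e.sign ≠ 0 := left_ne_zero_of_mul_eq_one hss
      have hX' := mul_left_cancel₀ hne hX
      rw [← Real.cos_abs (y t), ← Real.cos_abs (y u)] at hX'
      exact Real.injOn_cos ⟨abs_nonneg _, (hyb t).le⟩ ⟨abs_nonneg _, (hyb u).le⟩ hX')
  have hTn' : Tn = k * (Tl / l) := by
    rw [div_eq_div_iff hTlpos.ne' hl'.ne'] at hrot
    field_simp
    linarith
  refine ⟨⟨L, N, closingFraction k l * k, closingFraction k l * l, a, b⟩, Tl / l, m, ?_⟩
  refine ⟨⟨hL, hN, fun x => ?_, mul_pos (closingFraction_pos k l) hk',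
    mul_pos (closingFraction_pos k l) hl'⟩, ⟨rfl, rfl⟩, by positivity, fun t => ?_, fun t => ?_,
    h.deriv_lam, h.deriv_nu, h.level_lam, h.level_nu⟩
  · have := hyb ((x - b) * Tn)
    rw [hNe, mul_div_cancel_right₀ _ hTnpos.ne', sub_add_cancel] at this
    exact this
  · rw [hLe, mul_div_cancel₀ _ hl'.ne']
  · rw [hye, hNe, hTn']

/-! ### Phase space, period and singular times of a torus motion -/

namespace IsTorusMotion

variable {μ : ℝ} {e : Primary} {k l : ℕ} {g c : ℝ} {z : EllipticPath} {d : Lissajous} {u : ℝ}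
  {m : ℤ}

/-- The period. -/
noncomputable def _root_.TwoCenter.closingTime (k l : ℕ) (u : ℝ) : ℝ :=
  closingFraction k l * k * l * u

theorem _root_.TwoCenter.closingTime_pos (hk : 0 < k) (hl : 0 < l) (hu : 0 < u) :
    0 < closingTime k l u := by
  have := closingFraction_pos k l
  unfold closingTime
  positivity

theorem shift (h : IsTorusMotion μ e k l g c z d u m) (σ : ℝ) :
    IsTorusMotion μ e k l g c (shift σ z) { d with a := d.a + σ / (l * u) } u m where
  admissible := ⟨h.admissible.1, h.admissible.2, h.admissible.3, h.admissible.4, h.admissible.5⟩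
  type := h.type
  pos := h.pos
  lam t := by
    change z.lam (t + σ) = _
    rw [h.lam]
    simp only
    congr 1; ring
  nu := h.nu
  deriv_lam t := (h.deriv_lam (t + σ)).comp_add_const t σ
  deriv_nu := h.deriv_nu
  level_lam t := h.level_lam (t + σ)
  level_nu := h.level_nu

theorem plam (h : IsTorusMotion μ e k l g c z d u m) (t : ℝ) :
    4 * z.plam t = deriv d.L (t / (l * u) + d.a) / (l * u) := by
  have h1 : HasDerivAt (fun t => t / (l * u) + d.a) (1 / (l * u)) t :=
    ((hasDerivAt_id t).div_const _).add_const _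
  have h2 := (h.admissible.profile_L.hasDerivAt _).comp t h1
  rw [show d.L ∘ (fun t => t / (l * u) + d.a) = z.lam from funext fun t => (h.lam t).symm] at h2
  rw [(h.deriv_lam t).unique h2]
  ring

theorem pnu (h : IsTorusMotion μ e k l g c z d u m) (t : ℝ) :
    4 * z.pnu t = deriv d.N (t / (k * u) + d.b) / (k * u) := by
  have h1 : HasDerivAt (fun t => t / (k * u) + d.b) (1 / (k * u)) t :=
    ((hasDerivAt_id t).div_const _).add_const _
  have h2 := ((h.admissible.profile_N.hasDerivAt _).comp t h1).const_add
    (e.angle + m * (2 * Real.pi))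
  have h3 : (fun t => e.angle + m * (2 * Real.pi) + (d.N ∘ fun t => t / (k * u) + d.b) t) = z.nu :=
    funext fun t => (h.nu t).symm
  rw [h3] at h2
  rw [(h.deriv_nu t).unique h2]
  ring

/-- A value of a profile together with its derivative determines the phase modulo `1`, and the
opposite pair determines it modulo `1` up to a half shift. Since `|N| < π`, no further multiple of
`2π` in `ν` is possible. -/
theorem samePhasePoint_iff (hk : 0 < k) (hl : 0 < l) (h : IsTorusMotion μ e k l g c z d u m)
    (t r : ℝ) : z.SamePhasePoint (t + closingTime k l u * r) t ↔
      (d.κ * r, d.κ' * r) ∈ lattice True := by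
  have hk' : (0 : ℝ) < k := by exact_mod_cast hk
  have hl' : (0 : ℝ) < l := by exact_mod_cast hl
  have hu := h.pos
  have hL := h.admissible.profile_L
  have hN := h.admissible.profile_N
  have hp := Real.pi_pos
  have ex : (t + closingTime k l u * r) / (l * u) + d.a - (t / (l * u) + d.a) = d.κ * r := by
    rw [h.type.1]; unfold closingTime; field_simp; ring
  have ey : (t + closingTime k l u * r) / (k * u) + d.b - (t / (k * u) + d.b) = d.κ' * r := by
    rw [h.type.2]; unfold closingTime; field_simp; ring
  have hpl := fun t => h.plam t
  have hpn := fun t => h.pnu t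
  have hlu : (l : ℝ) * u ≠ 0 := by positivity
  have hku : (k : ℝ) * u ≠ 0 := by positivity
  unfold SamePhasePoint
  rw [h.lam, h.lam, h.nu, h.nu, mem_lattice]
  have p1 := hpl (t + closingTime k l u * r)
  have p2 := hpl t
  have p3 := hpn (t + closingTime k l u * r)
  have p4 := hpn t
  rw [eq_div_iff hlu] at p1 p2
  rw [eq_div_iff hku] at p3 p4
  set x' := (t + closingTime k l u * r) / (l * u) + d.a
  set x := t / (l * u) + d.a
  set y' := (t + closingTime k l u * r) / (k * u) + d.b
  set y := t / (k * u) + d.b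
  have b1 := abs_lt.1 (h.admissible.abs_lt y')
  have b2 := abs_lt.1 (h.admissible.abs_lt y)
  have hzero : ∀ n : ℤ, |(n : ℝ) * (2 * Real.pi)| < 2 * Real.pi → n = 0 := by
    intro n hn
    rw [abs_mul, abs_of_pos (by positivity : 0 < 2 * Real.pi)] at hn
    have : |(n : ℝ)| < 1 := by
      by_contra hcon
      nlinarith
    exact Int.abs_lt_one_iff.1 (by exact_mod_cast this)
  rw [← ex, ← ey]
  constructor
  · rintro (⟨e1, ⟨n, e2⟩, e3, e4⟩ | ⟨e1, ⟨n, e2⟩, e3, e4⟩)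
    · have hn := hzero n (by
        have : (n : ℝ) * (2 * Real.pi) = d.N y' - d.N y := by linarith
        rw [this]; exact abs_lt.2 ⟨by linarith, by linarith⟩)
      rw [hn] at e2
      obtain ⟨i, hi⟩ := hL.sub_int_of_eq e1 (by rw [← p1, ← p2, e3])
      obtain ⟨j, hj⟩ := hN.sub_int_of_eq (x := y) (y := y') (by push_cast at e2; linarith)
        (by rw [← p3, ← p4, e4])
      exact ⟨i, j, .inl ⟨hi, hj⟩⟩
    · obtain ⟨s, hs⟩ : ∃ s : ℤ, 2 * e.angle = s * (2 * Real.pi) := by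
        cases e
        · exact ⟨1, by simp [Primary.angle]⟩
        · exact ⟨0, by simp [Primary.angle]⟩
      have hn := hzero (n - 2 * m - s) (by
        have : ((n - 2 * m - s : ℤ) : ℝ) * (2 * Real.pi) = d.N y' + d.N y := by
          push_cast; linarith
        rw [this]; exact abs_lt.2 ⟨by linarith, by linarith⟩)
      have hn' : (n : ℝ) = 2 * m + s := by
        have : n = 2 * m + s := by omega
        exact_mod_cast this
      rw [hn'] at e2
      obtain ⟨i, hi⟩ := hL.sub_half_of_eq_neg e1 (by rw [← p1, ← p2, e3]; ring)
      obtain ⟨j, hj⟩ := hN.sub_half_of_eq_neg (x := y) (y := y') (by linarith)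
        (by rw [← p3, ← p4, e4]; ring)
      exact ⟨i, j, .inr ⟨trivial, hi, hj⟩⟩
  · rintro ⟨i, j, ⟨hi, hj⟩ | ⟨-, hi, hj⟩⟩
    · obtain ⟨a1, a2⟩ := hL.eq_of_sub hi
      obtain ⟨a3, a4⟩ := hN.eq_of_sub hj
      refine .inl ⟨a1, ⟨0, by rw [a3]; simp⟩, ?_, ?_⟩
      · rw [← p1, ← p2] at a2
        have := mul_right_cancel₀ hlu a2
        linarith
      · rw [← p3, ← p4] at a4
        have := mul_right_cancel₀ hku a4
        linarith
    · obtain ⟨a1, a2⟩ := hL.eq_of_sub_half hi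
      obtain ⟨a3, a4⟩ := hN.eq_of_sub_half hj
      refine .inr ⟨a1, ?_, ?_, ?_⟩
      · rw [a3]
        cases e
        · exact ⟨2 * m + 1, by simp only [Primary.angle]; push_cast; ring⟩
        · exact ⟨2 * m, by simp only [Primary.angle]; push_cast; ring⟩
      · rw [← p1, ← p2, ← neg_mul] at a2
        have := mul_right_cancel₀ hlu a2
        linarith
      · rw [← p3, ← p4, ← neg_mul] at a4
        have := mul_right_cancel₀ hku a4
        linarith

theorem minPeriod_eq (hk : 0 < k) (hl : 0 < l) (hkl : Nat.Coprime k l)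
    (h : IsTorusMotion μ e k l g c z d u m) : z.minPeriod = closingTime k l u := by
  have hP := closingTime_pos hk hl h.pos
  refine IsLeast.csInf_eq ⟨⟨hP, fun t => ?_⟩, ?_⟩
  · have := (h.samePhasePoint_iff hk hl t 1).2 (by simpa using (h.type.isClosing hkl).mem)
    rwa [mul_one] at this
  · rintro P ⟨hPpos, hper⟩
    have e : closingTime k l u * (P / closingTime k l u) = P := by field_simp
    obtain ⟨n, hn⟩ := (h.type.isClosing hkl).minimal (P / closingTime k l u)
      ((h.samePhasePoint_iff hk hl 0 _).1 (by rw [e]; exact hper 0))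
    have h1 : (0 : ℝ) < n := by rw [← hn]; positivity
    have h2 : (1 : ℝ) ≤ n := by exact_mod_cast Int.add_one_le_of_lt (by exact_mod_cast h1 : 0 < n)
    rw [← e, hn]
    nlinarith

theorem lam_mul (hk : 0 < k) (hl : 0 < l) (h : IsTorusMotion μ e k l g c z d u m) (t : ℝ) :
    (closingTime k l u * t) / (l * u) + d.a = d.x t ∧
      (closingTime k l u * t) / (k * u) + d.b = d.y t := by
  have hk' : (k : ℝ) ≠ 0 := by exact_mod_cast hk.ne'
  have hl' : (l : ℝ) ≠ 0 := by exact_mod_cast hl.ne'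
  have := h.pos.ne'
  unfold closingTime Lissajous.x Lissajous.y
  rw [h.type.1, h.type.2]
  constructor <;> field_simp

/-- `cosh w - 1 = 2 sinh² (w/2)`. At the Earth the shift of `ν` by `π` changes the sign of `cosh`,
which the factor `I² = -1` accounts for. -/
theorem pos_sub (hk : 0 < k) (hl : 0 < l) (h : IsTorusMotion μ e k l g c z d u m) (t : ℝ) :
    z.pos (closingTime k l u * t) - e.pos = loopMap e.unit (d.path t) := by
  obtain ⟨hx, hy⟩ := h.lam_mul hk hl t
  have h1 : loopMap e.unit (d.path t) = e.unit ^ 2 * ((Complex.cosh (d.path t) - 1) / 2) := by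
    have h2 := Complex.cosh_two_mul (d.path t / 2)
    rw [mul_div_cancel₀ _ (two_ne_zero' ℂ), Complex.cosh_sq] at h2
    rw [loopMap, h2]
    ring
  have h3 : Complex.cosh (d.path t) =
      ⟨Real.cosh (z.lam (closingTime k l u * t)) * (e.sign * Real.cos (z.nu (closingTime k l u * t))),
       Real.sinh (z.lam (closingTime k l u * t)) * (e.sign * Real.sin (z.nu (closingTime k l u * t)))⟩ := by
    rw [cosh_eq_mk, h.nu, h.lam, hx, hy, cos_angle_add, sin_angle_add]
    have hss : e.sign * e.sign = 1 := by cases e <;> norm_num [Primary.sign]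
    rw [← mul_assoc e.sign, ← mul_assoc e.sign, hss, one_mul, one_mul]
    rfl
  rw [h1, h3]
  unfold EllipticPath.pos
  cases e
  · apply Complex.ext
    · simp [Primary.pos, Primary.unit, Primary.sign, Complex.I_sq]; ring
    · simp [Primary.pos, Primary.unit, Primary.sign, Complex.I_sq]; ring
  · apply Complex.ext
    · simp [Primary.pos, Primary.unit, Primary.sign]; ring
    · simp [Primary.pos, Primary.unit, Primary.sign]

theorem loop_eq (hk : 0 < k) (hl : 0 < l) (hkl : Nat.Coprime k l)
    (h : IsTorusMotion μ e k l g c z d u m) :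
    loop e z = fun t => loopMap e.unit (d.path t) := by
  funext t
  rw [loop, h.minPeriod_eq hk hl hkl, h.pos_sub hk hl]

/-- On the level `K = 0`, away from collisions, `V - c = -2(p_λ² + p_ν²) / (cosh² λ - cos² ν)`. -/
theorem potential_eq_iff (h : IsTorusMotion μ e k l g c z d u m) {t : ℝ} (hne : z.pos t ≠ e.pos) :
    potential μ (z.pos t) = c ↔ z.plam t = 0 ∧ z.pnu t = 0 := by
  have hA : ‖z.pos t - Primary.earth.pos‖ = _ := norm_add_half (z.lam t) (z.nu t)
  have hB : ‖z.pos t - Primary.moon.pos‖ = _ := norm_sub_half (z.lam t) (z.nu t)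
  have hcos : -1 < Real.cos (d.N (t / (k * u) + d.b)) := by
    rw [← Real.cos_abs, ← Real.cos_pi]
    exact Real.cos_lt_cos_of_nonneg_of_le_pi (abs_nonneg _) le_rfl (h.admissible.abs_lt _)
  have hch := Real.one_le_cosh (z.lam t)
  have hnu : Real.cos (z.nu t) = e.sign * Real.cos (d.N (t / (k * u) + d.b)) := by
    rw [h.nu, cos_angle_add]
  have hAB : Real.cosh (z.lam t) + Real.cos (z.nu t) ≠ 0 ∧
      Real.cosh (z.lam t) - Real.cos (z.nu t) ≠ 0 := by
    have hne' : ‖z.pos t - e.pos‖ ≠ 0 := norm_ne_zero_iff.2 (sub_ne_zero.2 hne)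
    cases e
    · rw [hA] at hne'
      simp only [Primary.sign] at hnu
      exact ⟨fun h => hne' (by rw [h]; simp), by linarith⟩
    · rw [hB] at hne'
      simp only [Primary.sign] at hnu
      exact ⟨by linarith, fun h => hne' (by rw [h]; simp)⟩
  obtain ⟨hA0, hB0⟩ := hAB
  have e1 := h.level_lam t
  have e2 := h.level_nu t
  unfold potential
  rw [hA, hB]
  set Y := Real.cosh (z.lam t)
  set X := Real.cos (z.nu t)
  have h3 : -(1 - μ) / ((Y + X) / 2) - μ / ((Y - X) / 2) - c =
      -(2 * z.plam t ^ 2 + 2 * z.pnu t ^ 2) / ((Y + X) * (Y - X)) := by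
    field_simp
    linear_combination e1 + e2
  rw [← sub_eq_zero, h3, div_eq_zero_iff]
  constructor
  · rintro (h | h)
    · constructor
      · nlinarith [sq_nonneg (z.plam t), sq_nonneg (z.pnu t)]
      · nlinarith [sq_nonneg (z.plam t), sq_nonneg (z.pnu t)]
    · exact absurd h (mul_ne_zero hA0 hB0)
  · rintro ⟨h1, h2⟩
    left; rw [h1, h2]; norm_num

theorem plam_eq_zero_iff (hk : 0 < k) (hl : 0 < l) (h : IsTorusMotion μ e k l g c z d u m)
    (t : ℝ) : z.plam (closingTime k l u * t) = 0 ↔ ∃ n : ℤ, 2 * d.x t - 1 / 2 = n := by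
  have h1 := h.plam (closingTime k l u * t)
  have hlu : (l : ℝ) * u ≠ 0 := mul_ne_zero (by exact_mod_cast hl.ne') h.pos.ne'
  rw [(h.lam_mul hk hl t).1, eq_div_iff hlu] at h1
  constructor
  · intro h0
    exact h.admissible.profile_L.deriv_eq_zero (by rw [← h1, h0]; ring)
  · rintro ⟨n, hn⟩
    rw [h.admissible.profile_L.deriv_zero_of_int hn] at h1
    have := (mul_eq_zero.1 h1).resolve_right hlu
    linarith

theorem pnu_eq_zero_iff (hk : 0 < k) (hl : 0 < l) (h : IsTorusMotion μ e k l g c z d u m)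
    (t : ℝ) : z.pnu (closingTime k l u * t) = 0 ↔ ∃ n : ℤ, 2 * d.y t - 1 / 2 = n := by
  have h1 := h.pnu (closingTime k l u * t)
  have hku : (k : ℝ) * u ≠ 0 := mul_ne_zero (by exact_mod_cast hk.ne') h.pos.ne'
  rw [(h.lam_mul hk hl t).2, eq_div_iff hku] at h1
  constructor
  · intro h0
    exact h.admissible.profile_N.deriv_eq_zero (by rw [← h1, h0]; ring)
  · rintro ⟨n, hn⟩
    rw [h.admissible.profile_N.deriv_zero_of_int hn] at h1
    have := (mul_eq_zero.1 h1).resolve_right hku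
    linarith

theorem pos_eq_iff (hk : 0 < k) (hl : 0 < l) (h : IsTorusMotion μ e k l g c z d u m)
    (t : ℝ) : z.pos (closingTime k l u * t) = e.pos ↔
      ∃ m n : ℤ, 2 * d.x t - 1 / 2 = m + 1 / 2 ∧ 2 * d.y t - 1 / 2 = n + 1 / 2 := by
  rw [← sub_eq_zero, h.pos_sub hk hl]
  constructor
  · intro h0
    have hw := loopMap_eq_zero e.unit_ne_zero (h.admissible.abs_lt _) h0
    obtain ⟨m, hm⟩ := h.admissible.profile_L.eq_zero (congrArg Complex.re hw)
    obtain ⟨n, hn⟩ := h.admissible.profile_N.eq_zero (congrArg Complex.im hw)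
    exact ⟨m - 1, n - 1, by push_cast; linarith, by push_cast; linarith⟩
  · rintro ⟨m, n, hm, hn⟩
    have hw : d.path t = 0 := by
      apply Complex.ext
      · exact h.admissible.profile_L.zero_of_int (m := m + 1) (by push_cast; linarith)
      · exact h.admissible.profile_N.zero_of_int (m := n + 1) (by push_cast; linarith)
    rw [hw]; simp [loopMap]

/-- Touching the boundary of the Hill's region. -/
theorem brake_iff (hk : 0 < k) (hl : 0 < l) (h : IsTorusMotion μ e k l g c z d u m)
    (t : ℝ) : (z.pos (closingTime k l u * t) ≠ e.pos ∧
        potential μ (z.pos (closingTime k l u * t)) = c) ↔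
      ∃ m n : ℤ, 2 * d.x t - 1 / 2 = m ∧ 2 * d.y t - 1 / 2 = n := by
  constructor
  · rintro ⟨hne, hV⟩
    obtain ⟨h1, h2⟩ := (h.potential_eq_iff hne).1 hV
    obtain ⟨m, hm⟩ := (h.plam_eq_zero_iff hk hl t).1 h1
    obtain ⟨n, hn⟩ := (h.pnu_eq_zero_iff hk hl t).1 h2
    exact ⟨m, n, hm, hn⟩
  · rintro ⟨m, n, hm, hn⟩
    have hne : z.pos (closingTime k l u * t) ≠ e.pos := by
      rw [Ne, h.pos_eq_iff hk hl]
      rintro ⟨m', n', hm', -⟩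
      have h2 : ((2 * m : ℤ) : ℝ) = (2 * m' + 1 : ℤ) := by push_cast; linarith
      have := Int.cast_injective h2
      omega
    exact ⟨hne, (h.potential_eq_iff hne).2 ⟨(h.plam_eq_zero_iff hk hl t).2 ⟨m, hm⟩,
      (h.pnu_eq_zero_iff hk hl t).2 ⟨n, hn⟩⟩⟩

/-- Of the fixed points of time reversal, the integer lattice points are the brakes (both momenta
vanish) and the half-integer ones the collisions (both profiles vanish). -/
theorem isSingular_iff (hk : 0 < k) (hl : 0 < l) (h : IsTorusMotion μ e k l g c z d u m) :
    IsSingular μ e c z ↔ ¬ d.IsRegular True := by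
  have hP := closingTime_pos hk hl h.pos
  have hcond : ∀ t, (z.pos (closingTime k l u * t) = e.pos ∨
      potential μ (z.pos (closingTime k l u * t)) = c) ↔
      (2 * d.x t - 1 / 2, 2 * d.y t - 1 / 2) ∈ lattice True := by
    intro t
    have h1 := h.pos_eq_iff hk hl t
    have h2 := h.brake_iff hk hl t
    rw [mem_lattice]
    constructor
    · intro hs
      by_cases hpe : z.pos (closingTime k l u * t) = e.pos
      · obtain ⟨i, j, hij⟩ := h1.1 hpe
        exact ⟨i, j, .inr ⟨trivial, hij⟩⟩
      · obtain ⟨i, j, hij⟩ := h2.1 ⟨hpe, hs.resolve_left hpe⟩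
        exact ⟨i, j, .inl hij⟩
    · rintro ⟨i, j, hij | ⟨-, hij⟩⟩
      · exact .inr (h2.2 ⟨i, j, hij⟩).2
      · exact .inl (h1.2 ⟨i, j, hij⟩)
  unfold IsSingular Lissajous.IsRegular
  push Not
  constructor
  · rintro ⟨t, ht⟩
    refine ⟨t / closingTime k l u, (hcond _).1 ?_⟩
    rwa [mul_div_cancel₀ _ hP.ne']
  · rintro ⟨t, ht⟩
    exact ⟨_, (hcond t).2 ht⟩

end IsTorusMotion

end TwoCenter

namespace TwoCenter

/-! ### Singular orbits are distinguished -/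

theorem hasInverseSelfTangency_of_reals {γ : ℝ → ℂ} (hp : Function.Periodic γ 1) {t u : ℝ}
    (hne : ∀ n : ℤ, t - u ≠ n) (he : γ t = γ u) (hd : deriv γ u = -deriv γ t)
    (h0 : deriv γ t ≠ 0) : HasInverseSelfTangency γ := by
  have hdp : Function.Periodic (deriv γ) 1 := fun t => by
    conv_rhs => rw [show γ = fun t => γ (t + 1) from funext fun t => (hp t).symm,
      deriv_comp_add_const]
  have key : ∀ {f : ℝ → ℂ}, Function.Periodic f 1 → ∀ t, f (Int.fract t) = f t := by
    intro f hf t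
    have := hf.sub_int_mul_eq (x := t) ⌊t⌋
    rwa [mul_one] at this
  refine ⟨Int.fract t, ⟨Int.fract_nonneg t, Int.fract_lt_one t⟩, Int.fract u,
    ⟨Int.fract_nonneg u, Int.fract_lt_one u⟩, fun h => ?_, ?_, ?_⟩
  · obtain ⟨n, hn⟩ := Int.fract_eq_fract.1 h
    exact hne n hn
  · rw [key hp, key hp, he]
  · rw [key hdp, key hdp]
    exact ⟨h0, -1, by norm_num, by rw [hd]; simp⟩

namespace Lissajous

variable {d : Lissajous} {c : ℂ}

theorem deriv_deriv_of_path_eq_zero (h : d.IsAdmissible) (hc : c ≠ 0) {t : ℝ}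
    (h0 : d.path t = 0) :
    deriv (deriv fun t => loopMap c (d.path t)) t = c ^ 2 / 2 * d.velocity t ^ 2 := by
  have hd : (deriv fun t => loopMap c (d.path t)) =
      fun t => loopMapDeriv c (d.path t) * d.velocity t :=
    funext fun t => (h.hasDerivAt_comp (isChart_loopMap hc) t).deriv
  rw [hd]
  have hv : DifferentiableAt ℝ d.velocity t := by
    rw [show d.velocity = deriv d.path from funext fun t => (h.hasDerivAt t).deriv.symm]
    have : ContDiff ℝ 1 (deriv d.path) := by
      have h2 : ContDiff ℝ 2 d.path := by
        exact_mod_cast contDiff_infty.1 h.contDiff 2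
      exact ((contDiff_succ_iff_deriv (n := 1)).1 h2).2.2
    exact this.differentiable one_ne_zero t
  have hF : HasDerivAt (loopMapDeriv c) (c ^ 2 / 2) (d.path t) := by
    have h1 : HasDerivAt (fun w : ℂ => w / 2) (1 / 2) (d.path t) := (hasDerivAt_id _).div_const 2
    refine ((h1.csinh.const_mul (c ^ 2)).mul h1.ccosh).congr_deriv ?_
    rw [h0]
    simp
    ring
  have := (hF.comp_of_eq t (h.hasDerivAt t) rfl).mul hv.hasDerivAt
  refine (HasDerivAt.deriv this).trans ?_
  simp only [Function.comp, h0, loopMapDeriv, zero_div, Complex.sinh_zero, mul_zero, zero_mul,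
    add_zero]
  ring

theorem half_notMem_lattice {E : Prop} (hcl : d.IsClosing E) :
    (d.κ * (1 / 2), d.κ' * (1 / 2)) ∉ lattice E := by
  intro hm
  obtain ⟨n, hn⟩ := hcl.minimal _ hm
  have h2 : ((2 * n : ℤ) : ℝ) = (1 : ℤ) := by push_cast; linarith
  have := Int.cast_injective h2
  omega

theorem hasInverseSelfTangency {k l : ℕ} (hk : 0 < k) (hkl : Nat.Coprime k l)
    (h : d.IsAdmissible) (ht : d.HasType k l) (hc : c ≠ 0) {t₀ : ℝ}
    (hm : (2 * d.x t₀ - 1 / 2, 2 * d.y t₀ - 1 / 2) ∈ lattice True) :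
    HasInverseSelfTangency fun t => loopMap c (d.path t) := by
  have hF := isChart_loopMap hc
  have hκ : 1 / 2 ≤ d.κ := by
    rw [ht.1]
    have h1 := half_le_closingFraction k l
    have h2 : (1 : ℝ) ≤ k := by exact_mod_cast hk
    nlinarith
  have hκpos := h.κ_pos
  -- The orbit retraces itself around `t₀`. This `s` puts the phase of `λ` at an odd multiple of
  -- `1/8`, where neither the profile nor its derivative vanishes, and `2s ≤ 1/2` keeps the times
  -- `t₀ ± s` distinct modulo `1`.
  set s := 1 / (8 * d.κ) with hs
  have hsκ : d.κ * s = 1 / 8 := by rw [hs]; field_simp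
  have hspos : 0 < s := by positivity
  have hs1 : s ≤ 1 / 4 := by nlinarith
  have hmem : (d.x (t₀ - s) + d.x (t₀ + s) - 1 / 2, d.y (t₀ - s) + d.y (t₀ + s) - 1 / 2) ∈
      lattice True := by
    convert hm using 2 <;> simp only [x, y] <;> ring
  obtain ⟨e1, e2⟩ := eq_of_add h hF hmem
  have hx : ∃ i : ℤ, 8 * d.x (t₀ + s) = 2 * i + 1 := by
    have : d.x (t₀ + s) = d.x t₀ + 1 / 8 := by rw [← hsκ]; simp only [x]; ring
    rw [this]
    obtain ⟨m, n, ⟨h1, -⟩ | ⟨-, h1, -⟩⟩ := mem_lattice.1 hm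
    · exact ⟨2 * m + 1, by push_cast; linarith⟩
    · exact ⟨2 * m + 2, by push_cast; linarith⟩
  obtain ⟨i, hi⟩ := hx
  have hodd : ∀ j : ℤ, 8 * d.x (t₀ + s) ≠ 2 * j := by
    intro j hj
    have h2 : ((2 * i + 1 : ℤ) : ℝ) = (2 * j : ℤ) := by push_cast; linarith
    have := Int.cast_injective h2
    omega
  have hder : deriv (fun t => loopMap c (d.path t)) (t₀ + s) ≠ 0 := by
    rw [(h.hasDerivAt_comp hF _).deriv]
    refine mul_ne_zero (hF.deriv_ne_zero _ (h.abs_lt _) fun _ h0 => ?_) fun h0 => ?_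
    · obtain ⟨m, hm⟩ := h.profile_L.eq_zero (congrArg Complex.re h0)
      exact hodd (2 * m) (by push_cast; linarith)
    · have e1 : d.κ * deriv d.L (d.x (t₀ + s)) = 0 := congrArg Complex.re h0
      obtain ⟨m, hm⟩ := h.profile_L.deriv_eq_zero ((mul_eq_zero.1 e1).resolve_left hκpos.ne')
      exact hodd (2 * m + 1) (by push_cast; linarith)
  refine hasInverseSelfTangency_of_reals (periodic h hF (ht.isClosing hkl)) (t := t₀ + s)
    (u := t₀ - s) (fun n hn => ?_) e1.symm ?_ hder
  · have h1 : (0 : ℝ) < n := by linarith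
    have h2 : (n : ℝ) < 1 := by linarith
    have h3 : 0 < n := by exact_mod_cast h1
    have h4 : n < 1 := by exact_mod_cast h2
    omega
  · rw [(h.hasDerivAt_comp hF _).deriv, (h.hasDerivAt_comp hF _).deriv]
    exact e2

end Lissajous

namespace IsTorusMotion

variable {μ : ℝ} {e : Primary} {k l : ℕ} {g c : ℝ} {z : EllipticPath} {d : Lissajous} {u : ℝ}
  {m : ℤ}

theorem onHillBoundary (hk : 0 < k) (hl : 0 < l) (hkl : Nat.Coprime k l)
    (h : IsTorusMotion μ e k l g c z d u m) {t : ℝ} {i j : ℤ} (hi : 2 * d.x t - 1 / 2 = i)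
    (hj : 2 * d.y t - 1 / 2 = j) : OnHillBoundary (centeredPotential μ e) c (loop e z t) := by
  obtain ⟨h1, h2⟩ := (h.brake_iff hk hl t).2 ⟨i, j, hi, hj⟩
  rw [loop, h.minPeriod_eq hk hl hkl]
  refine ⟨sub_ne_zero.2 h1, ?_⟩
  rw [centeredPotential, sub_add_cancel, h2]

theorem path_eq_zero (h : IsTorusMotion μ e k l g c z d u m) {t : ℝ} {i j : ℤ}
    (hi : 2 * d.x t - 1 / 2 = i + 1 / 2) (hj : 2 * d.y t - 1 / 2 = j + 1 / 2) :
    d.path t = 0 := by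
  apply Complex.ext
  · exact h.admissible.profile_L.zero_of_int (m := i + 1) (by push_cast; linarith)
  · exact h.admissible.profile_N.zero_of_int (m := j + 1) (by push_cast; linarith)

/-- Half a period later time reversal has another fixed point, displaced by `(κ, κ')`. An integer
displacement gives two brakes or two collisions; a half-integer one gives a brake and a collision.
Minimality of the period keeps the two phases apart. -/
theorem isDistinguished (hk : 0 < k) (hl : 0 < l) (hkl : Nat.Coprime k l)
    (h : IsTorusMotion μ e k l g c z d u m) (hs : IsSingular μ e c z) :
    IsDistinguished (centeredPotential μ e) c (loop e z) := by
  have hc := e.unit_ne_zero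
  have hloop := h.loop_eq hk hl hkl
  have hcl := h.type.isClosing hkl
  have hhalf := Lissajous.half_notMem_lattice hcl
  have hL := h.admissible.profile_L
  have hN := h.admissible.profile_N
  rw [h.isSingular_iff hk hl, Lissajous.IsRegular] at hs
  push Not at hs
  obtain ⟨t, ht⟩ := hs
  have hinv := Lissajous.hasInverseSelfTangency hk hkl h.admissible h.type hc ht
  rw [← hloop] at hinv
  have hx : 2 * d.x (t + 1 / 2) - 1 / 2 = 2 * d.x t - 1 / 2 + d.κ := by
    simp only [Lissajous.x]; ring
  have hy : 2 * d.y (t + 1 / 2) - 1 / 2 = 2 * d.y t - 1 / 2 + d.κ' := by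
    simp only [Lissajous.y]; ring
  have hsub : (d.x (t + 1 / 2) - d.x t, d.y (t + 1 / 2) - d.y t) ∉ lattice True := by
    convert hhalf using 3 <;> simp only [Lissajous.x, Lissajous.y] <;> ring
  have hzero : ∀ {t : ℝ}, d.path t = 0 → loop e z t = 0 := fun h0 => by
    rw [hloop]; simp [h0, loopMap]
  obtain ⟨p, r, hpr⟩ := mem_lattice.1 hcl.mem
  obtain ⟨i, j, hij⟩ := mem_lattice.1 ht
  rcases hpr with ⟨hp, hr⟩ | ⟨-, hp, hr⟩ <;> rcases hij with ⟨hi, hj⟩ | ⟨-, hi, hj⟩ <;>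
    rw [hp] at hx <;> rw [hr] at hy <;> rw [hi] at hx <;> rw [hj] at hy
  · refine .inl ⟨hinv, t, t + 1 / 2, h.onHillBoundary hk hl hkl hi hj,
      h.onHillBoundary hk hl hkl (i := i + p) (j := j + r) (by push_cast; exact hx)
      (by push_cast; exact hy), fun heq => ?_⟩
    rw [hloop] at heq
    have h1 := int_mem_lattice (E := True) i 0
    have h2 := int_mem_lattice (E := True) 0 j
    rcases Lissajous.coincidence h.admissible (isChart_loopMap hc) heq with hm | hm | hm | hm
    · exact hsub hm
    · apply hsub
      convert sub_mem hm h1 using 1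
      simp only [Prod.mk_sub_mk]; congr 1
      · linarith
      · simp
    · apply hsub
      convert sub_mem hm h2 using 1
      simp only [Prod.mk_sub_mk]; congr 1
      · simp
      · linarith
    · apply hsub
      convert sub_mem (sub_mem hm h1) h2 using 1
      simp only [Prod.mk_sub_mk]; congr 1
      · push_cast; linarith
      · push_cast; linarith
  · have h1 := h.path_eq_zero hi hj
    have h2 := h.path_eq_zero (t := t + 1 / 2) (i := i + p) (j := j + r) (by push_cast; linarith)
      (by push_cast; linarith)
    refine .inr (.inl ⟨hinv, t, t + 1 / 2, hzero h1, hzero h2, fun heq => ?_⟩)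
    rw [hloop, Lissajous.deriv_deriv_of_path_eq_zero h.admissible hc h1,
      Lissajous.deriv_deriv_of_path_eq_zero h.admissible hc h2] at heq
    -- Equal second derivatives mean equal or opposite velocities in the covering plane. As `w = 0`
    -- at both times, the phases would agree modulo the lattice.
    have hsq := mul_left_cancel₀ (div_ne_zero (pow_ne_zero 2 hc) two_ne_zero) heq
    have a1 : d.L (d.x t) = 0 := congrArg Complex.re h1
    have a2 : d.N (d.y t) = 0 := congrArg Complex.im h1
    have a3 : d.L (d.x (t + 1 / 2)) = 0 := congrArg Complex.re h2
    have a4 : d.N (d.y (t + 1 / 2)) = 0 := congrArg Complex.im h2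
    have hκ := h.admissible.κ_pos.ne'
    have hκ' := h.admissible.κ'_pos.ne'
    apply hsub
    rcases sq_eq_sq_iff_eq_or_eq_neg.1 hsq with hv | hv
    · have b1 : d.κ * deriv d.L (d.x t) = d.κ * deriv d.L (d.x (t + 1 / 2)) :=
        congrArg Complex.re hv
      have b2 : d.κ' * deriv d.N (d.y t) = d.κ' * deriv d.N (d.y (t + 1 / 2)) :=
        congrArg Complex.im hv
      obtain ⟨m, hm⟩ := hL.sub_int_of_eq (a3.trans a1.symm) (mul_left_cancel₀ hκ b1).symm
      obtain ⟨n, hn⟩ := hN.sub_int_of_eq (a4.trans a2.symm) (mul_left_cancel₀ hκ' b2).symm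
      exact ⟨m, n, .inl ⟨hm, hn⟩⟩
    · have b1 : d.κ * deriv d.L (d.x t) = -(d.κ * deriv d.L (d.x (t + 1 / 2))) :=
        congrArg Complex.re hv
      have b2 : d.κ' * deriv d.N (d.y t) = -(d.κ' * deriv d.N (d.y (t + 1 / 2))) :=
        congrArg Complex.im hv
      rw [← mul_neg] at b1 b2
      obtain ⟨m, hm⟩ := hL.sub_half_of_eq_neg (x := d.x t) (y := d.x (t + 1 / 2))
        (by rw [a1, a3, neg_zero]) (by rw [mul_left_cancel₀ hκ b1, neg_neg])
      obtain ⟨n, hn⟩ := hN.sub_half_of_eq_neg (x := d.y t) (y := d.y (t + 1 / 2))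
        (by rw [a2, a4, neg_zero]) (by rw [mul_left_cancel₀ hκ' b2, neg_neg])
      exact ⟨m, n, .inr ⟨trivial, hm, hn⟩⟩
  · exact .inr (.inr ⟨hinv, t, t + 1 / 2, h.onHillBoundary hk hl hkl hi hj,
      hzero (h.path_eq_zero (i := i + p) (j := j + r) (by push_cast; linarith)
        (by push_cast; linarith))⟩)
  · exact .inr (.inr ⟨hinv, t + 1 / 2, t, h.onHillBoundary hk hl hkl (i := i + p + 1)
      (j := j + r + 1) (by push_cast; linarith) (by push_cast; linarith),
      hzero (h.path_eq_zero hi hj)⟩)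

theorem isGenericImmersionAvoidingZero (hk : 0 < k) (hl : 0 < l) (hkl : Nat.Coprime k l)
    (h : IsTorusMotion μ e k l g c z d u m) (hs : ¬ IsSingular μ e c z) :
    IsGenericImmersionAvoidingZero (loop e z) := by
  rw [h.isSingular_iff hk hl, not_not] at hs
  rw [h.loop_eq hk hl hkl]
  exact ⟨hs.isGenericImmersion h.admissible (isChart_loopMap e.unit_ne_zero)
    (h.type.isClosing hkl), Lissajous.loopMap_ne_zero h.admissible hs e.unit_ne_zero⟩

/-! ### Families of orbits -/

theorem pos_eq_cosh (z : EllipticPath) (t : ℝ) :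
    z.pos t = Complex.cosh (z.lam t + z.nu t * Complex.I) / 2 := by
  rw [← Complex.mk_eq_add_mul_I, cosh_eq_mk]
  apply Complex.ext <;> simp [EllipticPath.pos]

theorem hasDerivAt_loop (h : IsTorusMotion μ e k l g c z d u m) (t : ℝ) :
    HasDerivAt (loop e z) (Complex.sinh (z.lam (z.minPeriod * t) +
      z.nu (z.minPeriod * t) * Complex.I) * (4 * z.plam (z.minPeriod * t) +
      4 * z.pnu (z.minPeriod * t) * Complex.I) * z.minPeriod / 2) t := by
  have h1 : HasDerivAt (fun t => z.minPeriod * t) z.minPeriod t :=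
    ((hasDerivAt_id t).const_mul _).congr_deriv (mul_one _)
  have h2 := ((h.deriv_lam (z.minPeriod * t)).comp t h1).ofReal_comp
  have h3 := (((h.deriv_nu (z.minPeriod * t)).comp t h1).ofReal_comp).mul_const Complex.I
  have h4 := (((Complex.hasDerivAt_cosh _).comp_of_eq t (h2.add h3) rfl).div_const 2).sub_const e.pos
  have h5 : loop e z = fun t => Complex.cosh (z.lam (z.minPeriod * t) +
      z.nu (z.minPeriod * t) * Complex.I) / 2 - e.pos := by
    funext t; rw [loop, pos_eq_cosh]
  rw [h5]
  refine HasDerivAt.congr_deriv h4 ?_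
  simp only [Pi.add_apply, Function.comp]
  push_cast
  ring

/-- `C¹`-continuity is read off the orbits themselves, so `d` and `m` may be chosen separately for
each `s`; only `u`, which fixes the period, has to be continuous. The exceptional times are the
singular ones, and no triple points arise. -/
theorem isStarkHomotopy (hk : 0 < k) (hl : 0 < l) (hkl : Nat.Coprime k l) {g c : ℝ → ℝ}
    {z : ℝ → EllipticPath} {d : ℝ → Lissajous} {u : ℝ → ℝ} {m : ℝ → ℤ}
    (h : ∀ s ∈ Icc (0 : ℝ) 1, IsTorusMotion μ e k l (g s) (c s) (z s) (d s) (u s) (m s))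
    (hlam : ContinuousOn (fun x : ℝ × ℝ => (z x.1).lam x.2) (Icc (0 : ℝ) 1 ×ˢ univ))
    (hnu : ContinuousOn (fun x : ℝ × ℝ => (z x.1).nu x.2) (Icc (0 : ℝ) 1 ×ˢ univ))
    (hplam : ContinuousOn (fun x : ℝ × ℝ => (z x.1).plam x.2) (Icc (0 : ℝ) 1 ×ˢ univ))
    (hpnu : ContinuousOn (fun x : ℝ × ℝ => (z x.1).pnu x.2) (Icc (0 : ℝ) 1 ×ˢ univ))
    (hu : ContinuousOn u (Icc 0 1))
    (hfin : {s ∈ Icc (0 : ℝ) 1 | IsSingular μ e (c s) (z s)}.Finite)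
    (h0 : ¬ IsSingular μ e (c 0) (z 0)) (h1 : ¬ IsSingular μ e (c 1) (z 1)) :
    IsStarkHomotopy (centeredPotential μ e) c fun s => loop e (z s) := by
  have hP : ContinuousOn (fun s => (z s).minPeriod) (Icc 0 1) := by
    have : ContinuousOn (fun s => closingTime k l (u s)) (Icc 0 1) := by
      unfold closingTime
      exact continuousOn_const.mul hu
    exact this.congr fun s hs => (h s hs).minPeriod_eq hk hl hkl
  have hP' : ContinuousOn (fun x : ℝ × ℝ => (z x.1).minPeriod) (Icc (0 : ℝ) 1 ×ˢ univ) :=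
    hP.comp continuousOn_fst fun x hx => hx.1
  have hφ : ContinuousOn (fun x : ℝ × ℝ => (x.1, (z x.1).minPeriod * x.2))
      (Icc (0 : ℝ) 1 ×ˢ univ) := continuousOn_fst.prodMk (hP'.mul continuousOn_snd)
  have hmaps : MapsTo (fun x : ℝ × ℝ => (x.1, (z x.1).minPeriod * x.2))
      (Icc (0 : ℝ) 1 ×ˢ univ) (Icc (0 : ℝ) 1 ×ˢ univ) := fun x hx => ⟨hx.1, trivial⟩
  have lam' := Complex.continuous_ofReal.comp_continuousOn (hlam.comp hφ hmaps)
  have nu' := Complex.continuous_ofReal.comp_continuousOn (hnu.comp hφ hmaps)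
  have plam' := Complex.continuous_ofReal.comp_continuousOn (hplam.comp hφ hmaps)
  have pnu' := Complex.continuous_ofReal.comp_continuousOn (hpnu.comp hφ hmaps)
  have P' := Complex.continuous_ofReal.comp_continuousOn hP'
  have hw := lam'.add (nu'.mul (continuousOn_const (c := Complex.I)))
  have hsmooth : ∀ s ∈ Icc (0 : ℝ) 1, ContDiff ℝ (⊤ : ℕ∞) (loop e (z s)) := fun s hs => by
    rw [(h s hs).loop_eq hk hl hkl]
    exact (h s hs).admissible.contDiff_comp (isChart_loopMap e.unit_ne_zero)
  refine ⟨⟨fun s hs => ?_, fun s hs => (hsmooth s hs).of_le (by exact_mod_cast le_top), ?_, ?_⟩,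
    hsmooth, {s ∈ Icc (0 : ℝ) 1 | IsSingular μ e (c s) (z s)}, hfin, ?_, ?_, ?_⟩
  · rw [(h s hs).loop_eq hk hl hkl]
    exact Lissajous.periodic (h s hs).admissible (isChart_loopMap e.unit_ne_zero)
      ((h s hs).type.isClosing hkl)
  · have : ContinuousOn (fun x : ℝ × ℝ => Complex.cosh ((z x.1).lam ((z x.1).minPeriod * x.2) +
        (z x.1).nu ((z x.1).minPeriod * x.2) * Complex.I) / 2 - e.pos)
        (Icc (0 : ℝ) 1 ×ˢ univ) :=
      ((Complex.continuous_cosh.comp_continuousOn hw).div_const 2).sub continuousOn_const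
    refine this.congr fun x _ => ?_
    simp only
    rw [loop, pos_eq_cosh]
  · have h4 : ContinuousOn (fun _ : ℝ × ℝ => (4 : ℂ)) (Icc (0 : ℝ) 1 ×ˢ univ) := continuousOn_const
    have := (((Complex.continuous_sinh.comp_continuousOn hw).mul ((h4.mul plam').add
      ((h4.mul pnu').mul (continuousOn_const (c := Complex.I))))).mul P').div_const 2
    exact this.congr fun x hx => ((h x.1 hx.1).hasDerivAt_loop x.2).deriv
  · rintro s ⟨hs, hsing⟩
    refine ⟨lt_of_le_of_ne hs.1 ?_, lt_of_le_of_ne hs.2 ?_⟩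
    · rintro rfl; exact h0 hsing
    · rintro rfl; exact h1 hsing
  · intro s hs hnot
    exact (h s hs).isGenericImmersionAvoidingZero hk hl hkl fun hsing => hnot ⟨hs, hsing⟩
  · rintro s ⟨hs, hsing⟩
    exact .inl ((h s hs).isDistinguished hk hl hkl hsing)

/-- The phase difference grows linearly in `σ` at the positive rate `ρ`, and singular shifts are
those at which it is a quarter-integer. -/
theorem finite_singular (hk : 0 < k) (hl : 0 < l) (hkl : Nat.Coprime k l)
    (h : IsTorusMotion μ e k l g c z d u m) (a b : ℝ) :
    {σ ∈ Icc a b | IsSingular μ e c (EllipticPath.shift σ z)}.Finite := by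
  have hl' : (0 : ℝ) < l := by exact_mod_cast hl
  have hu := h.pos
  set ρ := d.κ' / (l * u) with hρ
  have hρpos : 0 < ρ := div_pos h.admissible.κ'_pos (by positivity)
  refine Set.Finite.subset ((Set.finite_Icc ⌊4 * (d.phase + ρ * a)⌋ ⌈4 * (d.phase + ρ * b)⌉).image
    fun n : ℤ => ((n : ℝ) / 4 - d.phase) / ρ) ?_
  rintro σ ⟨⟨ha, hb⟩, hs⟩
  rw [(h.shift σ).isSingular_iff hk hl, (h.shift σ).type.isRegular_iff hk hkl] at hs
  push Not at hs
  obtain ⟨n, hn⟩ := hs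
  have hph : d.phase + ρ * σ = n / 4 := by
    rw [← hn, hρ]; simp only [Lissajous.phase]; ring
  refine ⟨n, ⟨?_, ?_⟩, ?_⟩
  · have h1 : (⌊4 * (d.phase + ρ * a)⌋ : ℝ) ≤ n := by
      have h2 := Int.floor_le (4 * (d.phase + ρ * a))
      have h3 := mul_le_mul_of_nonneg_left ha hρpos.le
      linarith
    exact_mod_cast h1
  · have h1 : (n : ℝ) ≤ ⌈4 * (d.phase + ρ * b)⌉ := by
      have h2 := Int.le_ceil (4 * (d.phase + ρ * b))
      have h3 := mul_le_mul_of_nonneg_left hb hρpos.le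
      linarith
    exact_mod_cast h1
  · simp only
    rw [← hph]
    field_simp
    ring

end IsTorusMotion

/-- The period of an oscillation depends continuously on the oscillation. -/
theorem continuous_period {X : Type*} [TopologicalSpace X] {y : X → ℝ → ℝ}
    (hy : Continuous fun x : X × ℝ => y x.1 x.2) {T a : X → ℝ} {L : X → ℝ → ℝ}
    (hT : ∀ x, 0 < T x) (hL : ∀ x, IsProfile (L x)) (h : ∀ x t, y x t = L x (t / T x + a x)) :
    Continuous T := by
  refine continuous_iff_continuousAt.2 fun x₀ => Metric.continuousAt_iff'.2 fun ε hε => ?_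
  have hT₀ := hT x₀
  obtain ⟨η, hη, hηε, hηT⟩ : ∃ η > 0, 4 * η < ε ∧ 8 * η < T x₀ := by
    refine ⟨min ε (T x₀) / 16, by positivity, ?_, ?_⟩
    · linarith [min_le_left ε (T x₀)]
    · linarith [min_le_right ε (T x₀)]
  set τ := -a x₀ * T x₀ with hτ
  have hyτ : ∀ r, y x₀ (τ + r) = L x₀ (r / T x₀) := by
    intro r
    rw [h, hτ]
    congr 1
    field_simp
    ring
  have hpos : ∀ r, 0 < r → r < T x₀ / 2 → 0 < y x₀ (τ + r) := by
    intro r h1 h2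
    rw [hyτ]
    exact (hL x₀).pos ⟨by positivity, by rw [div_lt_iff₀ hT₀]; linarith⟩
  have hneg : ∀ r, 0 < r → r < T x₀ / 2 → y x₀ (τ - r) < 0 := by
    intro r h1 h2
    have := hpos r h1 h2
    rw [hyτ] at this
    rw [sub_eq_add_neg, hyτ, neg_div, (hL x₀).odd]
    linarith
  have hneg' : y x₀ (τ + (T x₀ / 2 + η)) < 0 := by
    have := hpos η hη (by linarith)
    rw [hyτ] at this
    rw [hyτ, show (T x₀ / 2 + η) / T x₀ = η / T x₀ + 1 / 2 by field_simp; ring, (hL x₀).half]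
    linarith
  have hcx : ∀ t, Continuous fun x => y x t := fun t => hy.comp (by fun_prop : Continuous fun x => (x, t))
  -- At `x₀` there are zeros at `τ` and `τ + T/2` with positive values between. For nearby `x` the
  -- signs persist outside windows of radius `η` about these zeros. The zeros of `y x` are spaced by
  -- `T x / 2`: one zero in each window bounds `T x` from above, and the absence of zeros in between
  -- bounds it from below.
  have ev1 : ∀ᶠ x in 𝓝 x₀, y x (τ - η) < 0 :=
    (hcx _).continuousAt.eventually_lt continuousAt_const (hneg η hη (by linarith))
  have ev2 : ∀ᶠ x in 𝓝 x₀, y x (τ + (T x₀ / 2 + η)) < 0 :=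
    (hcx _).continuousAt.eventually_lt continuousAt_const hneg'
  have ev3 : ∀ᶠ x in 𝓝 x₀, ∀ t ∈ Icc (τ + η) (τ + (T x₀ / 2 - η)), 0 < y x t := by
    refine isCompact_Icc.eventually_forall_of_forall_eventually fun t ht => ?_
    have h0 : 0 < y x₀ t := by
      have := hpos (t - τ) (by linarith [ht.1]) (by linarith [ht.2])
      rwa [add_sub_cancel] at this
    exact continuousAt_const.eventually_lt hy.continuousAt h0
  filter_upwards [ev1, ev2, ev3] with x h1 h2 h3
  have hTx := hT x
  have hyx : Continuous (y x) := hy.comp (by fun_prop : Continuous fun t => (x, t))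
  have hzero : ∀ t, y x t = 0 → ∃ n : ℤ, t = (n / 2 - a x) * T x := by
    intro t ht
    rw [h] at ht
    obtain ⟨n, hn⟩ := (hL x).eq_zero ht
    refine ⟨n, ?_⟩
    rw [← hn]; field_simp; ring
  have hzero' : ∀ n : ℤ, y x ((n / 2 - a x) * T x) = 0 := by
    intro n
    rw [h]
    refine (hL x).zero_of_int (m := n) ?_
    field_simp
    ring
  have p1 := h3 (τ + η) ⟨le_rfl, by linarith⟩
  have p2 := h3 (τ + (T x₀ / 2 - η)) ⟨by linarith, le_rfl⟩
  obtain ⟨z₁, hz₁, e₁⟩ := intermediate_value_Icc (by linarith : τ - η ≤ τ + η) hyx.continuousOn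
    (show (0 : ℝ) ∈ Icc _ _ from ⟨h1.le, p1.le⟩)
  obtain ⟨z₂, hz₂, e₂⟩ := intermediate_value_Icc'
    (by linarith : τ + (T x₀ / 2 - η) ≤ τ + (T x₀ / 2 + η)) hyx.continuousOn
    (show (0 : ℝ) ∈ Icc _ _ from ⟨h2.le, p2.le⟩)
  obtain ⟨n₁, hn₁⟩ := hzero z₁ e₁
  obtain ⟨n₂, hn₂⟩ := hzero z₂ e₂
  have hlt : z₁ < z₂ := by linarith [hz₁.2, hz₂.1]
  have hn : n₁ + 1 ≤ n₂ := by
    rw [hn₁, hn₂] at hlt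
    have := lt_of_mul_lt_mul_right hlt hTx.le
    have : (n₁ : ℝ) < n₂ := by linarith
    exact_mod_cast this
  have hn' : (n₁ : ℝ) + 1 ≤ n₂ := by exact_mod_cast hn
  have up : T x ≤ T x₀ + 4 * η := by
    have : (n₁ + 1) * T x ≤ n₂ * T x := mul_le_mul_of_nonneg_right hn' hTx.le
    linarith [hz₁.1, hz₂.2]
  have lo : T x₀ - 4 * η ≤ T x := by
    have f1 := Int.floor_le (2 * ((τ + η) / T x + a x))
    have f2 := Int.lt_floor_add_one (2 * ((τ + η) / T x + a x))
    -- The last zero not after `τ + η`; the next one must lie beyond the interval of positivity.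
    set n := ⌊2 * ((τ + η) / T x + a x)⌋
    have g1 : (n / 2 - a x) * T x ≤ τ + η := by
      rw [← le_div_iff₀ hTx]; linarith
    have g2 : τ + η < (((n + 1 : ℤ) : ℝ) / 2 - a x) * T x := by
      rw [← div_lt_iff₀ hTx]; push_cast; linarith
    have g3 : τ + (T x₀ / 2 - η) < (((n + 1 : ℤ) : ℝ) / 2 - a x) * T x := by
      by_contra hcon
      have := h3 _ ⟨g2.le, not_lt.1 hcon⟩
      rw [hzero'] at this
      exact lt_irrefl _ this
    push_cast at g3
    linarith
  rw [Real.dist_eq, abs_lt]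
  exact ⟨by linarith, by linarith⟩

end TwoCenter

/-! ### The proposition -/

theorem proposition4p2 (μ : ℝ) (hμ₀ : 0 < μ) (hμ₁ : μ < 1) (e : Primary) (k l : ℕ)
    (hk : 0 < k) (hl : 0 < l) (hkl : Nat.Coprime k l) :
    (∀ (g c : ℝ) (z : EllipticPath), IsTorusOrbit μ e k l g c z → ∀ a b : ℝ,
      {σ ∈ Set.Icc a b | IsSingular μ e c (shift σ z)}.Finite ∧
      (¬ IsSingular μ e c (shift a z) → ¬ IsSingular μ e c (shift b z) →
        IsStarkHomotopy (centeredPotential μ e) (fun _ => c)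
          (fun s => loop e (shift (a + s * (b - a)) z)))) ∧
    (∀ (g c : ℝ → ℝ) (z : ℝ → EllipticPath), IsTorusSubfamily μ e k l g c z →
      {s ∈ Set.Icc (0 : ℝ) 1 | IsSingular μ e (c s) (z s)}.Finite →
      ¬ IsSingular μ e (c 0) (z 0) → ¬ IsSingular μ e (c 1) (z 1) →
      IsStarkHomotopy (centeredPotential μ e) c (fun s => loop e (z s))) ∧
    (∃ (j₁ : ℚ) (j₂ : ℤ), ∀ (g c : ℝ) (z : EllipticPath), IsTorusOrbit μ e k l g c z →
      (¬ IsSingular μ e c z → JOne (loop e z) = j₁ ∧ JTwo (loop e z) = j₂) ∧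
      (IsSingular μ e c z → ∀ᶠ σ in 𝓝[≠] (0 : ℝ),
        IsGenericImmersionAvoidingZero (loop e (shift σ z)) ∧
        JOne (loop e (shift σ z)) = j₁ ∧ JTwo (loop e (shift σ z)) = j₂)) := by
  refine ⟨fun g c z hz a b => ?_, fun g c z hz hfin h0 h1 => ?_, ?_⟩
  · obtain ⟨d, u, m, h⟩ := exists_isTorusMotion hμ₀ hμ₁ hk hl hz
    refine ⟨h.finite_singular hk hl hkl a b, fun ha hb => ?_⟩
    have hlam := continuous_iff_continuousAt.2 fun t => (hz.deriv_lam t).continuousAt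
    have hnu := continuous_iff_continuousAt.2 fun t => (hz.deriv_nu t).continuousAt
    have hplam := continuous_iff_continuousAt.2 fun t => (hz.deriv_plam t).continuousAt
    have hpnu := continuous_iff_continuousAt.2 fun t => (hz.deriv_pnu t).continuousAt
    refine IsTorusMotion.isStarkHomotopy hk hl hkl
      (z := fun s => EllipticPath.shift (a + s * (b - a)) z) (g := fun _ => g) (u := fun _ => u)
      (m := fun _ => m) (fun s _ => h.shift _) ?_ ?_ ?_ ?_ continuousOn_const ?_ (by simpa using ha)
      (by simpa using hb)
    · exact Continuous.continuousOn (by unfold EllipticPath.shift; fun_prop)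
    · exact Continuous.continuousOn (by unfold EllipticPath.shift; fun_prop)
    · exact Continuous.continuousOn (by unfold EllipticPath.shift; fun_prop)
    · exact Continuous.continuousOn (by unfold EllipticPath.shift; fun_prop)
    -- For `a = b` the family is constant and non-singular. Otherwise `s ↦ a + s(b - a)` is
    -- injective; the order of `a` and `b` is not known, hence the interval from `min a b` to `max a
    -- b`.
    · rcases eq_or_ne a b with rfl | hab
      · refine Set.Finite.subset Set.finite_empty ?_
        rintro s ⟨-, hs⟩
        exact ha (by simpa using hs)
      · have hinj : Function.Injective fun s => a + s * (b - a) := fun s t hst =>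
          mul_right_cancel₀ (sub_ne_zero.2 hab.symm) (add_left_cancel hst)
        refine Set.Finite.of_finite_image (f := fun s => a + s * (b - a)) ?_ hinj.injOn
        refine (h.finite_singular hk hl hkl (min a b) (max a b)).subset ?_
        rintro _ ⟨s, ⟨hs, hsing⟩, rfl⟩
        refine ⟨?_, hsing⟩
        have := (convex_uIcc a b).add_smul_sub_mem left_mem_uIcc right_mem_uIcc hs
        exact this
  · have hm := fun s : Set.Icc (0 : ℝ) 1 => exists_isTorusMotion hμ₀ hμ₁ hk hl (hz.orbit s s.2)
    choose d u m h using hm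
    have hex : ∀ s ∈ Set.Icc (0 : ℝ) 1, IsTorusMotion μ e k l (g s) (c s) (z s)
        (d (Set.projIcc 0 1 zero_le_one s)) (u (Set.projIcc 0 1 zero_le_one s))
        (m (Set.projIcc 0 1 zero_le_one s)) := by
      intro s hs
      rw [Set.projIcc_of_mem _ hs]
      exact h ⟨s, hs⟩
    refine IsTorusMotion.isStarkHomotopy hk hl hkl hex hz.continuousOn_lam
      hz.continuousOn_nu hz.continuousOn_plam hz.continuousOn_pnu ?_ hfin h0 h1
    have hl' : (0 : ℝ) < l := by exact_mod_cast hl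
    have hper : Continuous fun s => (l : ℝ) * u s := by
      refine continuous_period (y := fun s : Set.Icc (0 : ℝ) 1 => (z s).lam) (a := fun s => (d s).a)
        (L := fun s => (d s).L) ?_ (fun s => mul_pos hl' (h s).pos)
        (fun s => (h s).admissible.profile_L) fun s t => (h s).lam t
      exact hz.continuousOn_lam.comp_continuous
        (f := fun x : Set.Icc (0 : ℝ) 1 × ℝ => ((x.1 : ℝ), x.2)) (by fun_prop)
        fun x => ⟨x.1.2, trivial⟩
    have hu : Continuous u := by
      have : u = fun s => (l : ℝ)⁻¹ * (l * u s) := by funext s; field_simp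
      rw [this]
      exact continuous_const.mul hper
    exact (hu.comp continuous_projIcc).continuousOn
  · obtain ⟨j₁, j₂, hj⟩ := Lissajous.exists_invariants hk hl hkl e.unit_ne_zero
    have key : ∀ {g c : ℝ} {z : EllipticPath} {d : Lissajous} {u : ℝ} {m : ℤ},
        IsTorusMotion μ e k l g c z d u m → ¬ IsSingular μ e c z →
        JOne (loop e z) = j₁ ∧ JTwo (loop e z) = j₂ := by
      intro g c z d u m h hs
      rw [h.isSingular_iff hk hl, not_not] at hs
      rw [h.loop_eq hk hl hkl]
      exact hj d h.admissible h.type hs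
    refine ⟨j₁, j₂, fun g c z hz => ?_⟩
    obtain ⟨d, u, m, h⟩ := exists_isTorusMotion hμ₀ hμ₁ hk hl hz
    refine ⟨key h, fun _ => ?_⟩
    -- The other singular shifts near `0` form a finite, hence closed, set that misses `0`.
    have hfin := (h.finite_singular hk hl hkl (-1) 1).subset (Set.sdiff_subset (t := {0}))
    have hev : ∀ᶠ σ in 𝓝 (0 : ℝ),
        σ ∉ {σ ∈ Set.Icc (-1 : ℝ) 1 | IsSingular μ e c (shift σ z)} \ {0} :=
      hfin.isClosed.isOpen_compl.mem_nhds fun h => h.2 rfl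
    filter_upwards [self_mem_nhdsWithin, nhdsWithin_le_nhds hev,
      nhdsWithin_le_nhds (Icc_mem_nhds (by norm_num : (-1 : ℝ) < 0) one_pos)] with σ hne hσ hmem
    have hns : ¬ IsSingular μ e c (shift σ z) := fun hs => hσ ⟨⟨hmem, hs⟩, hne⟩
    exact ⟨(h.shift σ).isGenericImmersionAvoidingZero hk hl hkl hns, key (h.shift σ) hns⟩
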